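/- Let $n\ge 2$. **Oriented swap process.** Particles labelled $1,\dots,n$ start at time $0$ with particle $j$ in position $j$ of $\{1,\dots,n\}$. The pairs of adjacent positions $(k,k+1)$, $1\le k\le n-1$, carry independent rate-$1$ Poisson clocks. When the clock of $(k,k+1)$ rings, the particles with labels $i,j$ currently in positions $k,k+1$ (respectively) are swapped if $i<j$, and nothing happens otherwise. Let $U_n=(U_n(1),\dots,U_n(n-1))$, where $U_n(k)$ is the last time at which a swap occurs between positions $k$ and $k+1$. **Randomly growing Young diagram.** The boxes $(i,j)$, $i,j\ge 1$, $i+j\le n$, of the staircase shape $\delta_n=(n-1,n-2,\dots,1)$ ($i$ is the row and $j$ the column index) carry independent rate-$1$ Poisson clocks. Starting at time $0$ from the empty diagram, when the clock of box $(i,j)$ rings, this box is added to the current diagram $\lambda$ if $\lambda\cup\{(i,j)\}$ is a Young diagram, and nothing happens otherwise. Let $V_n=(V_n(1),\dots,V_n(n-1))$, where $V_n(k)$ is the time at which the box $(n-k,k)$ is added. **Theorem 1.3.** For $2\le n\le 6$, the random vectors $U_n$ and $V_n$ have the same joint distribution: $U_n\overset{D}{=}V_n$. -/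

import Mathlib

open MeasureTheory ProbabilityTheory

namespace OrientedSwap

/-- Independent Poisson clocks of rate `1`, indexed by `ι`. Here `gap i 0` is the time of the first
ring of clock `i`, and `gap i (j + 1)` is the waiting time between its rings number `j + 1` and
`j + 2`; all the waiting times are independent and exponentially distributed with rate `1`. -/
structure IsPoissonClocks {ι Ω : Type*} [MeasurableSpace Ω] (μ : Measure Ω)
    (gap : ι → ℕ → Ω → ℝ) : Prop where
  hasLaw_gap : ∀ i j, HasLaw (gap i j) (expMeasure 1) μ
  iIndepFun_gap : iIndepFun (fun p : ι × ℕ => gap p.1 p.2) μ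

section Clocks

variable {ι S : Type*}

/-- The set of times at which clock `i` rings. -/
def ringSet (gap : ι → ℕ → ℝ) (i : ι) : Set ℝ :=
  Set.range fun m : ℕ => ∑ j ∈ Finset.range (m + 1), gap i j

/-- `ringTime gap m` is the time of the `m`-th ring, all clocks taken together
(with `ringTime gap 0 = 0`, the starting time). -/
noncomputable def ringTime (gap : ι → ℕ → ℝ) : ℕ → ℝ
  | 0 => 0
  | m + 1 => sInf {r : ℝ | ringTime gap m < r ∧ ∃ i, r ∈ ringSet gap i}

open Classical in
/-- The state, just after the `m`-th ring, of the system that starts from `s₀` and jumps from `s` to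
`attempt i s` whenever clock `i` rings; so this is the state during the time interval
`[ringTime gap m, ringTime gap (m + 1))`. (For independent Poisson clocks, almost surely no two
clocks ever ring simultaneously, so that the ringing clock is unique.) -/
noncomputable def stateAfter (attempt : ι → S → S) (s₀ : S) (gap : ι → ℕ → ℝ) : ℕ → S
  | 0 => s₀
  | m + 1 =>
    if h : ∃ i, ringTime gap (m + 1) ∈ ringSet gap i then
      attempt h.choose (stateAfter attempt s₀ gap m)
    else stateAfter attempt s₀ gap m

end Clocks

section SwapProcess

/-- The position `k` (positions are numbered from `0`), as the left one of the pair `k, k + 1`. -/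
def leftPos {n : ℕ} (k : Fin (n - 1)) : Fin n := ⟨k, by omega⟩

/-- The position `k + 1`. -/
def rightPos {n : ℕ} (k : Fin (n - 1)) : Fin n := ⟨k + 1, by omega⟩

/-- Exchange the particles at positions `k` and `k + 1` of a configuration. A configuration is a
permutation `σ` of `Fin n`: `σ p` is the label of the particle at position `p`. -/
def swapAt {n : ℕ} (k : Fin (n - 1)) (σ : Equiv.Perm (Fin n)) : Equiv.Perm (Fin n) :=
  σ * Equiv.swap (leftPos k) (rightPos k)

/-- The particles at positions `k` and `k + 1` attempt to swap; they succeed if and only if their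
labels are in increasing order. -/
def attemptSwap {n : ℕ} (k : Fin (n - 1)) (σ : Equiv.Perm (Fin n)) : Equiv.Perm (Fin n) :=
  if σ (leftPos k) < σ (rightPos k) then swapAt k σ else σ

/-- The configuration of the oriented swap process on `n` particles after `m` rings. -/
noncomputable def swapProcess {n : ℕ} (gap : Fin (n - 1) → ℕ → ℝ) : ℕ → Equiv.Perm (Fin n) :=
  stateAfter attemptSwap 1 gap

/-- The last time at which a swap occurs between positions `k` and `k + 1`. -/
noncomputable def lastSwapTime {n : ℕ} (gap : Fin (n - 1) → ℕ → ℝ) (k : Fin (n - 1)) : ℝ :=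
  sSup {t : ℝ | ∃ m, t = ringTime gap (m + 1) ∧
    swapProcess gap (m + 1) = swapAt k (swapProcess gap m)}

end SwapProcess

section Growth

/-- A box `(i, j)` (row and column numbered from `0`) of the staircase shape
`δ_n = (n - 1, n - 2, …, 1)`. -/
abbrev StaircaseBox (n : ℕ) : Type := {c : ℕ × ℕ // c.1 + c.2 + 1 < n}

open Classical in
/-- The box `c` attempts to add itself to the Young diagram `Y`; it succeeds if and only if the
result is still a Young diagram. -/
noncomputable def attemptBox {n : ℕ} (c : StaircaseBox n) (Y : YoungDiagram) : YoungDiagram :=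
  if h : IsLowerSet (insert c.1 Y.cells : Set (ℕ × ℕ)) then
    ⟨insert c.1 Y.cells, by simpa using h⟩
  else Y

/-- The randomly growing Young diagram inside the staircase shape, after `m` rings. -/
noncomputable def growthProcess {n : ℕ} (gap : StaircaseBox n → ℕ → ℝ) : ℕ → YoungDiagram :=
  stateAfter attemptBox ⊥ gap

/-- The time at which the box `c` is added to the growing diagram. -/
noncomputable def boxTime {n : ℕ} (gap : StaircaseBox n → ℕ → ℝ) (c : StaircaseBox n) : ℝ :=
  sInf {t : ℝ | ∃ m, t = ringTime gap m ∧ c.1 ∈ growthProcess gap m}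

/-- The corner boxes of the staircase: with rows and columns numbered from `1`, and `k` running
through `1, …, n - 1`, this is the box `(n - k, k)`. -/
def cornerBox {n : ℕ} (k : Fin (n - 1)) : StaircaseBox n := ⟨(n - 2 - k, k), by simp only; omega⟩

end Growth

/-- The random vector `U_n` of last swap times of the oriented swap process. -/
noncomputable def U {n : ℕ} {Ω : Type*} (gap : Fin (n - 1) → ℕ → Ω → ℝ) (ω : Ω) :
    Fin (n - 1) → ℝ :=
  fun k => lastSwapTime (fun i j => gap i j ω) k

/-- The random vector `V_n` of the times at which the corner boxes of the staircase shape are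
added to the randomly growing Young diagram. -/
noncomputable def V {n : ℕ} {Ω : Type*} (gap : StaircaseBox n → ℕ → Ω → ℝ) (ω : Ω) :
    Fin (n - 1) → ℝ :=
  fun k => boxTime (fun c j => gap c j ω) (cornerBox k)

end OrientedSwap

/-! Both processes are finite Markov chains driven by rate `1` clocks, and both vectors consist of
hitting times of absorbing targets. For the growing diagram, the target is to contain a given
corner. For the swap process it is `swapDone k`: with positions numbered from `0`, the `k + 1`
largest labels fill the positions up to `k`. Only a swap between `k` and `k + 1` changes the set of
labels in those positions, so the target is reached by such a swap. From then on the label at `k`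
exceeds the one at `k + 1`, so that swap is the last one there. Hence `U` and `V` are almost surely
vectors of hitting times (`U_ae_eq`, `V_ae_eq`).

Let `x` have nonnegative real parts. As a function of the starting state `s`, the joint Laplace
transform `φ` of the hitting times satisfies `∑ i, (φ (attempt i s) - φ s) = X s * φ s`, where `X s`
is the sum of the `x k` over the targets not yet reached, and `φ s = 1` once all are reached
(`IsAbsorbing.isLaplaceTransform`). This rests on the restart property `map_restart`: for `N`
clocks, the first ring comes from a uniformly chosen clock after an exponential time of rate `N`,
and the clocks then start afresh, independently of both.

The two systems of equations are linked by an intertwining. To each diagram `y` in the staircase a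
table assigns an integer combination `v y` of permutations such that the swap generator maps `v y`
to the sum of `v (y + b) - v y` over the addable boxes `b`; `v ∅` is the identity; every permutation
in `v y` has reached exactly the targets that `y` has; and the coefficients of `v` at the full
staircase sum to `1`. Then `y ↦ φ (v y)` solves the equations of the growth process. Their solution
is unique, by induction on the number of missing boxes: the unknown at `y` is multiplied by the
number of addable boxes plus `X y`, whose real part is at least `1` until `y` is full. Thus both
transforms agree at the starting states (`laplaceTransform_eq`). Coefficients may be negative, so
this is an identity between linear functionals and not a coupling.

The table is verified by evaluation for each `n` from `2` to `6` (`checkTable_table`); apart from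
the encoding, which allows `n ≤ 8`, nothing else restricts `n` from above. Purely imaginary `x` give
the characteristic functions, which determine the joint law (`map_hitTimes_eq`). -/

namespace OrientedSwap

/-! ### Numerical codes of permutations and Young diagrams. -/

section Codes

/-- The digit number `k` of `c` in base `8`. -/
def digit (c k : ℕ) : ℕ := c / 8 ^ k % 8

theorem digit_sum (n : ℕ) (f : ℕ → ℕ) (hf : ∀ i, f i < 8) (p : ℕ) (hp : p < n) :
    digit (∑ i ∈ Finset.range n, f i * 8 ^ i) p = f p := by
  induction n generalizing f p with
  | zero => omega
  | succ n ih =>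
    have h : ∑ i ∈ Finset.range (n + 1), f i * 8 ^ i
        = f 0 + 8 * ∑ i ∈ Finset.range n, f (i + 1) * 8 ^ i := by
      rw [Finset.sum_range_succ', Finset.mul_sum, add_comm]
      congr 1
      · simp
      · exact Finset.sum_congr rfl fun i _ => by ring
    have h0 := hf 0
    cases p with
    | zero => rw [h, digit]; omega
    | succ p =>
      rw [h, digit, pow_succ', ← Nat.div_div_eq_div_mul,
        show (f 0 + 8 * ∑ i ∈ Finset.range n, f (i + 1) * 8 ^ i) / 8
          = ∑ i ∈ Finset.range n, f (i + 1) * 8 ^ i by omega]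
      exact ih (fun i => f (i + 1)) (fun i => hf _) p (by omega)

theorem sum_digit (n c : ℕ) (hc : c < 8 ^ n) :
    ∑ i ∈ Finset.range n, digit c i * 8 ^ i = c := by
  induction n generalizing c with
  | zero => simp at hc; simp [hc]
  | succ n ih =>
    have h := ih (c / 8) (by rw [pow_succ] at hc; omega)
    rw [Finset.sum_range_succ']
    have h2 : ∀ i, digit c (i + 1) * 8 ^ (i + 1) = 8 * (digit (c / 8) i * 8 ^ i) := fun i => by
      rw [digit, digit, Nat.div_div_eq_div_mul, pow_succ']; ring
    simp_rw [h2, ← Finset.mul_sum, h]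
    simp only [digit, pow_zero, Nat.div_one]
    omega

/-- The number whose base `8` digits are the labels of the particles in a configuration. -/
def permCode {n : ℕ} (σ : Equiv.Perm (Fin n)) : ℕ := ∑ p, (σ p : ℕ) * 8 ^ (p : ℕ)

variable {n : ℕ}

theorem digit_permCode (hn : n ≤ 8) (σ : Equiv.Perm (Fin n)) (p : Fin n) :
    digit (permCode σ) p = σ p := by
  have h : permCode σ
      = ∑ i ∈ Finset.range n, (if h : i < n then (σ ⟨i, h⟩ : ℕ) else 0) * 8 ^ i := by
    rw [permCode, Finset.sum_range]
    simp
  rw [h, digit_sum n _ _ p p.2]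
  · simp
  · intro i
    split_ifs with h
    · exact lt_of_lt_of_le (σ ⟨i, h⟩).2 hn
    · norm_num

theorem permCode_injective (hn : n ≤ 8) : Function.Injective (permCode (n := n)) := by
  intro σ τ h
  ext p
  rw [← digit_permCode hn σ p, h, digit_permCode hn]

/-- The number whose binary digits indicate which labels occur in a configuration. -/
def labelBits (n c : ℕ) : ℕ := (List.range n).foldr (fun p x => 2 ^ digit c p ||| x) 0

theorem testBit_labelBits (n c v : ℕ) :
    (labelBits n c).testBit v = true ↔ ∃ p < n, digit c p = v := by
  have h : ∀ L : List ℕ, (L.foldr (fun p x => 2 ^ digit c p ||| x) 0).testBit v = true ↔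
      ∃ p ∈ L, digit c p = v := by
    intro L
    induction L with
    | nil => simp
    | cons p L ih => simp [Nat.testBit_or, Nat.testBit_two_pow, ih]
  rw [labelBits, h]
  simp

/-- Is `c` the code of a configuration? -/
def isPermCode (n c : ℕ) : Bool :=
  Nat.blt c (8 ^ n) && Nat.beq (labelBits n c) (2 ^ n - 1)

/-- If the digits that occur are exactly `0, …, n - 1`, then position ↦ digit is a surjective
self-map of `Fin n`, hence a bijection. The bound `8 ^ n` makes `c` recoverable from its first `n`
digits. -/
theorem exists_permCode {c : ℕ} (h : isPermCode n c = true) :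
    ∃ σ : Equiv.Perm (Fin n), permCode σ = c := by
  simp only [isPermCode, Bool.and_eq_true, Nat.blt_eq, Nat.beq_eq] at h
  obtain ⟨h1, h2⟩ := h
  have h3 : ∀ v, v < n ↔ ∃ p < n, digit c p = v := fun v => by
    rw [← testBit_labelBits, h2, Nat.testBit_two_pow_sub_one, decide_eq_true_eq]
  let f : Fin n → Fin n := fun p => ⟨digit c p, (h3 _).2 ⟨p, p.2, rfl⟩⟩
  have hf : Function.Surjective f := fun v => by
    obtain ⟨p, hp, hpv⟩ := (h3 v).1 v.2
    exact ⟨⟨p, hp⟩, Fin.ext hpv⟩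
  refine ⟨Equiv.ofBijective f (Finite.injective_iff_bijective.1
    (Finite.injective_iff_surjective.2 hf)), ?_⟩
  rw [permCode, ← sum_digit n c h1, Finset.sum_range]
  simp [f]

/-- The code after exchanging the particles at positions `k` and `k + 1`. -/
def swapCode (k c : ℕ) : ℕ := c + 7 * digit c k * 8 ^ k - 7 * digit c (k + 1) * 8 ^ k

/-- Are the labels at positions `k` and `k + 1` in increasing order? -/
def isAscent (k c : ℕ) : Bool := Nat.blt (digit c k) (digit c (k + 1))

theorem leftPos_ne_rightPos (k : Fin (n - 1)) : leftPos k ≠ rightPos k := by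
  simp [leftPos, rightPos]

theorem isAscent_permCode (hn : n ≤ 8) (k : Fin (n - 1)) (σ : Equiv.Perm (Fin n)) :
    isAscent k (permCode σ) = true ↔ σ (leftPos k) < σ (rightPos k) := by
  have h1 := digit_permCode hn σ (leftPos k)
  have h2 := digit_permCode hn σ (rightPos k)
  simp only [leftPos, rightPos] at h1 h2
  rw [isAscent, Nat.blt_eq, h1, h2]
  rfl

/-- Exchanging digits `a`, `b` at places `k`, `k + 1` changes the number by `7 * (a - b) * 8 ^ k`.
Since `swapCode` adds before it subtracts, the subtraction in `ℕ` is not truncated. -/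
theorem swapCode_permCode (hn : n ≤ 8) (k : Fin (n - 1)) (σ : Equiv.Perm (Fin n)) :
    swapCode k (permCode σ) = permCode (swapAt k σ) := by
  have h1 := digit_permCode hn σ (leftPos k)
  have h2 := digit_permCode hn σ (rightPos k)
  simp only [leftPos, rightPos] at h1 h2
  have key : ∀ τ : Equiv.Perm (Fin n), permCode τ
      = (τ (leftPos k) : ℕ) * 8 ^ (k : ℕ) + (τ (rightPos k) : ℕ) * 8 ^ (k + 1 : ℕ)
        + ∑ p ∈ (Finset.univ.erase (leftPos k)).erase (rightPos k), (τ p : ℕ) * 8 ^ (p : ℕ) := by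
    intro τ
    rw [permCode, ← Finset.add_sum_erase _ _ (Finset.mem_univ (leftPos k)),
      ← Finset.add_sum_erase _ _ (Finset.mem_erase.2
        ⟨(leftPos_ne_rightPos k).symm, Finset.mem_univ (rightPos k)⟩), add_assoc]
    rfl
  have hrest : ∑ p ∈ (Finset.univ.erase (leftPos k)).erase (rightPos k),
        (swapAt k σ p : ℕ) * 8 ^ (p : ℕ)
      = ∑ p ∈ (Finset.univ.erase (leftPos k)).erase (rightPos k), (σ p : ℕ) * 8 ^ (p : ℕ) := by
    refine Finset.sum_congr rfl fun p hp => ?_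
    simp only [Finset.mem_erase, Finset.mem_univ, and_true] at hp
    rw [swapAt, Equiv.Perm.mul_apply, Equiv.swap_apply_of_ne_of_ne hp.2 hp.1]
  have e1 := key σ
  have e2 := key (swapAt k σ)
  rw [hrest] at e2
  simp only [swapAt, Equiv.Perm.mul_apply, Equiv.swap_apply_left, Equiv.swap_apply_right] at e2
  rw [swapCode, h1, h2, swapAt, e2, e1]
  simp only [leftPos, rightPos, pow_succ]
  generalize 8 ^ (k : ℕ) = X
  apply Nat.sub_eq_of_eq_add
  ring

/-- The particles with the `k + 1` largest labels occupy the positions up to `k`. -/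
def swapDone (k : Fin (n - 1)) (σ : Equiv.Perm (Fin n)) : Prop :=
  ∀ p : Fin n, (p : ℕ) ≤ k → n ≤ σ p + k + 1

/-- The analogue of `swapDone` for codes. -/
def doneCode (n k c : ℕ) : Bool :=
  (List.range (k + 1)).all fun p => Nat.ble n (digit c p + k + 1)

theorem doneCode_permCode (hn : n ≤ 8) (k : Fin (n - 1)) (σ : Equiv.Perm (Fin n)) :
    doneCode n k (permCode σ) = true ↔ swapDone k σ := by
  simp only [doneCode, List.all_eq_true, List.mem_range, Nat.ble_eq]
  constructor
  · intro h p hp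
    rw [← digit_permCode hn σ p]
    exact h p (by omega)
  · intro h p hp
    have := h ⟨p, by omega⟩ (by simp only; omega)
    rwa [← digit_permCode hn σ] at this

/-- The boxes of the staircase shape. -/
def boxes (n : ℕ) : List (ℕ × ℕ) :=
  (List.range (n - 1)).flatMap fun i => (List.range (n - 1 - i)).map fun j => (i, j)

theorem mem_boxes {b : ℕ × ℕ} : b ∈ boxes n ↔ b.1 + b.2 + 1 < n := by
  obtain ⟨i, j⟩ := b
  simp only [boxes, List.mem_flatMap, List.mem_map, List.mem_range, Prod.mk.injEq]
  constructor
  · rintro ⟨i', h1, j', h2, rfl, rfl⟩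
    omega
  · intro h
    exact ⟨i, by omega, j, by omega, rfl, rfl⟩

theorem nodup_boxes : (boxes n).Nodup := by
  rw [boxes, List.nodup_flatMap]
  refine ⟨fun i _ => List.nodup_range.map fun a b h => by simpa using h, ?_⟩
  refine List.Pairwise.imp ?_ (List.nodup_range (n := n - 1))
  intro a b hab x h1 h2
  simp only [List.mem_map] at h1 h2
  obtain ⟨_, _, rfl⟩ := h1
  obtain ⟨_, _, h⟩ := h2
  exact hab (Prod.ext_iff.1 h).1.symm

instance (n : ℕ) : Fintype (StaircaseBox n) :=
  Fintype.subtype (boxes n).toFinset fun b => by simp [mem_boxes]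

theorem sum_staircaseBox {M : Type*} [AddCommMonoid M] (f : ℕ × ℕ → M) :
    ∑ c : StaircaseBox n, f c.1 = ((boxes n).map f).sum := by
  rw [← List.sum_toFinset _ nodup_boxes]
  exact (Finset.sum_subtype (boxes n).toFinset (p := fun c => c.1 + c.2 + 1 < n)
    (fun b => by simp [mem_boxes]) f).symm

/-- The position of the binary digit which stands for a box. -/
def boxIndex (b : ℕ × ℕ) : ℕ := 8 * b.1 + b.2

/-- The number whose binary digits are the indicators of the boxes of a diagram. -/
def diagramCode (Y : YoungDiagram) : ℕ := ∑ b ∈ Y.cells, 2 ^ boxIndex b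

/-- The Young diagram is contained in the staircase shape. -/
def InStaircase (n : ℕ) (Y : YoungDiagram) : Prop := ∀ b ∈ Y, b.1 + b.2 + 1 < n

/-- Columns stay below `8` inside the staircase, so `boxIndex` is injective there and the code is a
sum of distinct powers of `2`. -/
theorem testBit_diagramCode (hn : n ≤ 8) {Y : YoungDiagram} (hY : InStaircase n Y)
    {b : ℕ × ℕ} (hb : b.1 + b.2 + 1 < n) :
    (diagramCode Y).testBit (boxIndex b) = true ↔ b ∈ Y := by
  have hinj : ∀ x ∈ Y.cells, ∀ z : ℕ × ℕ, z.1 + z.2 + 1 < n → boxIndex x = boxIndex z → x = z := by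
    intro x hx z hz h
    have := hY x hx
    simp only [boxIndex] at h
    ext <;> omega
  have h : diagramCode Y = ∑ e ∈ Y.cells.image boxIndex, 2 ^ e := by
    rw [diagramCode, Finset.sum_image]
    intro x hx z hz h
    exact hinj x hx z (hY z hz) h
  rw [← Nat.mem_bitIndices, ← List.mem_toFinset, h, Finset.toFinset_bitIndices_sum_two_pow,
    Finset.mem_image]
  constructor
  · rintro ⟨x, hx, hxb⟩
    rwa [← hinj x hx b hb hxb]
  · intro h
    exact ⟨b, h, rfl⟩

/-- Can the box be added to the diagram with the given code? -/
def addable (y : ℕ) (b : ℕ × ℕ) : Bool :=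
  !y.testBit (8 * b.1 + b.2) &&
    ((Nat.beq b.1 0 || y.testBit (8 * (b.1 - 1) + b.2)) &&
      (Nat.beq b.2 0 || y.testBit (8 * b.1 + (b.2 - 1))))

/-- As `Y` is itself a lower set, only the upper and left neighbours of the new box matter: any
other box below it lies below one of these two. -/
theorem isLowerSet_insert_iff (Y : YoungDiagram) {b : ℕ × ℕ} :
    IsLowerSet (insert b Y.cells : Set (ℕ × ℕ)) ↔
      (b.1 = 0 ∨ (b.1 - 1, b.2) ∈ Y) ∧ (b.2 = 0 ∨ (b.1, b.2 - 1) ∈ Y) := by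
  obtain ⟨i, j⟩ := b
  constructor
  · intro h
    constructor
    · rcases Nat.eq_zero_or_pos i with hi | hi
      · exact Or.inl hi
      · right
        have := h (a := (i, j)) (b := (i - 1, j)) ⟨by simp, le_rfl⟩ (Set.mem_insert _ _)
        rcases this with h | h
        · simp at h; omega
        · exact h
    · rcases Nat.eq_zero_or_pos j with hj | hj
      · exact Or.inl hj
      · right
        have := h (a := (i, j)) (b := (i, j - 1)) ⟨le_rfl, by simp⟩ (Set.mem_insert _ _)
        rcases this with h | h
        · simp at h; omega
        · exact h
  · rintro ⟨h1, h2⟩ x z hzx hx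
    rcases hx with rfl | hx
    · obtain ⟨hz1, hz2⟩ := hzx
      simp only at hz1 hz2 h1 h2
      by_cases hz : z = (i, j)
      · exact Or.inl hz
      · right
        by_cases h : z.1 < i
        · rcases h1 with h1 | h1
          · omega
          · exact Y.isLowerSet (a := (i - 1, j)) ⟨by simp only; omega, hz2⟩ h1
        · have : z.2 < j := by
            rcases lt_or_eq_of_le hz2 with h' | h'
            · exact h'
            · exact absurd (Prod.ext (by simp only; omega) h') hz
          rcases h2 with h2 | h2
          · omega
          · exact Y.isLowerSet (a := (i, j - 1)) ⟨hz1, by simp only; omega⟩ h2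
    · exact Or.inr (Y.isLowerSet hzx hx)

theorem addable_diagramCode (hn : n ≤ 8) {Y : YoungDiagram} (hY : InStaircase n Y)
    {b : ℕ × ℕ} (hb : b.1 + b.2 + 1 < n) :
    addable (diagramCode Y) b = true ↔
      b ∉ Y ∧ IsLowerSet (insert b Y.cells : Set (ℕ × ℕ)) := by
  obtain ⟨i, j⟩ := b
  simp only at hb
  have h1 := testBit_diagramCode hn hY (b := (i, j)) (by simp only; omega)
  -- For `i = 0` the subtraction truncates, which is harmless: the box is still in the staircase,
  -- and `addable` tests that case separately. The same applies to `j - 1`.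
  have h2 := testBit_diagramCode hn hY (b := (i - 1, j)) (by simp only; omega)
  have h3 := testBit_diagramCode hn hY (b := (i, j - 1)) (by simp only; omega)
  simp only [boxIndex] at h1 h2 h3
  simp only [addable, isLowerSet_insert_iff, Bool.and_eq_true, Bool.not_eq_true', Bool.or_eq_true,
    h2, h3, Nat.beq_eq]
  rw [← h1, Bool.not_eq_true]

theorem mem_attemptBox {Y : YoungDiagram} {c : StaircaseBox n}
    (h : IsLowerSet (insert c.1 Y.cells : Set (ℕ × ℕ))) (b : ℕ × ℕ) :
    b ∈ attemptBox c Y ↔ b = c.1 ∨ b ∈ Y := by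
  rw [attemptBox, dif_pos h, ← YoungDiagram.mem_cells, Finset.mem_insert, YoungDiagram.mem_cells]

theorem attemptBox_of_mem {Y : YoungDiagram} {c : StaircaseBox n} (h : c.1 ∈ Y) :
    attemptBox c Y = Y := by
  rw [attemptBox]
  split_ifs
  · ext1
    exact Finset.insert_eq_of_mem h
  · rfl

theorem attemptBox_of_not_isLowerSet {Y : YoungDiagram} {c : StaircaseBox n}
    (h : ¬ IsLowerSet (insert c.1 Y.cells : Set (ℕ × ℕ))) : attemptBox c Y = Y :=
  dif_neg h

theorem diagramCode_attemptBox {Y : YoungDiagram} {c : StaircaseBox n} (hc : c.1 ∉ Y)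
    (h : IsLowerSet (insert c.1 Y.cells : Set (ℕ × ℕ))) :
    diagramCode (attemptBox c Y) = diagramCode Y + 2 ^ boxIndex c.1 := by
  rw [attemptBox, dif_pos h, diagramCode, diagramCode, Finset.sum_insert hc, add_comm]

theorem InStaircase.attemptBox {Y : YoungDiagram} (hY : InStaircase n Y) (c : StaircaseBox n) :
    InStaircase n (attemptBox c Y) := by
  by_cases h : IsLowerSet (insert c.1 Y.cells : Set (ℕ × ℕ))
  · intro b hb
    rcases (mem_attemptBox h b).1 hb with rfl | hb
    · exact c.2
    · exact hY b hb
  · rwa [attemptBox_of_not_isLowerSet h]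

end Codes

/-! ### Formal combinations of codes and the generator of the swap process. -/

section Vectors

/-- A formal combination of codes of configurations, with integer coefficients. -/
abbrev Vec := List (ℕ × ℤ)

/-- The value at a formal combination of the linear extension of `f`. -/
def Vec.eval (f : ℕ → ℂ) (v : Vec) : ℂ := (v.map fun a => (a.2 : ℂ) * f a.1).sum

/-- The sum of two formal combinations, sorted by codes if both of them are. It is stated with
recursors, which the kernel evaluates fast. -/
def mergeVec (l : Vec) : Vec → Vec :=
  List.rec (motive := fun _ => Vec → Vec) (fun l' => l')
    (fun a l f l' => List.rec (motive := fun _ => Vec) (a :: l)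
      (fun b l' r => Bool.rec (motive := fun _ => Vec) (a :: f (b :: l'))
        (Bool.rec (motive := fun _ => Vec) (b :: r) ((a.1, a.2 + b.2) :: f l') (Nat.ble a.1 b.1))
        (Nat.ble b.1 a.1)) l') l

/-- Merge neighbours in a list of formal combinations. -/
def mergePairs : List Vec → List Vec
  | l :: l' :: ls => mergeVec l l' :: mergePairs ls
  | ls => ls

/-- Merge a list of formal combinations, in `m` rounds of pairwise merging and a final one. -/
def mergeAll : ℕ → List Vec → Vec
  | 0, ls => ls.foldr mergeVec []
  | m + 1, ls => mergeAll m (mergePairs ls)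

/-- Sort a formal combination by codes. -/
def sortVec (l : Vec) : Vec := mergeAll 10 (l.map fun a => [a])

/-- A multiple of a formal combination. -/
def smulVec (z : ℤ) (l : Vec) : Vec := l.map fun a => (a.1, z * a.2)

/-- Do all coefficients vanish? -/
def isZeroVec (l : Vec) : Bool := l.all fun a => decide (a.2 = 0)

variable (f : ℕ → ℂ)

@[simp] theorem Vec.eval_nil : Vec.eval f [] = 0 := rfl

@[simp] theorem Vec.eval_cons (a : ℕ × ℤ) (l : Vec) :
    Vec.eval f (a :: l) = (a.2 : ℂ) * f a.1 + Vec.eval f l := by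
  simp [Vec.eval]

@[simp] theorem Vec.eval_append (l l' : Vec) :
    Vec.eval f (l ++ l') = Vec.eval f l + Vec.eval f l' := by
  simp [Vec.eval]

/-- The usual merge recursion, recovered from the recursors by `rfl`. Equal codes are collected in
one term, which is where cancellation takes place. -/
theorem mergeVec_cons_cons (a b : ℕ × ℤ) (l l' : Vec) :
    mergeVec (a :: l) (b :: l') = if a.1 < b.1 then a :: mergeVec l (b :: l')
      else if a.1 ≤ b.1 then (a.1, a.2 + b.2) :: mergeVec l l' else b :: mergeVec (a :: l) l' := by
  have h : mergeVec (a :: l) (b :: l') = Bool.rec (motive := fun _ => Vec)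
      (a :: mergeVec l (b :: l'))
      (Bool.rec (motive := fun _ => Vec) (b :: mergeVec (a :: l) l')
        ((a.1, a.2 + b.2) :: mergeVec l l') (Nat.ble a.1 b.1)) (Nat.ble b.1 a.1) := rfl
  rw [h]
  rcases h1 : Nat.ble b.1 a.1 with _ | _
  · rw [if_pos (not_le.1 fun h => by simp [Nat.ble_eq_true_of_le h] at h1)]
  · rw [if_neg (not_lt.2 (Nat.le_of_ble_eq_true h1))]
    rcases h2 : Nat.ble a.1 b.1 with _ | _
    · rw [if_neg fun h => by simp [Nat.ble_eq_true_of_le h] at h2]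
    · rw [if_pos (Nat.le_of_ble_eq_true h2)]

-- No sortedness is assumed. The order only decides whether equal codes meet and cancel, so unsorted
-- input can make a check fail but never wrongly succeed.
@[simp] theorem Vec.eval_mergeVec (l l' : Vec) :
    Vec.eval f (mergeVec l l') = Vec.eval f l + Vec.eval f l' := by
  induction l generalizing l' with
  | nil => simp [mergeVec]
  | cons a l ih =>
    induction l' with
    | nil => simp [mergeVec]
    | cons b l' ih' =>
      rw [mergeVec_cons_cons]
      split_ifs with h1 h2
      · simp only [Vec.eval_cons, ih]
        ring
      · simp only [Vec.eval_cons, ih, Int.cast_add, le_antisymm (not_lt.1 h1) h2]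
        ring
      · simp only [Vec.eval_cons, ih']
        ring

theorem Vec.eval_mergePairs (ls : List Vec) :
    ((mergePairs ls).map (Vec.eval f)).sum = (ls.map (Vec.eval f)).sum := by
  induction ls using mergePairs.induct with
  | case1 l l' ls ih => simp [mergePairs, ih, add_assoc]
  | case2 ls h => rw [mergePairs]; exact h

theorem Vec.eval_mergeAll (m : ℕ) (ls : List Vec) :
    Vec.eval f (mergeAll m ls) = (ls.map (Vec.eval f)).sum := by
  induction m generalizing ls with
  | zero =>
    rw [mergeAll]
    induction ls with
    | nil => rfl
    | cons l ls ih => simp [ih]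
  | succ m ih => rw [mergeAll, ih, Vec.eval_mergePairs]

@[simp] theorem Vec.eval_sortVec (l : Vec) : Vec.eval f (sortVec l) = Vec.eval f l := by
  rw [sortVec, Vec.eval_mergeAll, List.map_map]
  simp only [Vec.eval, Function.comp_def, List.map_cons, List.map_nil, List.sum_singleton]

@[simp] theorem Vec.eval_smulVec (z : ℤ) (l : Vec) :
    Vec.eval f (smulVec z l) = z * Vec.eval f l := by
  induction l with
  | nil => simp [smulVec]
  | cons a l ih =>
    rw [smulVec] at ih ⊢
    simp only [List.map_cons, Vec.eval_cons, ih, Int.cast_mul]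
    ring

theorem Vec.eval_eq_zero {l : Vec} (h : isZeroVec l = true) : Vec.eval f l = 0 := by
  induction l with
  | nil => rfl
  | cons a l ih =>
    simp only [isZeroVec, List.all_cons, Bool.and_eq_true, decide_eq_true_eq] at h
    simp [h.1, ih h.2]

/-- The terms of the combination to which the swap at `k` applies, after that swap. -/
def swapImage (k : ℕ) (l : Vec) : Vec :=
  (l.filter fun a => isAscent k a.1).map fun a => (swapCode k a.1, a.2)

/-- The number of ascents of a configuration. -/
def ascents (n c : ℕ) : ℕ := ((List.range (n - 1)).filter fun k => isAscent k c).length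

/-- The generator of the oriented swap process on `n` particles, applied to a combination. -/
def generator (n : ℕ) (l : Vec) : Vec :=
  mergeVec (sortVec ((List.range (n - 1)).flatMap fun k => swapImage k l))
    (l.map fun a => (a.1, -(ascents n a.1 : ℤ) * a.2))

/-- Duality: the generator acting on combinations is the transpose of the generator acting on
functions. The gain terms (`h1`) come from `swapImage`, the loss terms (`h2`) from the number of
ascents. -/
theorem Vec.eval_generator (n : ℕ) (l : Vec) :
    Vec.eval f (generator n l) = Vec.eval (fun c => ((List.range (n - 1)).map fun k =>
      if isAscent k c then f (swapCode k c) - f c else 0).sum) l := by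
  have h1 : ∀ K : List ℕ, Vec.eval f (K.flatMap fun k => swapImage k l)
      = Vec.eval (fun c => (K.map fun k =>
        if isAscent k c then f (swapCode k c) else 0).sum) l := by
    intro K
    induction K with
    | nil => simp [Vec.eval]
    | cons k K ih =>
      rw [List.flatMap_cons, Vec.eval_append, ih]
      clear ih
      induction l with
      | nil => simp [swapImage]
      | cons a l ih =>
        simp only [Vec.eval_cons, List.map_cons, List.sum_cons] at ih ⊢
        rw [mul_add, ← ih]
        rcases h : isAscent k a.1 with _ | _ <;> simp [swapImage, h] <;> ring
  have h2 : ∀ c, ((List.range (n - 1)).map fun k =>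
      if isAscent k c then f (swapCode k c) - f c else 0).sum
      = ((List.range (n - 1)).map fun k => if isAscent k c then f (swapCode k c) else 0).sum
        - (ascents n c : ℂ) * f c := by
    intro c
    rw [ascents]
    induction List.range (n - 1) with
    | nil => simp
    | cons k K ih =>
      rw [List.map_cons, List.sum_cons, ih, List.map_cons, List.sum_cons]
      rcases h : isAscent k c with _ | _
      · simp [h]
      · simp [h]
        ring
  simp_rw [h2]
  rw [generator, Vec.eval_mergeVec, Vec.eval_sortVec, h1]
  clear h1 h2
  induction l with
  | nil => simp
  | cons a l ih =>
    simp only [List.map_cons, Vec.eval_cons, Int.cast_mul, Int.cast_neg, Int.cast_natCast] at ih ⊢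
    linear_combination ih

end Vectors

/-! ### Boolean conditions that express the intertwining. -/

section Check

/-- Read a formal combination off a number: each term takes `24` binary digits, `6` of them for the
coefficient and the others for the code. -/
def unpack : ℕ → ℕ → Vec
  | 0, _ => []
  | m + 1, v => bif Nat.beq v 0 then [] else
      (v % 2 ^ 24 / 64, (v % 64 : ℕ) - 32) :: unpack m (v / 2 ^ 24)

/-- The value at `y` of a function given by a table. -/
def lookupVec (y : ℕ) : List (ℕ × Vec) → Vec
  | [] => []
  | a :: l => bif Nat.beq a.1 y then a.2 else lookupVec y l

/-- All terms of `v` are configurations in which exactly those positions are done whose corner box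
belongs to the diagram `y`. -/
def checkSupport (n y : ℕ) (v : Vec) : Bool :=
  v.all fun a => isPermCode n a.1 && (List.range (n - 1)).all fun k =>
    doneCode n k a.1 == y.testBit (boxIndex (n - 2 - k, k))

/-- The generator maps the combination of the diagram `y` to the combination obtained from the
generator of the growth process. -/
def checkGenerator (n : ℕ) (T : List (ℕ × Vec)) (y : ℕ) (v : Vec) : Bool :=
  let B := (boxes n).filter (addable y)
  isZeroVec (mergeVec (generator n v)
    (mergeVec (smulVec B.length v)
      (smulVec (-1) (B.foldr (fun b acc => mergeVec (lookupVec (y + 2 ^ boxIndex b) T) acc) []))))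

/-- The conditions on the combination `v` of the diagram `y`. -/
def checkEntry (n : ℕ) (T : List (ℕ × Vec)) (y : ℕ) (v : Vec) : Bool :=
  checkSupport n y v &&
    (((boxes n).all fun b => !addable y b || T.any fun a => Nat.beq a.1 (y + 2 ^ boxIndex b)) &&
      ((!((List.range (n - 1)).all fun k => y.testBit (boxIndex (n - 2 - k, k))) ||
          decide ((v.map Prod.snd).sum = 1)) &&
        checkGenerator n T y v))

/-- `T` intertwines the growth process with the oriented swap process on `n` particles. -/
def checkTable (n : ℕ) (T : List (ℕ × Vec)) : Bool :=
  (T.any fun a => Nat.beq a.1 0) &&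
    (decide (lookupVec 0 T = [(permCode (1 : Equiv.Perm (Fin n)), 1)]) &&
      T.all fun a => checkEntry n T a.1 (lookupVec a.1 T))

end Check

/-! ### An intertwining table forces equality of the Laplace transforms. -/

section Soundness

open Classical in
/-- The equations between the joint Laplace transforms `φ s`, at the point `x`, of the times at
which the targets `done k` are reached from the states `s` of a system driven by rate `1` clocks. -/
structure IsLaplaceTransform {ι κ S : Type*} [Fintype ι] [Fintype κ] (attempt : ι → S → S)
    (done : κ → S → Prop) (x : κ → ℂ) (φ : S → ℂ) : Prop where
  sum_sub_eq : ∀ s, ∑ i, (φ (attempt i s) - φ s) = (∑ k, if done k s then 0 else x k) * φ s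
  eq_one : ∀ s, (∀ k, done k s) → φ s = 1

/-- The corner box number `k` belongs to the diagram. -/
def boxDone {n : ℕ} (k : Fin (n - 1)) (Y : YoungDiagram) : Prop := (cornerBox k).1 ∈ Y

variable {n : ℕ}

theorem lookupVec_spec {y : ℕ} {T : List (ℕ × Vec)} {p : ℕ → Vec → Bool}
    (h : (T.all fun a => p a.1 (lookupVec a.1 T)) = true)
    (hy : (T.any fun a => Nat.beq a.1 y) = true) : p y (lookupVec y T) = true := by
  obtain ⟨a, ha, hay⟩ := List.any_eq_true.1 hy
  rw [Nat.beq_eq] at hay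
  subst hay
  exact List.all_eq_true.1 h a ha

theorem attemptSwap_of_not_lt {k : Fin (n - 1)} {σ : Equiv.Perm (Fin n)}
    (h : ¬ σ (leftPos k) < σ (rightPos k)) : attemptSwap k σ = σ := if_neg h

theorem attemptSwap_of_lt {k : Fin (n - 1)} {σ : Equiv.Perm (Fin n)}
    (h : σ (leftPos k) < σ (rightPos k)) : attemptSwap k σ = swapAt k σ := if_pos h

theorem cornerBox_lt (k : Fin (n - 1)) : (cornerBox k).1.1 + (cornerBox k).1.2 + 1 < n :=
  (cornerBox k).2

theorem boxDone_iff (hn : n ≤ 8) {Y : YoungDiagram} (hY : InStaircase n Y) (k : Fin (n - 1)) :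
    boxDone k Y ↔ (diagramCode Y).testBit (boxIndex (n - 2 - k, k)) = true :=
  (testBit_diagramCode hn hY (cornerBox_lt k)).symm

/-- Some box of the staircase outside the diagram can be added, if a corner is missing. -/
theorem exists_addable {Y : YoungDiagram} {c : StaircaseBox n} (hc : c.1 ∉ Y) :
    ∃ c : StaircaseBox n, c.1 ∉ Y ∧ IsLowerSet (insert c.1 Y.cells : Set (ℕ × ℕ)) := by
  classical
  -- The neighbours above and to the left of a missing box with least coordinate sum have a smaller
  -- sum, so they belong to the diagram.
  obtain ⟨b, hb, hmin⟩ := Finset.exists_min_image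
    (Finset.univ.filter fun c : StaircaseBox n => c.1 ∉ Y) (fun c => c.1.1 + c.1.2)
    ⟨c, by simpa using hc⟩
  simp only [Finset.mem_filter, Finset.mem_univ, true_and] at hb hmin
  refine ⟨b, hb, ?_⟩
  rw [isLowerSet_insert_iff]
  have hb2 := b.2
  constructor
  · by_contra! h
    have := hmin ⟨(b.1.1 - 1, b.1.2), by simp only; omega⟩ h.2
    simp only at this
    omega
  · by_contra! h
    have := hmin ⟨(b.1.1, b.1.2 - 1), by simp only; omega⟩ h.2
    simp only at this
    omega

theorem sum_map_range (m : ℕ) (f : ℕ → ℂ) :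
    ((List.range m).map f).sum = ∑ i ∈ Finset.range m, f i := by
  induction m with
  | zero => rfl
  | succ m ih => rw [List.range_succ, List.map_append, List.sum_append, ih, Finset.sum_range_succ,
      List.map_singleton, List.sum_singleton]

/-- All permutations in `v` have reached the same targets, namely those marked in `y`. So the factor
in the equation for `φ` is the same for every term and comes out of the combination.
`Function.extend permCode φ 0` is `φ` read as a function of codes. -/
theorem eval_checkSupport (hn : n ≤ 8) {φ : Equiv.Perm (Fin n) → ℂ} {x : Fin (n - 1) → ℂ}
    (hφ : IsLaplaceTransform attemptSwap swapDone x φ) {y : ℕ} {v : Vec}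
    (h : checkSupport n y v = true) :
    Vec.eval (Function.extend permCode φ 0) (generator n v)
      = (∑ k : Fin (n - 1), if y.testBit (boxIndex (n - 2 - k, k)) then 0 else x k)
        * Vec.eval (Function.extend permCode φ 0) v := by
  classical
  have hext := (permCode_injective hn).extend_apply φ 0
  rw [Vec.eval_generator]
  induction v with
  | nil => simp
  | cons a v ih =>
    simp only [checkSupport, List.all_cons, Bool.and_eq_true] at h
    obtain ⟨⟨h1, h2⟩, h3⟩ := h
    rw [Vec.eval_cons, Vec.eval_cons, ih h3, mul_add]
    congr 1
    obtain ⟨σ, hσ⟩ := exists_permCode h1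
    have h4 : ∀ k : Fin (n - 1),
        (y.testBit (boxIndex (n - 2 - k, k)) = true) = swapDone k σ := by
      intro k
      have h5 := List.all_eq_true.1 h2 k (List.mem_range.2 k.2)
      rw [beq_iff_eq, ← hσ] at h5
      rw [← h5, doneCode_permCode hn]
    simp_rw [h4]
    rw [← hσ, hext, mul_left_comm]
    congr 1
    rw [← hφ.sum_sub_eq, sum_map_range, Finset.sum_range]
    refine Finset.sum_congr rfl fun k _ => ?_
    have h5 := isAscent_permCode hn k σ
    split_ifs with h6
    · rw [attemptSwap_of_lt (h5.1 h6), swapCode_permCode hn, hext]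
    · rw [attemptSwap_of_not_lt fun h => h6 (h5.2 h), sub_self]

theorem eval_eq_of_all_done (hn : n ≤ 8) {φ : Equiv.Perm (Fin n) → ℂ} {x : Fin (n - 1) → ℂ}
    (hφ : IsLaplaceTransform attemptSwap swapDone x φ) {y : ℕ} {v : Vec}
    (h : checkSupport n y v = true)
    (hy : ∀ k : Fin (n - 1), y.testBit (boxIndex (n - 2 - k, k)) = true) :
    Vec.eval (Function.extend permCode φ 0) v = ((v.map Prod.snd).sum : ℤ) := by
  have hext := (permCode_injective hn).extend_apply φ 0
  induction v with
  | nil => simp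
  | cons a v ih =>
    simp only [checkSupport, List.all_cons, Bool.and_eq_true] at h
    obtain ⟨⟨h1, h2⟩, h3⟩ := h
    obtain ⟨σ, hσ⟩ := exists_permCode h1
    have h4 : φ σ = 1 := by
      refine hφ.eq_one σ fun k => ?_
      have h5 := List.all_eq_true.1 h2 k (List.mem_range.2 k.2)
      rw [beq_iff_eq, ← hσ, hy k] at h5
      rwa [← doneCode_permCode hn]
    rw [Vec.eval_cons, ih h3, ← hσ, hext, h4]
    simp

/-- The list that the check finds to be zero is the generator of `v`, plus `v` times the number of
addable boxes, minus the sum of the table entries of the enlarged diagrams. -/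
theorem eval_checkGenerator (f : ℕ → ℂ) {T : List (ℕ × Vec)} {y : ℕ} {v : Vec}
    (h : checkGenerator n T y v = true) :
    Vec.eval f (generator n v) = ((boxes n).map fun b => if addable y b then
      Vec.eval f (lookupVec (y + 2 ^ boxIndex b) T) - Vec.eval f v else 0).sum := by
  have h1 := Vec.eval_eq_zero f h
  have h2 : ∀ L : List (ℕ × ℕ), Vec.eval f
      ((L.filter (addable y)).foldr
        (fun b acc => mergeVec (lookupVec (y + 2 ^ boxIndex b) T) acc) [])
        - ((L.filter (addable y)).length : ℂ) * Vec.eval f v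
      = (L.map fun b => if addable y b then
        Vec.eval f (lookupVec (y + 2 ^ boxIndex b) T) - Vec.eval f v else 0).sum := by
    intro L
    induction L with
    | nil => simp
    | cons b L ih =>
      rw [List.map_cons, List.sum_cons, ← ih]
      rcases h : addable y b with _ | _
      · simp [h]
      · simp only [h, List.filter_cons_of_pos, List.foldr_cons, Vec.eval_mergeVec,
          List.length_cons, Nat.cast_add, Nat.cast_one, if_true]
        ring
  rw [← h2]
  simp only [Vec.eval_mergeVec, Vec.eval_smulVec] at h1
  push_cast at h1
  linear_combination h1

/-- If a table intertwines the two processes, then the Laplace transforms agree. -/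
theorem laplaceTransform_eq (hn : n ≤ 8) {T : List (ℕ × Vec)} (hT : checkTable n T = true)
    {x : Fin (n - 1) → ℂ} (hx : ∀ k, 0 ≤ (x k).re)
    {φ : Equiv.Perm (Fin n) → ℂ} (hφ : IsLaplaceTransform attemptSwap swapDone x φ)
    {ψ : YoungDiagram → ℂ} (hψ : IsLaplaceTransform (attemptBox (n := n)) boxDone x ψ) :
    φ 1 = ψ ⊥ := by
  classical
  simp only [checkTable, Bool.and_eq_true, decide_eq_true_eq] at hT
  obtain ⟨h0, h1, hall⟩ := hT
  set F : ℕ → ℂ := fun y => Vec.eval (Function.extend permCode φ 0) (lookupVec y T) with hF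
  -- Uniqueness for the equations of the growth process: `F` and `ψ` are compared by strong
  -- induction on the number `m` of missing boxes. The membership in `T` is carried along, since
  -- `checkEntry` supplies it for the enlarged diagrams.
  have key : ∀ m : ℕ, ∀ Y : YoungDiagram, InStaircase n Y →
      (T.any fun a => Nat.beq a.1 (diagramCode Y)) = true →
      (Finset.univ.filter fun c : StaircaseBox n => c.1 ∉ Y).card = m →
      F (diagramCode Y) = ψ Y := by
    intro m
    induction m using Nat.strong_induction_on with
    | _ m ih =>
    intro Y hY hmem hm
    have hc := lookupVec_spec (p := checkEntry n T) hall hmem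
    simp only [checkEntry, Bool.and_eq_true] at hc
    obtain ⟨hs, hb, hd, hg⟩ := hc
    by_cases hfull : ∀ k, boxDone (n := n) k Y
    · rw [hψ.eq_one Y hfull, hF]
      simp only
      have hfull' : ∀ k : Fin (n - 1),
          (diagramCode Y).testBit (boxIndex (n - 2 - k, k)) = true := fun k =>
        (boxDone_iff hn hY k).1 (hfull k)
      rw [eval_eq_of_all_done hn hφ hs hfull']
      have : ((List.range (n - 1)).all fun k =>
          (diagramCode Y).testBit (boxIndex (n - 2 - k, k))) = true := by
        rw [List.all_eq_true]
        intro k hk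
        exact hfull' ⟨k, List.mem_range.1 hk⟩
      rw [this] at hd
      simp only [Bool.not_true, Bool.false_or, decide_eq_true_eq] at hd
      rw [hd]
      simp
    · have e1 := eval_checkSupport hn hφ hs
      have e2 := eval_checkGenerator (Function.extend permCode φ 0) hg
      have hX : (∑ k : Fin (n - 1), if (diagramCode Y).testBit (boxIndex (n - 2 - k, k)) then 0
          else x k) = ∑ k : Fin (n - 1), if boxDone k Y then 0 else x k :=
        Finset.sum_congr rfl fun k _ => by simp only [boxDone_iff hn hY]
      have e3 := hψ.sum_sub_eq Y
      rw [hX] at e1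
      set X := ∑ k : Fin (n - 1), if boxDone k Y then 0 else x k with hXdef
      have hterm : ∀ c : StaircaseBox n, ψ (attemptBox c Y) - ψ Y
          = if addable (diagramCode Y) c.1 then F (diagramCode Y + 2 ^ boxIndex c.1) - ψ Y
            else 0 := by
        intro c
        have hadd := addable_diagramCode hn hY c.2
        split_ifs with h
        · obtain ⟨h2, h3⟩ := hadd.1 h
          have hcode := diagramCode_attemptBox h2 h3
          rw [← hcode]
          refine congrArg (· - ψ Y) (ih _ ?_ (attemptBox c Y) (hY.attemptBox c) ?_ rfl).symm
          · rw [← hm]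
            refine Finset.card_lt_card (Finset.ssubset_iff_of_subset ?_ |>.2 ⟨c, ?_, ?_⟩)
            · intro d hd
              simp only [Finset.mem_filter, Finset.mem_univ, true_and, mem_attemptBox h3] at hd ⊢
              exact fun h => hd (Or.inr h)
            · simpa using h2
            · simp [mem_attemptBox h3]
          · rw [hcode]
            have := List.all_eq_true.1 hb c.1 (mem_boxes.2 c.2)
            simpa only [h, Bool.not_true, Bool.false_or] using this
        · by_cases h2 : c.1 ∈ Y
          · rw [attemptBox_of_mem h2, sub_self]
          · rw [attemptBox_of_not_isLowerSet fun h3 => h (hadd.2 ⟨h2, h3⟩), sub_self]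
      rw [Finset.sum_congr rfl fun c _ => hterm c] at e3
      rw [e1, ← sum_staircaseBox] at e2
      -- By induction both equations at `Y` contain the same values at the enlarged diagrams. These
      -- cancel in the difference, and only `F (diagramCode Y) - ψ Y` is left as an unknown.
      have hsub : (∑ c : StaircaseBox n, if addable (diagramCode Y) c.1 then (1 : ℂ) else 0)
          * (F (diagramCode Y) - ψ Y) = X * (ψ Y - F (diagramCode Y)) := by
        rw [mul_sub X, ← e3, e2, ← Finset.sum_sub_distrib, Finset.sum_mul]
        refine Finset.sum_congr rfl fun c _ => ?_
        split_ifs <;> ring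
      -- A missing corner yields an addable box, which contributes `1`, and `X` has nonnegative real
      -- part; so the coefficient of the unknown cannot vanish.
      have hcard : ((1 : ℝ)) ≤
          ((∑ c : StaircaseBox n, if addable (diagramCode Y) c.1 then (1 : ℂ) else 0) + X).re := by
        have hXre : 0 ≤ X.re := by
          rw [hXdef, Complex.re_sum]
          refine Finset.sum_nonneg fun k _ => ?_
          split_ifs
          · simp
          · exact hx k
        simp only [not_forall] at hfull
        obtain ⟨k, hk⟩ := hfull
        obtain ⟨c, hc1, hc2⟩ := exists_addable hk
        have : (1 : ℝ) ≤
            (∑ c : StaircaseBox n, if addable (diagramCode Y) c.1 then (1 : ℂ) else 0).re := by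
          rw [Complex.re_sum]
          refine le_trans ?_ (Finset.single_le_sum (fun c _ => ?_) (Finset.mem_univ c))
          · rw [if_pos ((addable_diagramCode hn hY c.2).2 ⟨hc1, hc2⟩), Complex.one_re]
          · split_ifs <;> simp
        rw [Complex.add_re]
        linarith
      have hne : (∑ c : StaircaseBox n, if addable (diagramCode Y) c.1 then (1 : ℂ) else 0) + X
          ≠ 0 := by
        intro h
        rw [h, Complex.zero_re] at hcard
        linarith
      have : ((∑ c : StaircaseBox n, if addable (diagramCode Y) c.1 then (1 : ℂ) else 0) + X)
          * (F (diagramCode Y) - ψ Y) = 0 := by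
        linear_combination hsub
      exact sub_eq_zero.1 ((mul_eq_zero.1 this).resolve_left hne)
  have hbot : diagramCode ⊥ = 0 := by simp [diagramCode]
  have := key _ ⊥ (fun b hb => absurd hb (YoungDiagram.notMem_bot b)) (by rwa [hbot]) rfl
  rw [← this, hbot, hF]
  simp only
  rw [h1, Vec.eval_cons, Vec.eval_nil, (permCode_injective hn).extend_apply φ 0]
  simp

end Soundness

/-! ### The intertwining combinations for `n` from `2` to `6`. -/

section Table

/-- For each Young diagram `y` in the staircase shape, in packed form, the sum over all increasing
tableaux with entries `1, …, n - 1` and shape contained in `y` of the product of the elements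
`T k - 1` of the `0`-Hecke algebra along the row reading word, in the basis of permutations. -/
def packedTable : ℕ → List (ℕ × ℕ)
  | 2 => [
      (0, 0x221),
      (1, 0x61)]
  | 3 => [
      (0, 0x2221),
      (1, 0x221f002061001421),
      (257, 0x10a1),
      (3, 0x461),
      (259, 0x2a1)]
  | 4 => [
      (0, 0x1a221),
      (1, 0x1a21e01a061019421013221),
      (257, 0x1a22101a05f01941f0190a101321f013061011621),
      (3, 0x1a22101a05f01941f01846101321f01306100b421),
      (65793, 0x110e1),
      (259, 0x1a21f01a06101942101909f01845f0182a101322101305f01161f01066100b41f00b0a100a621),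
      (7, 0x3461),
      (65795, 0x110df0102e100a0e1),
      (771, 0x86a1),
      (263, 0x345f0032a1002661),
      (66307, 0x84e1),
      (65799, 0x22e1),
      (775, 0x16a1),
      (66311, 0x14e1)]
  | 5 => [
      (0, 0x11a221),
      (1, 0x11a21d11a0611194211132210e2221),
      (257, 0x11a22311a05e11941e1190a111321e1130611116210e221e0e20610e14210d4221),
      (3, 0x11a22311a05e11941e11846111321e11306110b4210e221e0e20610e14210a3221),
      (65793, 0x11a21f11a06111942111909f11322111305f11161f1110e10e22210e205f0e141f0e10a10d421f0d40610d1821),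
      (259, 0x11a21b11a06411942411909e11845e1182a111322411305d11161e11066110b41e10b0a110a6210e22240e205d0e141d0e10a10e04610d421e0d40610cc4210a321e0a30610a162109c221),
      (7, 0x11a21f11a06111942111845f11322111305f10b41f1034610e22210e205f0e141f0e04610a321f0a3061063421),
      (16843009, 0xd1121),
      (65795, 0x11a22211a05e11941e1190a211846111829f11321e1130621116221110de11065f1102e110b42110b09f10a61f10a0e10e221e0e20620e14220e109e0e045f0e02a10d42220d405e0d181e0d08610cc41f0cc0a10ca8210a32210a305f0a161f0a10e109c21f09c061099821),
      (771, 0x11a22111a05f11941f1190a111846111829f11321f11306111162111065f10b42110b09f10a61f1086a10e221f0e20610e14210e109f0e045f0e02a10d42210d405f0cc41f0cc0a10a32210a305f0a161f0a066109c21f09c06108c621),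
      (263, 0x11a22211a05e11941e1190a111846211829f11321e11306211162111065f10b42210b09f10a61f10345e1032a11026610e221e0e20620e14220e109f0e045e0e02a10d42210d405f0cc41f0c44610a32220a305e0a161f0a066109c21f09c06106341e0630a106262105c421),
      (15, 0x23461),
      (16843011, 0xd111e0d03210ca121099121),
      (66307, 0x11a21f11a06111942111909f11845f1182a111322111305f11161f1110e11106611102df10b41f10b0a110a62110a0df10869f1084e10e22210e205f0e141f0e10a10e04610e029f0d421f0d40610d18210d085f0cc4210cc09f0ca81f0c88a10a321f0a30610a16210a10df0a065f0a02e109c22109c05f09981f09886108c61f08c0e108b821),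
      (65799, 0x11a21f11a06111942111909f11845f1182a111322111305f11161f1110e11106611102df10b41f10b0a110a62110a0df10346110329f10265f1022e10e22210e205f0e141f0e10a10e04610e029f0d421f0d40610d18210d085f0cc4210cc09f0ca81f0c445f0c42a10c28610a321f0a30610a16210a10df0a065f0a02e109c22109c05f09981f09886106342106309f06261f0620e105c41f05c0a105a821),
      (775, 0x11a21f11a06111942111909f11845f1182a111322111305f11161f11066110b41f10b0a110a62110869f10346110329f10265f1016a10e22210e205f0e141f0e10a10e04610e029f0d421f0d40610cc4210cc09f0c445f0c42a10a321f0a30610a16210a065f09c22109c05f08c61f08466106342106309f06261f0606a105c41f05c0a1054621),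
      (271, 0x2345e0232a102266101c461),
      (16843523, 0xd11210d031f0ca11f0c852109911f09832108b121),
      (197379, 0x888e1),
      (16843015, 0xd11210d031f0ca11f0c232109911f09832105a121),
      (66311, 0x11a22111a05f11941f1190a111846111829f11321f1130611116211110df11065f1102e110b42110b09f10a61f10a0e11086a11084df10345f1032a11026611022df10169f1014e10e221f0e20610e14210e109f0e045f0e02a10d42210d405f0d181f0d08610cc41f0cc0a10ca8210c889f0c44610c429f0c285f0c18a10a32210a305f0a161f0a10e10a06610a02df09c21f09c06109982109885f08c62108c0df08b81f08465f0842e108386106341f0630a10626210620df06069f0604e105c42105c09f05a81f0588a105461f0540e1053821),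
      (1799, 0x446a1),
      (65807, 0x2346102329f02265f0222e101c45f01c2a101a861),
      (783, 0x2346102329f02265f0216a101c45f01c2a1014661),
      (16974595, 0x88721),
      (16843527, 0xd111f0d03210ca1210c851f0c231f0c152109912109831f08b11f08332105a11f058521053121),
      (197383, 0x888df0818e10508e1),
      (67335, 0x4469f0444e10438a1),
      (16843023, 0x1a321),
      (66319, 0x2345f0232a10226610222df02169f0214e101c46101c29f01a85f0198a101465f0142e1013861),
      (1807, 0xc6a1),
      (16974599, 0x8871f081721050721),
      (16844551, 0x43521),
      (198407, 0x428e1),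
      (16843535, 0x1a31f019521013321),
      (197391, 0x118e1),
      (67343, 0xc69f00c4e100b8a1),
      (16975623, 0x42721),
      (16974607, 0x11721),
      (16844559, 0xb521),
      (198415, 0xa8e1),
      (16975631, 0xa721)]
  | 6 => [
      (0, 0xb1a221),
      (1, 0xb1a21cb1a061b19421b13221ae222195a221),
      (257, 0xb1a226b1a05db1941db190a1b1321db13061b11621ae221dae2061ae1421ad422195a21d95a0619594219532218ea221),
      (3, 0xb1a226b1a05db1941db18461b1321db13061b0b421ae221dae2061ae1421aa322195a21d95a061959421953221762221),
      (65793, 0xb1a21cb1a063b19423b1909eb13223b1305eb1161eb110e1ae2223ae205eae141eae10a1ad421ead4061ad182195a22395a05e95941e9590a195321e9530619516218ea21e8ea0618e94218d5221),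
      (259, 0xb1a212b1a069b19429b1909db1845db182a1b13229b1305bb1161db10661b0b41db0b0a1b0a621ae2229ae205bae141bae10a1ae0461ad421dad4061acc421aa321daa3061aa1621a9c22195a22995a05b95941b9590a195846195321b95306295162194b4218ea21d8ea0618e94218ab22176221d76206176142175422172a221),
      (7, 0xb1a21cb1a063b19423b1845eb13223b1305eb0b41eb03461ae2223ae205eae141eae0461aa321eaa3061a6342195a22395a05e95941e95846195321e95306194b42176221e762061761421563221),
      (16843009, 0xb1a221b1a05fb1941fb190a1b1321fb13061b11621b110dfae221fae2061ae1421ae109fad4221ad405fad181fad112195a21f95a06195942195909f95322195305f95161f9510e18ea2218ea05f8e941f8e90a18d521f8d50618d1a21),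
      (65795, 0xb1a22bb1a057b19417b190a6b18463b1829eb13217b13067b11626b110ddb1065eb102e1b0b423b0b09eb0a61eb0a0e1ae2217ae2067ae1427ae109cae045eae02a1ad4226ad405cad181dad0861acc41eacc0a1aca821aa3223aa305eaa161eaa10e1a9c21ea9c061a9982195a21795a06795942795909c95845e9582a195322795305b95161c9510e195066194b41e94b0a194a6218ea2268ea05c8e941c8e90a18e84618d521d8d50618cd4218ab21e8ab0618a962189d22176222376205e76141e7610a175421e75406175182172a21e72a061729421715221),
      (771, 0xb1a226b1a05bb1941bb190a3b18463b1829eb1321bb13064b11623b1065eb0b423b0b09eb0a61eb086a1ae221bae2064ae1424ae109eae045eae02a1ad4223ad405eacc41eacc0a1aa3223aa305eaa161eaa0661a9c21ea9c061a8c62195a21b95a06495942495909e95845e9582a195322495305d95161e95066194b41e94b0a194a6218ea2238ea05e8e941e8e90a18ab21e8ab0618a962176222376205e76141e76046175421e75406174c42172a21e72a0617294216ac221),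
      (263, 0xb1a22bb1a057b19417b190a3b18466b1829eb13217b13067b11623b1065eb0b426b0b09eb0a61eb0345db032a1b02661ae2217ae2067ae1427ae109eae045cae02a1ad4223ad405eacc41eac4461aa3226aa305caa161eaa0661a9c21ea9c061a6341da630a1a62621a5c42195a21795a06795942795909e95845c9582a195322795305b95161e95066194b41c94b0a194a6219434618ea2238ea05e8e941e8e84618ab21e8ab06186b42176222676205c76141c7610a176046175421e75406174c42172a21e72a06172942156321d56306156162155c22152b221),
      (15, 0xb1a221b1a05fb1941fb18461b1321fb13061b0b421b0345fae221fae2061ae1421ae045faa3221aa305fa6341fa2346195a21f95a06195942195845f95322195305f94b41f94346176222176205f76141f76046156321f563061363421),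
      (4311810305, 0x8d1161),
      (16843011, 0xb1a21db1a063b19423b1909db1845fb182a1b13223b1305db1161db110e3b10661b102dfb0b41fb0b0a1b0a621b0a0dfae2223ae205dae141dae10a3ae0461ae029fad421dad4063ad1823ad111dad085fad0321acc421acc09faca81faca121aa321faa3061aa1621aa10dfa9c221a9c05fa9981fa9912195a22395a05d95941d9590a395846195829f95321d9530639516239510dd95065f9502e194b42194b09f94a61f94a0e18ea21d8ea0638e94238e909d8e845f8e82a18d52238d505d8d1a1d8d0a618cd41f8cd0a18caa218ab2218ab05f8a961f8a90e189d21f89d061899a2176221f76206176142176109f75422175405f75181f75112172a22172a05f72941f7290a171521f715061711a21),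
      (66307, 0xb1a217b1a068b19428b1909ab1845bb182a4b13228b13059b1161ab110e3b10664b102deb0b41bb0b0a4b0a624b0a0deb0869eb084e1ae2228ae2059ae1419ae10a5ae0464ae029dad421aad4065ad1823ad085eacc424acc09daca81eac88a1aa321baa3064aa1624aa10deaa065eaa02e1a9c224a9c05da9981ea98861a8c61ea8c0e1a8b82195a22895a0599594199590a595846495829d9532199530669516259510de95065d9502e194b42494b09d94a61d94a0e19486a18ea21a8ea0658e94258e909d8e845e8e82a18d52238d505e8cd41e8cd0a18ab2248ab05d8a961d8a90e18a866189d21e89d06188d62176221b76206476142476109e76045e7602a175422475405d75181e75086174c41e74c0a174a82172a22472a05d72941d7290a172846171521e71506170d4216ac21e6ac0616a98216a5221),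
      (65799, 0xb1a216b1a069b19429b1909ab1845ab182a4b13229b13058b1161ab110e3b10664b102deb0b41ab0b0a4b0a624b0a0deb03463b0329eb0265eb022e1ae2229ae2058ae1418ae10a5ae0465ae029dad421aad4065ad1823ad085eacc424acc09eaca81eac445eac42a1ac2861aa321aaa3065aa1624aa10deaa065eaa02e1a9c224a9c05da9981ea98861a63423a6309ea6261ea620e1a5c41ea5c0a1a5a82195a22995a0589594189590a595846595829d9532189530679516259510de95065d9502e194b42594b09d94a61d94a0e194345e9432a19426618ea21a8ea0658e94258e909e8e845d8e82a18d52238d505e8cd41e8c54618ab2248ab05d8a961e8a866189d21e89d06186b41e86b0a186a62185d42176221a76206576142576109d76045e7602a175422475405d75181e75086174c41e74c0a174a82172a22472a05d72941d7290a172846171521e71506170d42156322356305e56161e5610e155c21e55c06155982152b21e52b06152962151d221),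
      (775, 0xb1a217b1a068b19428b1909bb1845ab182a4b13228b13059b1161bb10664b0b41ab0b0a4b0a624b0869eb03463b0329eb0265eb016a1ae2228ae2059ae1419ae10a4ae0465ae029dad421bad4064acc424acc09eac445eac42a1aa321aaa3065aa1624aa065da9c224a9c05da8c61ea84661a63423a6309ea6261ea606a1a5c41ea5c0a1a5462195a22895a0599594199590a495846595829d95321995306695162495065d94b42594b09d94a61d9486a194345e9432a19426618ea21b8ea0648e94248e909e8e845e8e82a18ab2248ab05d8a961e8a866186b41e86b0a186a62176221a76206576142576109e76045d7602a175422475405d74c41d74c0a174446172a22472a05d72941d7290a17284616ac21e6ac06166c42156322356305e56161e56066155c21e55c06154c62152b21e52b0615296214ec221),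
      (271, 0xb1a21db1a063b19423b1909fb1845db182a1b13223b1305db1161fb10661b0b41db0b0a1b0a621b03463b0329fb0265fae2223ae205dae141dae10a1ae0463ae029fad421fad4061acc421ac445faa321daa3063aa1621aa065fa9c221a9c05fa63423a6309fa6261fa5c41fa2345da232a1a22661a1c46195a22395a05d95941d9590a195846395829f95321d95306395162195065f94b42394b09f94a61f94345d9432a19426618ea21f8ea0618e94218e845f8ab2218ab05f86b41f82b46176221d76206376142376109f76045d7602a175422175405f74c41f74446172a22172a05f72941f72846156322356305d56161f56066155c21f55c06152b21f52b06136341d3630a136262135c42132b421),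
      (31, 0x163461),
      (4311810307, 0x8d115d8d03618ca161899161711161),
      (16843523, 0xb1a223b1a05db1941db190a3b18462b1829eb1321db13063b11623b110ddb1065eb102e2b0b422b0b09eb0a61eb0a0e2b086a1b084dfae221dae2063ae1423ae109dae045eae02a2ad4223ad405dad181dad1123ad0862ad031eacc41eacc0a2aca822aca11eac889fac8521aa3222aa305eaa161eaa10e2aa0661aa02dfa9c21ea9c062a99822a9911ea9885fa98321a8c621a8c0dfa8b81fa8b12195a21d95a06395942395909d95845e9582a295322395305d95161d9510e39506629502de94b41e94b0a294a62294a0de94869f9484e18ea2238ea05d8e941d8e90a38e84628e829e8d521d8d50638d1a238d0a5e8cd4228cd09e8caa1e8c8aa18ab21e8ab0628a96228a90de8a865f8a82e189d22289d05e899a1e898a6188d61f88d0e188ba2176222276205e76141e7610a276046176029f75421e75406275182275111e75085f75032174c42174c09f74a81f74a12172a21e72a06272942272909e72845f7282a171522271505e711a1e710a6170d41f70d0a170aa216ac2216ac05f6a981f6a91216a521f6a50616a1a21),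
      (197379, 0xb1a221b1a05fb1941fb190a1b18461b1829fb1321fb13061b11621b110dfb1065fb102e1b0b421b0b09fb0a61fb0a0e1b086a1b084dfae221fae2061ae1421ae109fae045fae02a1ad4221ad405fad181fad0861acc41facc0a1aca821ac889faa3221aa305faa161faa10e1aa0661aa02dfa9c21fa9c061a99821a9885fa8c621a8c0dfa8b81fa888e195a21f95a06195942195909f95845f9582a195322195305f95161f9510e19506619502df94b41f94b0a194a62194a0df94869f9484e18ea2218ea05f8e941f8e90a18e84618e829f8d521f8d50618cd4218cd09f8ab21f8ab0618a96218a90df8a865f8a82e189d22189d05f88d61f88d0e176222176205f76141f7610a176046176029f75421f75406175182175085f74c42174c09f74a81f7488a172a21f72a06172942172909f72845f7282a171522171505f70d41f70d0a16ac2216ac05f6a981f6a88616a521f6a506168d821),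
      (16843015, 0xb1a223b1a05db1941db190a3b18462b1829eb1321db13063b11623b110ddb1065eb102e2b0b422b0b09eb0a61eb0a0e2b0345fb032a1b02661b022dfae221dae2063ae1423ae109dae045eae02a2ad4223ad405dad181dad1123ad0862ad031eacc41eacc0a2aca822aca11eac4461ac429fac285fac2321aa3222aa305eaa161eaa10e2aa0661aa02dfa9c21ea9c062a99822a9911ea9885fa98321a6341fa630a1a62621a620dfa5c421a5c09fa5a81fa5a12195a21d95a06395942395909d95845e9582a295322395305d95161d9510e39506629502de94b41e94b0a294a62294a0de94346194329f94265f9422e18ea2238ea05d8e941d8e90a38e84628e829e8d521d8d50638d1a238d0a5e8cd4228cd09e8caa1e8c545f8c52a18c2a618ab21e8ab0628a96228a90de8a865f8a82e189d22289d05e899a1e898a6186b42186b09f86a61f86a0e185d41f85d0a185aa2176222276205e76141e7610a276046176029f75421e75406275182275111e75085f75032174c42174c09f74a81f74a12172a21e72a06272942272909e72845f7282a171522271505e711a1e710a6170d41f70d0a170aa2156321f5630615616215610df55c22155c05f55981f55912152b22152b05f52961f5290e151d21f51d061519a21),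
      (66311, 0xb1a22eb1a053b19413b190aab1846ab18298b13213b1306cb1162ab110dbb10658b102e4b0b42ab0b098b0a618b0a0e4b086a4b084deb0345bb032a4b02664b022deb0169eb014e1ae2213ae206cae142cae1097ae0457ae02a7ad422aad4057ad181bad0864acc418acc0a6aca824ac889eac4464ac429dac285eac18a1aa322aaa3057aa1618aa10e4aa0666aa02dda9c218a9c067a99824a9885da8c624a8c0dea8b81ea8465ea842e1a83861a6341ba630a4a62624a620dea6069ea604e1a5c424a5c09da5a81ea588a1a5461ea540e1a5382195a21395a06c95942c9590979584579582a795322c9530559516179510e49506679502dd94b41794b0a794a62794a0dd94869d9484e194346494329d94265d9422e19416a18ea22a8ea0578e94178e90a68e84668e829c8d521b8d50648cd4248cd09e8c545e8c52a18ab2188ab0678a96268a90de8a865c8a82e189d22489d05d88d61e88566186b42486b09d86a61d86a0e18686a185d41e85d0a185562176222a7620577614177610a676046676029c75421875406775182475085d74c42674c09c74a81d7488a174445e7442a174286172a21872a06772942772909c72845c7282a271522471505d70d41d70d0a17054616ac2246ac05d6a981e6a88616a521e6a506166c41e66c0a166a82166542156321b5630645616245610de56065e5602e155c22455c05d55981e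55886154c61e54c0e154b82152b22452b05d52961d5290e152866151d21e51d06150d6214ec21e4ec0614e98214e5221),
      (1799, 0xb1a221b1a05fb1941fb190a1b18461b1829fb1321fb13061b11621b1065fb0b421b0b09fb0a61fb086a1b0345fb032a1b02661b0169fae221fae2061ae1421ae109fae045fae02a1ad4221ad405facc41facc0a1ac4461ac429faa3221aa305faa161faa0661a9c21fa9c061a8c621a8465fa6341fa630a1a62621a6069fa5c421a5c09fa5461fa446a195a21f95a06195942195909f95845f9582a195322195305f95161f95066194b41f94b0a194a62194869f94346194329f94265f9416a18ea2218ea05f8e941f8e90a18e84618e829f8ab21f8ab0618a96218a865f86b42186b09f86a61f8686a176222176205f76141f7610a176046176029f75421f75406174c42174c09f74445f7442a172a21f72a06172942172909f72845f7282a16ac2216ac05f66c41f66c0a156321f56306156162156065f55c22155c05f54c61f54466152b22152b05f52961f5286614ec21f4ec06146c621),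
      (65807, 0xb1a223b1a05db1941db190a2b18463b1829eb1321db13063b11622b110dfb1065eb102e1b0b423b0b09eb0a61eb0a0e1b0345db032a2b02662b022dfae221dae2063ae1423ae109eae045dae02a2ad4222ad405ead181fad0861acc41eacc0a1aca821ac4462ac429fac285faa3223aa305daa161eaa10e1aa0662aa02dfa9c21ea9c062a99821a9885fa6341da630a2a62622a620dfa5c422a5c09fa5a81fa23463a2329ea2265ea222e1a1c45ea1c2a1a1a86195a21d95a06395942395909e95845d9582a295322395305d95161e9510e19506629502df94b41d94b0a294a62294a0df94346394329e94265e9422e18ea2228ea05e8e941e8e90a18e84628e829f8d521f8d50618cd4218c545f8ab21e8ab0628a96218a865f89d22189d05f86b42286b09f86a61f85d41f82b45e82b2a182a66181d46176222376205d76141d7610a276046376029e75421e75406275182175085f74c42274c09f74a81f74445e7442a174286172a21e72a06272942272909f72845e7282a171522171505f70d41f70546156321d5630635616225610df56065e5602e155c22255c05e55981f55886152b22252b05e52961f52866151d21f51d06136342336309e36261e3620e135c41e35c0a135a82132b41e32b0a132a62131d421),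
      (783, 0xb1a223b1a05db1941db190a2b18463b1829eb1321db13063b11622b1065eb0b423b0b09eb0a61eb086a1b0345db032a2b02662b0169fae221dae2063ae1423ae109eae045dae02a2ad4222ad405eacc41eacc0a1ac4462ac429faa3223aa305daa161eaa0662a9c21ea9c062a8c621a8465fa6341da630a2a62622a6069fa5c422a5c09fa5461fa23463a2329ea2265ea216a1a1c45ea1c2a1a1466195a21d95a06395942395909e95845d9582a295322395305d95161e95066294b41d94b0a294a62294869f94346394329e94265e9416a18ea2228ea05e8e941e8e90a18e84628e829f8ab21e8ab0628a96218a865f86b42286b09f86a61f82b45e82b2a182a66176222376205d76141d7610a276046376029e75421e75406274c42274c09f74445e7442a172a21e72a06272942272909f72845e7282a16ac2216ac05f66c41f62c46156321d56306356162256065e55c22255c05e54c61f54466152b22252b05e52961f5286614ec21f4ec06136342336309e36261e3606a135c41e35c0a135462132b41e32b0a132a6212ec421),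
      (287, 0x16345d1632a116266115c46112b461),
      (4311810819, 0x8d11638d035e8ca15e8c856189915e89836188b16171115e71036170a1616a1161),
      (16974595, 0xb1a21fb1a061b19421b1909fb1845fb182a1b13221b1305fb1161fb110e1b10661b102dfb0b41fb0b0a1b0a621b0a0dfb0869fb084e1ae2221ae205fae141fae10a1ae0461ae029fad421fad4061ad1821ad111fad085fad0321acc421acc09faca81faca121ac88a1ac851faa321faa3061aa1621aa10dfaa065faa02e1a9c221a9c05fa9981fa99121a98861a9831fa8c61fa8c0e1a8b821a8b11fa888dfa8872195a22195a05f95941f9590a195846195829f95321f9530619516219510df95065f9502e194b42194b09f94a61f94a0e19486a19484df8ea21f8ea0618e94218e909f8e845f8e82a18d52218d505f8d1a1f8d0a618cd41f8cd0a18caa218c8a9f8ab2218ab05f8a961f8a90e18a86618a82df89d21f89d061899a21898a5f88d62188d0df88ba1f888ae176221f76206176142176109f76045f7602a175422175405f75181f75112175086175031f74c41f74c0a174a82174a11f74889f74852172a22172a05f72941f7290a172846172829f71521f715061711a21710a5f70d42170d09f70aa1f708aa16ac21f6ac0616a98216a911f6a885f6a83216a52216a505f6a1a1f6a0a6168d8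1f68d12168ca21),
      (4311810311, 0x8d11638d035e8ca15e8c236189915e89836185a16171115e71036170a161519161),
      (16843527, 0xb1a21bb1a065b19425b1909bb1845cb182a4b13225b1305bb1161bb110e5b10664b102dcb0b41cb0b0a4b0a624b0a0dcb0869eb084e2b03462b0329eb0265eb022e2b016a1b014dfae2225ae205bae141bae10a5ae0464ae029cad421bad4065ad1825ad111bad085cad0324acc424acc09caca81caca124ac88a2ac851eac445eac42a2ac2862ac231eac189fac1521aa321caa3064aa1624aa10dcaa065daa02e3a9c224a9c05ca9981ca99124a98863a9831da8c61ea8c0e2a8b822a8b11ea84661a842dfa8385fa83321a63422a6309ea6261ea620e2a606a1a604dfa5c41ea5c0a2a5a822a5a11ea5889fa58521a54621a540dfa5381fa5312195a22595a05b95941b9590a595846495829c95321b9530659516259510db95065c9502e494b42494b09c94a61c94a0e49486a29484de94345e9432a29426629422de94169f9414e18ea21b8ea0658e94258e909b8e845c8e82a48d52258d505b8d1a1b8d0a648cd41c8cd0a48caa248c8a9e8c54628c529e8c2a5e8c1aa18ab2248ab05c8a961c8a90e48a86638a82dd89d21c89d064899a24898a5d88d62288d0de88ba1e88565f8852e1883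a6186b41e86b0a286a62286a0de86869f8684e185d42285d09e85aa1e858aa185561f8550e1853a2176221c76206476142476109c76045d7602a375422475405c75181c75112475086375031d74c41d74c0a374a82374a11d74889f74852174446174429f74285f74232172a22472a05c72941c7290a472846372829d71521c715064711a24710a5d70d42370d09d70aa1d708aa170545f7052a1702a616ac21e6ac0626a98226a911e6a885f6a83216a52226a505e6a1a1e6a0a6166c42166c09f66a81f66a12166541f6650a1662a2156322256305e56161e5610e25606615602df55c21e55c06255982255911e55885f55832154c62154c0df54b81f54b12152b21e52b0625296225290de52865f5282e151d22251d05e519a1e518a6150d61f50d0e150ba214ec2214ec05f4e981f4e91214e521f4e50614e1a21),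
      (197383, 0xb1a21eb1a062b19422b1909eb1845eb182a2b13222b1305eb1161eb110e2b10662b102deb0b41eb0b0a2b0a622b0a0deb0869eb084e2b03461b0329fb0265fb022e1b016a1b014dfae2222ae205eae141eae10a2ae0462ae029ead421ead4062ad1822ad085eacc422acc09eaca81eac88a2ac445fac42a1ac2861ac189faa321eaa3062aa1622aa10deaa065eaa02e2a9c222a9c05ea9981ea98862a8c61ea8c0e2a8b822a888dea84661a842dfa8385fa818e1a63421a6309fa6261fa620e1a606a1a604dfa5c41fa5c0a1a5a821a5889fa54621a540dfa5381fa508e195a22295a05e95941e9590a295846295829e95321e9530629516229510de95065e9502e294b42294b09e94a61e94a0e29486a29484de94345f9432a19426619422df94169f9414e18ea21e8ea0628e94228e909e8e845e8e82a28d52228d505e8cd41e8cd0a28c54618c529f8ab2228ab05e8a961e8a90e28a86628a82de89d21e89d06288d62288d0de88565f8852e186b41f86b0a186a62186a0df86869f8684e185d42185d09f85561f8550e176221e76206276142276109e76045e7602a275422275405e75181e75086274c41e74c0a274a82274889e74446174429f74285f7418a172a22272a05e72941e7290a272846272829e71521e71506270d42270d09e70545f7052a16ac21e6ac0626a98226a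885e6a52226a505e68d81e68586166c42166c09f66a81f6688a166541f6650a165582156322156305f56161f5610e15606615602df55c21f55c06155982155885f54c62154c0df54b81f5488e152b21f52b0615296215290df52865f5282e151d22151d05f50d61f50d0e14ec2214ec05f4e981f4e88614e521f4e50614cd821),
      (67335, 0xb1a21eb1a062b19422b1909eb1845eb182a2b13222b1305eb1161eb110e1b10662b102dfb0b41eb0b0a2b0a622b0a0dfb0869eb084e1b03462b0329eb0265eb022e1b016a2b014dfae2222ae205eae141eae10a2ae0462ae029ead421ead4062ad1821ad085facc422acc09eaca81fac88a1ac445eac42a2ac2861ac189faa321eaa3062aa1622aa10dfaa065eaa02e1a9c222a9c05ea9981fa98861a8c61ea8c0e1a8b821a84662a842dfa8385fa63422a6309ea6261ea620e1a606a2a604dfa5c41ea5c0a2a5a821a5889fa54622a540dfa5381fa4469ea444e1a438a195a22295a05e95941e9590a295846295829e95321e9530629516229510df95065e9502e194b42294b09e94a61e94a0e19486a29484df94345e9432a29426629422df94169e9414e18ea21e8ea0628e94228e909e8e845e8e82a28d52218d505f8cd41f8cd0a18c54618c529f8ab2228ab05e8a961e8a90e18a86628a82df89d21f89d06188d6218856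5f86b41e86b0a286a62286a0df86869e8684e185d42185d09f85561f8456a176221e76206276142276109e76045e7602a275422275405e75181f75086174c41e74c0a274a82174889f74446274429e74285f7418a172a22272a05e72941e7290a272846272829e71521f71506170d42170d09f70545f7052a16ac21e6ac0626a98216a885f6a52216a505f66c42266c09e66a81f6688a166541f6650a156322256305e56161e5610e15606625602df55c21e55c06255982155885f54c62254c0df54b81f54465e5442e154386152b21e52b0625296225290df52865e5282e151d22151d05f50d61f5056614ec2224ec05e4e981f4e88614e521f4e506146c61e46c0e146b821465621),
      (16843023, 0xb1a21fb1a061b19421b1909fb1845fb182a1b13221b1305fb1161fb110e1b10661b102dfb0b41fb0b0a1b0a621b0a0dfb03461b0329fb0265fb022e1ae2221ae205fae141fae10a1ae0461ae029fad421fad4061ad1821ad111fad085fad0321acc421acc09faca81faca121ac445fac42a1ac2861ac231faa321faa3061aa1621aa10dfaa065faa02e1a9c221a9c05fa9981fa99121a98861a9831fa63421a6309fa6261fa620e1a5c41fa5c0a1a5a821a5a11fa2345fa232a1a22661a222dfa1c461a1c29fa1a85fa1a32195a22195a05f95941f9590a195846195829f95321f9530619516219510df95065f9502e194b42194b09f9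4a61f94a0e194345f9432a19426619422df8ea21f8ea0618e94218e909f8e845f8e82a18d52218d505f8d1a1f8d0a618cd41f8cd0a18caa218c54618c529f8c2a5f8ab2218ab05f8a961f8a90e18a86618a82df89d21f89d061899a21898a5f86b41f86b0a186a62186a0df85d42185d09f85aa1f82b46182b29f82a65f82a2e181d45f81d2a181aa6176221f76206176142176109f76045f7602a175422175405f75181f75112175086175031f74c41f74c0a174a82174a11f74446174429f74285f74232172a22172a05f72941f7290a172846172829f71521f715061711a21710a5f70d42170d09f70aa1f70545f7052a1702a6156322156305f56161f5610e15606615602df55c21f55c06155982155911f55885f55832152b21f52b0615296215290df52865f5282e151d22151d05f519a1f518a6136341f3630a13626213620df35c42135c09f35a81f35a12132b42132b09f32a61f32a0e131d41f31d0a131aa21),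
      (66319, 0xb1a21bb1a065b19425b1909cb1845bb182a4b13225b1305bb1161cb110e2b10664b102deb0b41bb0b0a4b0a624b0a0deb0869eb084e1b03465b0329cb0265cb022e2b016a2b014dfae2225ae205bae141bae10a4ae0465ae029cad421cad4064ad1822ad085eacc424acc09daca81eac88a1ac445cac42a3ac2862ac189faa321baa3065aa1624aa10deaa065caa02e2a9c224a9c05ca9981ea98862a8c61ea8c0e1a8b821a84662a842dfa8385fa63425a6309ca6261ca620e2a606a2a604dfa5c41ca5c0a3a5a822a5889fa54622a540dfa5381fa2345ba232a4a22664a222dea2169ea214e1a1c464a1c29da1a85ea198a1a1465ea142e1a1386195a22595a05b95941b9590a495846595829c95321b9530659516249510de95065c9502e294b42594b09c94a61c94a0e29486a29484df94345b9432a49426649422de94169e9414e18ea21c8ea0648e94248e909d8e845c8e82a38d52228d505e8cd41e8cd0a18c54628c529f8ab2248ab05c8a961d8a90e18a86638a82df89d21e89d06288d62188565f86b41c86b0a386a62386a0df86869f85d42285d09f85561f82b46482b29d82a65d82a2e18296a181d45e81d2a181566176221b76206576142576109c76045b7602a475422475405c75181e75086274c41c74c0a374a82274889f74446474429d74285e7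418a172a22472a05c72941c7290a372846472829d71521e71506270d42270d09f70545e7052a16ac21e6ac0626a98216a885f6a52216a505f66c42266c09f66a81f66541f62c45e62c2a162a86162546156322556305b56161c5610e25606645602de55c21c55c06455982255885e54c62254c0df54b81f54465e5442e154386152b21c52b0645296235290df52865d5282e151d22251d05e50d61f5056614ec2224ec05e4e981f4e88614e521f4e506136341b3630a43626243620de36069e3604e135c42435c09d35a81e3588a135461e3540e135382132b42432b09d32a61d32a0e13286a131d41e31d0a13156212ec41e2ec0a12ea8212e5421),
      (1807, 0xb1a21fb1a061b19421b1909fb1845fb182a1b13221b1305fb1161fb10661b0b41fb0b0a1b0a621b0869fb03461b0329fb0265fb016a1ae2221ae205fae141fae10a1ae0461ae029fad421fad4061acc421acc09fac445fac42a1aa321faa3061aa1621aa065fa9c221a9c05fa8c61fa84661a63421a6309fa6261fa606a1a5c41fa5c0a1a54621a4469fa2345fa232a1a22661a2169fa1c461a1c29fa1465fa0c6a195a22195a05f95941f9590a195846195829f95321f95306195162195065f94b42194b09f94a61f9486a194345f9432a194266194169f8ea21f8ea0618e94218e909f8e845f8e82a18ab2218ab05f8a961f8a866186b41f86b0a186a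62186869f82b46182b29f82a65f8296a176221f76206176142176109f76045f7602a175422175405f74c41f74c0a174446174429f72a22172a05f72941f7290a172846172829f6ac21f6ac06166c42166c09f62c45f62c2a156322156305f56161f56066155c21f55c06154c62154465f52b21f52b06152962152865f4ec2214ec05f46c61f42c66136341f3630a136262136069f35c42135c09f35461f3446a132b42132b09f32a61f3286a12ec41f2ec0a12ac621),
      (65823, 0x16346316329e16265e1622e115c45e15c2a115a86112b45e12b2a112a66111d461),
      (799, 0x16346316329e16265e1616a115c45e15c2a115466112b45e12b2a112a6610ec461),
      (4311941891, 0x8d115f8d03618ca1618c855f89916189835f88b15f88876171116171035f70a15f7085616a115f6a036168c161),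
      (50529027, 0x688b21),
      (4311810823, 0x8d115b8d03648ca1648c855e8c235e8c156189916489835d88b15e88336185a15e85856185316171116471035d70a15d7085617023616a115e6a036166216151915e51836150b1614e1161),
      (16974599, 0xb1a222b1a05eb1941eb190a2b18462b1829eb1321eb13062b11622b110deb1065eb102e2b0b422b0b09eb0a61eb0a0e2b086a2b084deb0345fb032a1b02661b022dfb0169fb014e1ae221eae2062ae1422ae109eae045eae02a2ad4222ad405ead181ead1122ad0862ad031eacc41eacc0a2aca822aca11eac889eac8522ac4461ac429fac285fac2321ac18a1ac151faa3222aa305eaa161eaa10e2aa0662aa02dea9c21ea9c062a99822a9911ea9885ea98322a8c622a8c0dea8b81ea8b122a888e2a8871ea8465fa842e1a83861a8331fa818dfa81721a6341fa630a1a62621a620dfa6069fa604e1a5c421a5c09fa5a81fa5a121a588a1a5851fa5461fa540e1a53821a5311fa508dfa5072195a21e95a06295942295909e95845e9582a295322295305e95161e9510e29506629502de94b41e94b0a294a62294a0de94869e9484e294346194329f94265f9422e19416a19414df8ea2228ea05e8e941e8e90a28e84628e829e8d521e8d50628d1a228d0a5e8cd4228cd09e8caa1e8c8aa28c545f8c5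2a18c2a618c1a9f8ab21e8ab0628a96228a90de8a865e8a82e289d22289d05e899a1e898a6288d61e88d0e288ba22888ade8856618852df883a5f881ae186b42186b09f86a61f86a0e18686a18684df85d41f85d0a185aa21858a9f8556218550df853a1f850ae176222276205e76141e7610a276046276029e75421e75406275182275111e75085e75032274c42274c09e74a81e74a1227488a274851e74445f7442a174286174231f74189f74152172a21e72a06272942272909e72845e7282a271522271505e711a1e710a6270d41e70d0a270aa22708a9e70546170529f702a5f701aa16ac2226ac05e6a981e6a91226a88626a831e6a521e6a50626a1a226a0a5e68d82268d11e68ca1e68585f685321684a6166c41f66c0a166a82166a11f66889f66852166542166509f662a1f660aa165581f655121654a2156321f5630615616215610df56065f5602e155c22155c05f55981f55912155886155831f54c61f54c0e154b82154b11f5488df54872152b22152b05f52961f5290e15286615282df51d21f51d061519a21518a5f50d62150d0df50ba1f508ae14ec21f4ec0614e98214e911f4e885f4e83214e52214e505f4e1a1f4e0a614cd81f4cd1214cca21),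
      (16844551, 0xb1a221b1a05fb1941fb190a1b18461b1829fb1321fb13061b11621b110dfb1065fb102e1b0b421b0b09fb0a61fb0a0e1b086a1b084dfb0345fb032a1b02661b022dfb0169fb014e1ae221fae2061ae1421ae109fae045fae02a1ad4221ad405fad181fad1121ad0861ad031facc41facc0a1aca821aca11fac889fac8521ac4461ac429fac285fac2321ac18a1ac151faa3221aa305faa161faa10e1aa0661aa02dfa9c21fa9c061a99821a9911fa9885fa98321a8c621a8c0dfa8b81fa8b121a8465fa842e1a83861a8331fa6341fa630a1a62621a620dfa6069fa604e1a5c421a5c09fa5a81fa5a121a588a1a5851fa5461fa540e1a53821a5311fa446a1a444dfa4389fa4352195a21f95a06195942195909f95845f9582a195322195305f95161f9510e19506619502df94b41f94b0a194a62194a0df94869f9484e194346194329f94265f9422e19416a19414df8ea2218ea05f8e941f8e90a18e84618e829f8d521f8d50618d1a218d0a5f8cd4218cd09f8caa1f8c8aa18c545f8c52a18c2a618c1a9f8ab21f8ab0618a96218a90df8a865f8a82e189d22189d05f899a1f898a6188d61f88d0e188ba218856618852df883a5f86b42186b09f86a61f86a0e18686a18684df85d41f85d0a185aa21858a9f8556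218550df853a1f84569f8454e1843aa176222176205f76141f7610a176046176029f75421f75406175182175111f75085f75032174c42174c09f74a81f74a1217488a174851f74445f7442a174286174231f74189f74152172a21f72a06172942172909f72845f7282a171522171505f711a1f710a6170d41f70d0a170aa21708a9f70546170529f702a5f701aa16ac2216ac05f6a981f6a91216a88616a831f6a521f6a50616a1a216a0a5f66c41f66c0a166a82166a11f66889f66852166542166509f662a1f660aa156321f5630615616215610df56065f5602e155c22155c05f55981f55912155886155831f54c61f54c0e154b82154b11f5446615442df54385f54332152b22152b05f52961f5290e15286615282df51d21f51d061519a21518a5f50d62150d0df50ba1f50565f5052e1503a614ec21f4ec0614e98214e911f4e885f4e83214e52214e505f4e1a1f4e0a6146c62146c0df46b81f46b12146561f4650e1463a21),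
      (198407, 0xb1a221b1a05fb1941fb190a1b18461b1829fb1321fb13061b11621b110dfb1065fb102e1b0b421b0b09fb0a61fb0a0e1b086a1b084dfb0345fb032a1b02661b022dfb0169fb014e1ae221fae2061ae1421ae109fae045fae02a1ad4221ad405fad181fad0861acc41facc0a1aca821ac889fac4461ac429fac285fac18a1aa3221aa305faa161faa10e1aa0661aa02dfa9c21fa9c061a99821a9885fa8c621a8c0dfa8b81fa888e1a8465fa842e1a83861a818dfa6341fa630a1a62621a620dfa6069fa604e1a5c421a5c09fa5a81fa588a1a5461fa540e1a53821a508dfa446a1a444dfa4389fa428e195a21f95a06195942195909f95845f9582a195322195305f95161f9510e19506619502df94b41f94b0a194a62194a0df94869f9484e194346194329f94265f9422e19416a19414df8ea2218ea05f8e941f8e90a18e84618e829f8d521f8d50618cd4218cd09f8c545f8c52a18ab21f8ab0618a96218a90df8a865f8a82e189d22189d05f88d61f88d0e18856618852df86b42186b09f86a61f86a0e18686a18684df85d41f85d0a18556218550df84569f8454e176222176205f76141f7610a176046176029f75421f75406175182175085f74c42174c09f74a81f7488a174445f7442a174286174189f72a21f72a06172942172909f72845f7282a171522171505f70d41f70d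0a170546170529f6ac2216ac05f6a981f6a88616a521f6a506168d82168585f66c41f66c0a166a82166889f66542166509f65581f6458a156321f5630615616215610df56065f5602e155c22155c05f55981f55886154c61f54c0e154b8215488df5446615442df54385f5418e152b22152b05f52961f5290e15286615282df51d21f51d06150d62150d0df50565f5052e14ec21f4ec0614e98214e885f4e52214e505f4cd81f4c586146c62146c0df46b81f4688e146561f4650e145d821),
      (4311810319, 0x8d115f8d03618ca1618c235f89916189835f85a15f81a36171116171035f70a15f70236151915f51836131a161),
      (16843535, 0xb1a222b1a05eb1941eb190a2b18462b1829eb1321eb13062b11622b110deb1065eb102e2b0b422b0b09eb0a61eb0a0e2b086a1b084dfb0345eb032a2b02662b022deb0169fb014e1ae221eae2062ae1422ae109eae045eae02a2ad4222ad405ead181ead1122ad0862ad031eacc41eacc0a2aca822aca11eac889fac8521ac4462ac429eac285eac2322ac18a1ac151faa3222aa305eaa161eaa10e2aa0662aa02dea9c21ea9c062a99822a9911ea9885ea98322a8c621a8c0dfa8b81fa8b121a8465fa842e1a83861a8331fa6341ea630a2a62622a620dea6069fa604e1a5c422a5c09ea5a81ea5a122a588a1a5851fa5461fa540e1a53821a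5311fa23462a2329ea2265ea222e2a216a1a214dfa1c45ea1c2a2a1a862a1a31ea1989fa19521a14661a142dfa1385fa1332195a21e95a06295942295909e95845e9582a295322295305e95161e9510e29506629502de94b41e94b0a294a62294a0de94869f9484e194346294329e94265e9422e29416a19414df8ea2228ea05e8e941e8e90a28e84628e829e8d521e8d50628d1a228d0a5e8cd4228cd09e8caa1e8c8aa18c545e8c52a28c2a628c1a9f8ab21e8ab0628a96228a90de8a865e8a82e289d22289d05e899a1e898a6288d61f88d0e188ba218856618852df883a5f86b42286b09e86a61e86a0e28686a18684df85d41e85d0a285aa22858a9f8556218550df853a1f82b45e82b2a282a66282a2de82969f8294e181d46281d29e81aa5e819aa181565f8152e1813a6176222276205e76141e7610a276046276029e75421e75406275182275111e75085e75032274c42274c09e74a81e74a1227488a174851f74445e7442a274286274231e74189f74152172a21e72a06272942272909e72845e7282a271522271505e711a1e710a6270d41e70d0a270aa22708a9f70546270529e702a5e701aa16ac2216ac05f6a981f6a91216a88616a831f6a521f6a50616a1a216a0a5f66c41f66c0a166a82166a11f66542166509f662a1f62c46162c29f62a85f62a32162545f6252a1622a6156321e5630625616225610de56065e5602e255c2225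5c05e55981e55912255886255831e54c61f54c0e154b82154b11f5446615442df54385f54332152b22252b05e52961e5290e25286625282de51d21e51d062519a22518a5e50d62150d0df50ba1f50565f5052e1503a614ec21f4ec0614e98214e911f4e885f4e83214e52214e505f4e1a1f4e0a6136342236309e36261e3620e23606a13604df35c41e35c0a235a82235a11e35889f3585213546213540df35381f35312132b41e32b0a232a62232a0de32869f3284e131d42231d09e31aa1e318aa131561f3150e1313a212ec4212ec09f2ea81f2ea1212e541f2e50a12e2a21),
      (197391, 0xb1a221b1a05fb1941fb190a1b18461b1829fb1321fb13061b11621b110dfb1065fb102e1b0b421b0b09fb0a61fb0a0e1b086a1b084dfb0345fb032a1b02661b022dfb0169fb014e1ae221fae2061ae1421ae109fae045fae02a1ad4221ad405fad181fad0861acc41facc0a1aca821ac889fac4461ac429fac285fac18a1aa3221aa305faa161faa10e1aa0661aa02dfa9c21fa9c061a99821a9885fa8c621a8c0dfa8b81fa888e1a8465fa842e1a83861a818dfa6341fa630a1a62621a620dfa6069fa604e1a5c421a5c09fa5a81fa588a1a5461fa540e1a53821a508dfa23461a2329fa2265fa222e1a216a1a214dfa1c45fa1c2a1a1a861a1989f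a14661a142dfa1385fa118e195a21f95a06195942195909f95845f9582a195322195305f95161f9510e19506619502df94b41f94b0a194a62194a0df94869f9484e194346194329f94265f9422e19416a19414df8ea2218ea05f8e941f8e90a18e84618e829f8d521f8d50618cd4218cd09f8c545f8c52a18ab21f8ab0618a96218a90df8a865f8a82e189d22189d05f88d61f88d0e18856618852df86b42186b09f86a61f86a0e18686a18684df85d41f85d0a18556218550df82b45f82b2a182a66182a2df82969f8294e181d46181d29f81565f8152e176222176205f76141f7610a176046176029f75421f75406175182175085f74c42174c09f74a81f7488a174445f7442a174286174189f72a21f72a06172942172909f72845f7282a171522171505f70d41f70d0a170546170529f6ac2216ac05f6a981f6a88616a521f6a506168d82168585f66c41f66c0a166a82166889f66542166509f65581f62c46162c29f62a85f6298a162545f6252a161586156321f5630615616215610df56065f5602e155c22155c05f55981f55886154c61f54c0e154b8215488df5446615442df54385f5418e152b22152b05f52961f5290e15286615282df51d21f51d06150d62150d0df50565f5052e14ec21f4ec0614e98214e885f4e52214e505f4cd81f4c586136342136309f36261f3620e13606a13604df35c41f35c0a135a82135889f3546213540df35381f3508e132b41f32b0a132a62132a0df32869f3284e131d42131d09f3156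1f3150e12ec4212ec09f2ea81f2e88a12e541f2e50a12d5821),
      (67343, 0xb1a222b1a05eb1941eb190a2b18462b1829eb1321eb13062b11622b110dfb1065eb102e1b0b422b0b09eb0a61eb0a0e1b086a2b084dfb0345eb032a2b02662b022dfb0169eb014e1ae221eae2062ae1422ae109eae045eae02a2ad4222ad405ead181fad0861acc41eacc0a2aca821ac889fac4462ac429eac285fac18a1aa3222aa305eaa161eaa10e1aa0662aa02dfa9c21ea9c062a99821a9885fa8c622a8c0dfa8b81fa8465ea842e1a83861a6341ea630a2a62622a620dfa6069ea604e1a5c422a5c09ea5a81fa588a1a5461ea540e1a53821a446a2a444dfa4389fa23462a2329ea2265ea222e1a216a2a214dfa1c45ea1c2a2a1a861a1989fa14662a142dfa1385fa0c69ea0c4e1a0b8a195a21e95a06295942295909e95845e9582a295322295305e95161e9510e19506629502df94b41e94b0a294a62294a0df94869e9484e194346294329e94265e9422e19416a29414df8ea2228ea05e8e941e8e90a28e84628e829e8d521f8d50618cd4218cd09f8c545f8c52a18ab21e8ab0628a96228a90df8a865e8a82e189d22189d05f88d61f88566186b42286b09e86a61e86a0e18686a28684df85d41f85d0a185562184569f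82b45e82b2a282a66282a2df82969e8294e181d46181d29f81565f80d6a176222276205e76141e7610a276046276029e75421e75406275182175085f74c42274c09e74a81f7488a174445e7442a274286174189f72a21e72a06272942272909e72845e7282a271522171505f70d41f70d0a170546170529f6ac2226ac05e6a981f6a88616a521f6a506166c41e66c0a266a82166889f66542166509f62c46262c29e62a85f6298a162545f6252a156321e5630625616225610df56065e5602e155c22255c05e55981f55886154c61e54c0e154b8215446625442df54385f52b22252b05e52961e5290e15286625282df51d21f51d06150d62150565f4ec21e4ec0624e98214e885f4e52214e505f46c62246c0df46b81f46561f42c65e42c2e142b86142566136342236309e36261e3620e13606a23604df35c41e35c0a235a82135889f3546223540df35381f34469e3444e13438a132b41e32b0a232a62232a0df32869e3284e131d42131d09f31561f3056a12ec4222ec09e2ea81f2e88a12e541f2e50a12ac61e2ac0e12ab8212a5621),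
      (3855, 0x22c6a1),
      (16843039, 0x16345f1632a11626611622df15c46115c29f15a85f15a32112b46112b29f12a65f12a2e111d45f11d2a111aa61),
      (66335, 0x16345b1632a41626641622de16169e1614e115c46415c29d15a85e1598a115465e1542e115386112b46412b29d12a65d12a2e11296a111d45e11d2a11156610ec45e0ec2a10ea8610e5461),
      (1823, 0x16345f1632a116266116169f15c46115c29f15465f14c6a112b46112b29f12a65f1296a10ec45f0ec2a10ac661),
      (4345496323, 0x688961),
      (4311941895, 0x8d11628d035e8ca15e8c85628c23618c155f89915e89836288b16288875e88335f88176185a16185855f85315f85076171115e71036270a16270855e70235f7015616a11626a035e68c15e68436166215f66056165416151916151835f50b15f5087614e115f4e03614cc161),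
      (50529031, 0x688b1e681b21650b214c8b21),
      (4311811847, 0x8d11618d035f8ca15f8c85618c23618c155f89915f89836188b16188335f85a16185855f85315f84356171115f71036170a16170855f70235f7015616a11616a035f66215f66056151916151835f50b15f5033614e115f4e0361463161),
      (16975623, 0xb1a21fb1a061b19421b1909fb1845fb182a1b13221b1305fb1161fb110e1b10661b102dfb0b41fb0b0a1b0a621b0a0dfb0869fb084e1b03461b0329fb0265fb022e1b016a1b014dfae2221ae205fae141fae10a1ae0461ae029fad421fad4061ad1821ad111fad085fad0321acc421acc09faca81faca121ac88a1ac851fac445fac42a1ac2861ac231fac189fac1521aa321faa3061aa1621aa10dfaa065faa02e1a9c221a9c05fa9981fa99121a98861a9831fa8c61fa8c0e1a8b821a8b11fa888dfa88721a84661a842dfa8385fa83321a818e1a8171fa63421a6309fa6261fa620e1a606a1a604dfa5c41fa5c0a1a5a821a5a11fa5889fa58521a54621a540dfa5381fa53121a508e1a5071fa4469fa444e1a438a1a4351fa428dfa4272195a22195a05f95941f9590a195846195829f95321f9530619516219510df95065f9502e194b42194b09f94a61f94a0e19486a19484df94345f9432a19426619422df94169f9414e18ea21f8ea0618e94218e9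09f8e845f8e82a18d52218d505f8d1a1f8d0a618cd41f8cd0a18caa218c8a9f8c54618c529f8c2a5f8c1aa18ab2218ab05f8a961f8a90e18a86618a82df89d21f89d061899a21898a5f88d62188d0df88ba1f888ae188565f8852e1883a61881adf86b41f86b0a186a62186a0df86869f8684e185d42185d09f85aa1f858aa185561f8550e1853a21850adf8456a18454df843a9f842ae176221f76206176142176109f76045f7602a175422175405f75181f75112175086175031f74c41f74c0a174a82174a11f74889f74852174446174429f74285f7423217418a174151f72a22172a05f72941f7290a172846172829f71521f715061711a21710a5f70d42170d09f70aa1f708aa170545f7052a1702a61701a9f6ac21f6ac0616a98216a911f6a885f6a83216a52216a505f6a1a1f6a0a6168d81f68d12168ca2168586168531f684a5f66c42166c09f66a81f66a1216688a166851f66541f6650a1662a21660a9f65582165511f654a1f64589f645521644aa156322156305f56161f5610e15606615602df55c21f55c06155982155911f55885f55832154c62154c0df54b81f54b1215488e154871f54465f5442e154386154331f5418df54172152b21f52b0615296215290df52865f5282e151d22151d05f519a1f518a6150d61f50d0e150ba21508adf5056615052df503a5f501ae14ec2214ec05f4e981f4e91214e88614e831f4e521f4e50614e1a214e0a5f4c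d8214cd11f4cca1f4c585f4c53214c4a6146c61f46c0e146b82146b11f4688df4687214656214650df463a1f460ae145d81f45d12145ca21),
      (460551, 0x4458e1),
      (4311810831, 0x8d11628d035e8ca15e8c85618c23628c155f89915e89836288b16188335f85a16285855f85315f81a35e81956181336171115e71036270a16270855f70235e7015616a11616a035f66215f62236151916251835e50b15f5033614e115f4e036131a15e3185613131612e2161),
      (16974607, 0xb1a21fb1a061b19421b1909fb1845fb182a1b13221b1305fb1161fb110e1b10661b102dfb0b41fb0b0a1b0a621b0a0dfb0869fb084e1b03461b0329fb0265fb022e1b016a1b014dfae2221ae205fae141fae10a1ae0461ae029fad421fad4061ad1821ad111fad085fad0321acc421acc09faca81faca121ac88a1ac851fac445fac42a1ac2861ac231fac189fac1521aa321faa3061aa1621aa10dfaa065faa02e1a9c221a9c05fa9981fa99121a98861a9831fa8c61fa8c0e1a8b821a8b11fa888dfa88721a84661a842dfa8385fa83321a818e1a8171fa63421a6309fa6261fa620e1a606a1a604dfa5c41fa5c0a1a5a821a5a11fa5889fa58521a54621a540dfa5381fa53121a508e1a5071fa2345fa232a1a22661a222dfa2169fa214e1a1c461a1c29fa1a85fa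1a321a198a1a1951fa1465fa142e1a13861a1331fa118dfa1172195a22195a05f95941f9590a195846195829f95321f9530619516219510df95065f9502e194b42194b09f94a61f94a0e19486a19484df94345f9432a19426619422df94169f9414e18ea21f8ea0618e94218e909f8e845f8e82a18d52218d505f8d1a1f8d0a618cd41f8cd0a18caa218c8a9f8c54618c529f8c2a5f8c1aa18ab2218ab05f8a961f8a90e18a86618a82df89d21f89d061899a21898a5f88d62188d0df88ba1f888ae188565f8852e1883a61881adf86b41f86b0a186a62186a0df86869f8684e185d42185d09f85aa1f858aa185561f8550e1853a21850adf82b46182b29f82a65f82a2e18296a18294df81d45f81d2a181aa61819a9f8156618152df813a5f811ae176221f76206176142176109f76045f7602a175422175405f75181f75112175086175031f74c41f74c0a174a82174a11f74889f74852174446174429f74285f7423217418a174151f72a22172a05f72941f7290a172846172829f71521f715061711a21710a5f70d42170d09f70aa1f708aa170545f7052a1702a61701a9f6ac21f6ac0616a98216a911f6a885f6a83216a52216a505f6a1a1f6a0a6168d81f68d12168ca2168586168531f684a5f66c42166c09f66a81f66a1216688a166851f66541f6650a1662a21660a9f65582165511f654a1f62c45f62c2a162a86162a31f62989f6295216254616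2529f622a5f621aa161585f615321614a6156322156305f56161f5610e15606615602df55c21f55c06155982155911f55885f55832154c62154c0df54b81f54b1215488e154871f54465f5442e154386154331f5418df54172152b21f52b0615296215290df52865f5282e151d22151d05f519a1f518a6150d61f50d0e150ba21508adf5056615052df503a5f501ae14ec2214ec05f4e981f4e91214e88614e831f4e521f4e50614e1a214e0a5f4cd8214cd11f4cca1f4c585f4c53214c4a6136341f3630a13626213620df36069f3604e135c42135c09f35a81f35a1213588a135851f35461f3540e135382135311f3508df35072132b42132b09f32a61f32a0e13286a13284df31d41f31d0a131aa21318a9f3156213150df313a1f310ae12ec41f2ec0a12ea8212ea11f2e889f2e85212e54212e509f2e2a1f2e0aa12d581f2d51212d4a21),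
      (16844559, 0xb1a21fb1a061b19421b1909fb1845fb182a1b13221b1305fb1161fb110e1b10661b102dfb0b41fb0b0a1b0a621b0a0dfb0869fb084e1b03461b0329fb0265fb022e1b016a1b014dfae2221ae205fae141fae10a1ae0461ae029fad421fad4061ad1821ad111fad085fad0321acc421acc09faca81faca121ac88a1ac851fac445fac42a1ac2861ac231fac189fac1521aa321faa3061aa1621aa10dfaa065faa02e1a9c221a9c05fa9981fa99121a98861a9831fa8c61fa8c0e1a8b821a8b11fa84661a842dfa8385fa83321a63421a6309fa6261fa620e1a606a1a604dfa5c41fa5c0a1a5a821a5a11fa5889fa58521a54621a540dfa5381fa53121a4469fa444e1a438a1a4351fa2345fa232a1a22661a222dfa2169fa214e1a1c461a1c29fa1a85fa1a321a198a1a1951fa1465fa142e1a13861a1331fa0c6a1a0c4dfa0b89fa0b52195a22195a05f95941f9590a195846195829f95321f9530619516219510df95065f9502e194b42194b09f94a61f94a0e19486a19484df94345f9432a19426619422df94169f9414e18ea21f8ea0618e94218e909f8e845f8e82a18d52218d505f8d1a1f8d0a618cd41f8cd0a18caa218c8a9f8c54618c529f8c2a5f8c1aa18ab2218ab05f8a9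61f8a90e18a86618a82df89d21f89d061899a21898a5f88d62188d0df88ba1f88565f8852e1883a6186b41f86b0a186a62186a0df86869f8684e185d42185d09f85aa1f858aa185561f8550e1853a218456a18454df843a9f82b46182b29f82a65f82a2e18296a18294df81d45f81d2a181aa61819a9f8156618152df813a5f80d69f80d4e180baa176221f76206176142176109f76045f7602a175422175405f75181f75112175086175031f74c41f74c0a174a82174a11f74889f74852174446174429f74285f7423217418a174151f72a22172a05f72941f7290a172846172829f71521f715061711a21710a5f70d42170d09f70aa1f708aa170545f7052a1702a61701a9f6ac21f6ac0616a98216a911f6a885f6a83216a52216a505f6a1a1f6a0a6166c42166c09f66a81f66a1216688a166851f66541f6650a1662a21660a9f62c45f62c2a162a86162a31f62989f62952162546162529f622a5f621aa156322156305f56161f5610e15606615602df55c21f55c06155982155911f55885f55832154c62154c0df54b81f54b12154465f5442e154386154331f52b21f52b0615296215290df52865f5282e151d22151d05f519a1f518a6150d61f50d0e150ba215056615052df503a5f4ec2214ec05f4e981f4e91214e88614e831f4e521f4e50614e1a214e0a5f46c61f46c0e146b82146b11f4656214650df463a1f42c66142c2df42b85f42b32142565f4252e1423a6136341f3630a1362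6213620df36069f3604e135c42135c09f35a81f35a1213588a135851f35461f3540e135382135311f3446a13444df34389f34352132b42132b09f32a61f32a0e13286a13284df31d41f31d0a131aa21318a9f3156213150df313a1f30569f3054e1303aa12ec41f2ec0a12ea8212ea11f2e889f2e85212e54212e509f2e2a1f2e0aa12ac6212ac0df2ab81f2ab1212a561f2a50e12a3a21),
      (198415, 0xb1a21fb1a061b19421b1909fb1845fb182a1b13221b1305fb1161fb110e1b10661b102dfb0b41fb0b0a1b0a621b0a0dfb0869fb084e1b03461b0329fb0265fb022e1b016a1b014dfae2221ae205fae141fae10a1ae0461ae029fad421fad4061ad1821ad085facc421acc09faca81fac88a1ac445fac42a1ac2861ac189faa321faa3061aa1621aa10dfaa065faa02e1a9c221a9c05fa9981fa98861a8c61fa8c0e1a8b821a888dfa84661a842dfa8385fa818e1a63421a6309fa6261fa620e1a606a1a604dfa5c41fa5c0a1a5a821a5889fa54621a540dfa5381fa508e1a4469fa444e1a438a1a428dfa2345fa232a1a22661a222dfa2169fa214e1a1c461a1c29fa1a85fa198a1a1465fa142e1a13861a118dfa0c6a1a0c4dfa0b89fa0a8e195a22195a05f95941f9590a195846195829f9532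1f9530619516219510df95065f9502e194b42194b09f94a61f94a0e19486a19484df94345f9432a19426619422df94169f9414e18ea21f8ea0618e94218e909f8e845f8e82a18d52218d505f8cd41f8cd0a18c54618c529f8ab2218ab05f8a961f8a90e18a86618a82df89d21f89d06188d62188d0df88565f8852e186b41f86b0a186a62186a0df86869f8684e185d42185d09f85561f8550e18456a18454df82b46182b29f82a65f82a2e18296a18294df81d45f81d2a18156618152df80d69f80d4e176221f76206176142176109f76045f7602a175422175405f75181f75086174c41f74c0a174a82174889f74446174429f74285f7418a172a22172a05f72941f7290a172846172829f71521f71506170d42170d09f70545f7052a16ac21f6ac0616a98216a885f6a52216a505f68d81f68586166c42166c09f66a81f6688a166541f6650a165582164589f62c45f62c2a162a86162989f62546162529f61585f60d8a156322156305f56161f5610e15606615602df55c21f55c06155982155885f54c62154c0df54b81f5488e154465f5442e15438615418df52b21f52b0615296215290df52865f5282e151d22151d05f50d61f50d0e15056615052df4ec2214ec05f4e981f4e88614e521f4e50614cd8214c585f46c61f46c0e146b8214688df4656214650df45d81f42c66142c2df42b85f4298e142565f4252e141d86136341f3630a13626213620df36069f3604e135c42135c09f35a81f3588a135461f3540e1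3538213508df3446a13444df34389f3428e132b42132b09f32a61f32a0e13286a13284df31d41f31d0a13156213150df30569f3054e12ec41f2ec0a12ea8212e889f2e54212e509f2d581f2c58a12ac6212ac0df2ab81f2a88e12a561f2a50e129d821),
      (69391, 0x22c69e22c4e122b8a12256a1),
      (4311810335, 0x11a361),
      (16843551, 0x16346216329e16265e1622e21616a11614df15c45e15c2a215a86215a31e15989f1595211546611542df15385f15332112b45e12b2a212a66212a2de12969f1294e111d46211d29e11aa5e119aa111565f1152e1113a610ec4610ec29f0ea85f0ea3210e545f0e52a10e2a61),
      (197407, 0x16346116329f16265f1622e11616a11614df15c45f15c2a115a86115989f1546611542df15385f1518e112b45f12b2a112a66112a2df12969f1294e111d46111d29f11565f1152e10ec4610ec29f0ea85f0e98a10e545f0e52a10d5861),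
      (67359, 0x16346216329e16265e1622e11616a21614df15c45e15c2a215a86115989f1546621542df15385f14c69e14c4e114b8a112b45e12b2a212a66212a2df12969e1294e111d46111d29f11565f10d6a10ec4620ec29e0ea85f0e98a10e545f0e52a10ac65e0ac2e10ab8610a5661),
      (3871, 0x6c6a1),
      (4345496327, 0x68895e6819616509614c8961),
      (4311942919, 0x8d115f8d03618ca1618c855f8c235f8c156189916189835f88b15f88876188336188175f85a15f85856185316185075f84355f84276171116171035f70a15f70856170236170155f6a115f6a036168c16168435f66216166055f65415f64456151915f51836150b16150875f50335f5017614e11614e035f4cc15f4c436146315f46076145c161),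
      (50530055, 0x688b21681b1f650b1f642b214c8b1f4c1b21458b21),
      (17237767, 0x4458df445721444ae1),
      (4311941903, 0x8d115f8d03618ca1618c855f8c235f8c156189916189835f88b15f88876188336188175f85a15f85856185316185075f81a36181955f81335f81176171116171035f70a15f70856170236170155f6a115f6a036168c16168435f66216166055f65415f62235f62156161436151915f51836150b16150875f50335f5017614e11614e035f4cc15f4c436131a16131855f31315f3107612e215f2e05612d4161),
      (50529039, 0x688b21681b1f650b1f611b214c8b1f4c1b212d0b21),
      (4311811855, 0x8d115f8d03618ca1618c855f8c235f8c156189916189835f88b15f88336185a15f85856185316184355f81a36181955f81335f80b56171116171035f70a15f70856170236170155f6a115f6a036166216166055f62235f62156151915f51836150b16150335f4e11614e035f46315f42336131a16131855f31315f3035612e215f2e05612a3161),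
      (16975631, 0xb1a221b1a05fb1941fb190a1b18461b1829fb1321fb13061b11621b110dfb1065fb102e1b0b421b0b09fb0a61fb0a0e1b086a1b084dfb0345fb032a1b02661b022dfb0169fb014e1ae221fae2061ae1421ae109fae045fae02a1ad4221ad405fad181fad1121ad0861ad031facc41facc0a1aca821aca11fac889fac8521ac4461ac429fac285fac2321ac18a1ac151faa3221aa305faa161faa10e1aa0661aa02dfa9c21fa9c061a99821a9911fa9885fa98321a8c621a8c0dfa8b81fa8b121a888e1a8871fa8465fa842e1a83861a8331fa818dfa81721a6341fa630a1a62621a620dfa6069fa604e1a5c421a5c09fa5a81fa5a121a588a1a5851fa5461fa540e1a53821a5311fa508dfa50721a446a1a444dfa4389fa43521a428e1a4271fa23461a2329fa2265fa222e1a216a1a214dfa1c45fa1c2a1a1a861a1a31fa1989fa19521a14661a142dfa1385fa13321a118e1a1171fa0c69fa0c4e1a0b8a1a0b51fa0a8dfa0a72195a21f95a06195942195909f95845f9582a195322195305f95161f9510e19506619502df94b41f94b0a194a62194a0df94869f9484e194346194329f94265f9422e19416a19414df8ea2218ea05f8e941f8e90a18e84618e829f8d521f8d50618d1a218d0a5f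8cd4218cd09f8caa1f8c8aa18c545f8c52a18c2a618c1a9f8ab21f8ab0618a96218a90df8a865f8a82e189d22189d05f899a1f898a6188d61f88d0e188ba21888adf8856618852df883a5f881ae186b42186b09f86a61f86a0e18686a18684df85d41f85d0a185aa21858a9f8556218550df853a1f850ae184569f8454e1843aa1842adf82b45f82b2a182a66182a2df82969f8294e181d46181d29f81aa5f819aa181565f8152e1813a61811adf80d6a180d4df80ba9f80aae176222176205f76141f7610a176046176029f75421f75406175182175111f75085f75032174c42174c09f74a81f74a1217488a174851f74445f7442a174286174231f74189f74152172a21f72a06172942172909f72845f7282a171522171505f711a1f710a6170d41f70d0a170aa21708a9f70546170529f702a5f701aa16ac2216ac05f6a981f6a91216a88616a831f6a521f6a50616a1a216a0a5f68d82168d11f68ca1f68585f685321684a6166c41f66c0a166a82166a11f66889f66852166542166509f662a1f660aa165581f655121654a216458a164551f644a9f62c46162c29f62a85f62a3216298a162951f62545f6252a1622a61621a9f61586161531f614a5f60d89f60d52160caa156321f5630615616215610df56065f5602e155c22155c05f55981f55912155886155831f54c61f54c0e154b82154b11f5488df5487215446615442df54385f5433215418e154171f52b22152b05f52961f5290e1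5286615282df51d21f51d061519a21518a5f50d62150d0df50ba1f508ae150565f5052e1503a61501adf4ec21f4ec0614e98214e911f4e885f4e83214e52214e505f4e1a1f4e0a614cd81f4cd1214cca214c58614c531f4c4a5f46c62146c0df46b81f46b1214688e146871f46561f4650e1463a21460adf45d82145d11f45ca1f42c65f42c2e142b86142b31f4298df4297214256614252df423a5f421ae141d85f41d32141ca6136342136309f36261f3620e13606a13604df35c41f35c0a135a82135a11f35889f3585213546213540df35381f3531213508e135071f34469f3444e13438a134351f3428df34272132b41f32b0a132a62132a0df32869f3284e131d42131d09f31aa1f318aa131561f3150e1313a21310adf3056a13054df303a9f302ae12ec4212ec09f2ea81f2ea1212e88a12e851f2e541f2e50a12e2a212e0a9f2d58212d511f2d4a1f2c589f2c55212c4aa12ac61f2ac0e12ab8212ab11f2a88df2a87212a56212a50df2a3a1f2a0ae129d81f29d12129ca21),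
      (460559, 0x4458df40d8e12858e1),
      (16846607, 0x22c6a122c4df22b89f22b52122569f2254e1223aa1),
      (200463, 0x22c6a122c4df22b89f22a8e122569f2254e121d8a1),
      (4311810847, 0x11a35e1195611133610e2361),
      (16974623, 0x16345f1632a11626611622df16169f1614e115c46115c29f15a85f15a3211598a115951f15465f1542e115386115331f1518df15172112b46112b29f12a65f12a2e11296a11294df11d45f11d2a111aa61119a9f1156611152df113a5f111ae10ec45f0ec2a10ea8610ea31f0e989f0e95210e54610e529f0e2a5f0e1aa10d585f0d53210d4a61),
      (16844575, 0x16345f1632a11626611622df16169f1614e115c46115c29f15a85f15a3211598a115951f15465f1542e115386115331f14c6a114c4df14b89f14b52112b46112b29f12a65f12a2e11296a11294df11d45f11d2a111aa61119a9f1156611152df113a5f10d69f10d4e110baa10ec45f0ec2a10ea8610ea31f0e989f0e95210e54610e529f0e2a5f0e1aa10ac6610ac2df0ab85f0ab3210a565f0a52e10a3a61),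
      (198431, 0x16345f1632a11626611622df16169f1614e115c46115c29f15a85f1598a115465f1542e11538611518df14c6a114c4df14b89f14a8e112b46112b29f12a65f12a2e11296a11294df11d45f11d2a11156611152df10d69f10d4e10ec45f0ec2a10ea8610e989f0e54610e529f0d585f0cd8a10ac6610ac2df0ab85f0a98e10a565f0a52e109d861),
      (69407, 0x6c69e06c4e106b8a10656a1),
      (4345497351, 0x68896168195f65095f6429614c895f4c1961458961),
      (4312205063, 0x444761),
      (50792199, 0x443b21),
      (4345496335, 0x68896168195f65095f6119614c895f4c19612d0961),
      (4311942927, 0x8d11618d035f8ca15f8c85618c23618c155f89915f89836188b16188875f88335f88176185a16185855f85315f85076184356184275f81a35f81956181336181175f80b55f80a76171115f71036170a16170855f70235f7015616a11616a035f68c15f68436166215f66056165416164455f62236162155f61435f60c56151916151835f50b15f50876150336150175f4e115f4e03614cc1614c435f46316146075f45c15f42335f42176141c36131a15f31856131316131075f30355f3027612e21612e055f2d415f2c45612a315f2a076129c161),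
      (50530063, 0x688b1f681b21650b21642b1f611b1f60ab214c8b214c1b1f458b1f419b212d0b1f2c2b21298b21),
      (17237775, 0x4458e144571f444adf40d8df40d72140cae12858df285721284ae1),
      (4311813903, 0x223561),
      (16977679, 0x22c69f22c4e122b8a122b51f22a8df22a7212256a12254df223a9f222ae121d89f21d52121caa1),
      (462607, 0x2158e1),
      (4311941919, 0x11a36111955f11335f1117610e235f0e15610d4361),
      (50529055, 0xd1b21),
      (4311811871, 0x11a36111955f11335f10b5610e235f0e15610a3361),
      (16975647, 0x16346116329f16265f1622e11616a11614df15c45f15c2a115a86115a31f15989f1595211546611542df15385f1533211518e115171f14c69f14c4e114b8a114b51f14a8df14a72112b45f12b2a112a66112a2df12969f1294e111d46111d29f11aa5f119aa111565f1152e1113a61111adf10d6a110d4df10ba9f10aae10ec4610ec29f0ea85f0ea3210e98a10e951f0e545f0e52a10e2a610e1a9f0d58610d531f0d4a5f0cd89f0cd5210ccaa10ac65f0ac2e10ab8610ab31f0a98df0a97210a56610a52df0a3a5f0a1ae109d85f09d32109ca61),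
      (460575, 0x8d8e1),
      (16846623, 0x6c6a106c4df06b89f06b52106569f0654e1063aa1),
      (200479, 0x6c6a106c4df06b89f06a8e106569f0654e105d8a1),
      (4345759495, 0x443961),
      (4345497359, 0x68895f68196165096164295f61195f60a9614c89614c195f45895f4199612d095f2c2961298961),
      (4312205071, 0x44475f40c761284761),
      (50792207, 0x443b1f40bb21283b21),
      (4311944975, 0x22355f22276121c561),
      (50532111, 0x21ab21),
      (17239823, 0x2158df215721214ae1),
      (4345496351, 0xd1961),
      (4311942943, 0x11a35f11956111336111175f10b55f10a7610e23610e155f0d435f0cc5610a335f0a176109c361),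
      (50530079, 0xd1b1f0cab21099b21),
      (17237791, 0x8d8df08d72108cae1),
      (4311813919, 0x63561),
      (16977695, 0x6c69f06c4e106b8a106b51f06a8df06a7210656a10654df063a9f062ae105d89f05d52105caa1),
      (462623, 0x558e1),
      (4345759503, 0x44395f40b961283961),
      (4345499407, 0x21a961),
      (4312207119, 0x214761),
      (50794255, 0x213b21),
      (4345497375, 0xd195f0ca961099961),
      (4312205087, 0x8c761),
      (50792223, 0x8bb21),
      (4311944991, 0x6355f06276105c561),
      (50532127, 0x5ab21),
      (17239839, 0x558df055721054ae1),
      (4345761551, 0x213961),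
      (4345759519, 0x8b961),
      (4345499423, 0x5a961),
      (4312207135, 0x54761),
      (50794271, 0x53b21),
      (4345761567, 0x53961)]
  | _ => []

/-- The table of the formal combinations of configurations that represent Young diagrams. -/
def table (n : ℕ) : List (ℕ × Vec) := (packedTable n).map fun a => (a.1, unpack 1000 a.2)

/-- A finite computation. The origin of the combinations in the `0`-Hecke algebra plays no role in
the argument: only the tested identities are used. The bound `1000` in `table` exceeds `6! = 720`,
the largest possible number of distinct permutations in an entry. -/
theorem checkTable_table {n : ℕ} (hn₂ : 2 ≤ n) (hn₆ : n ≤ 6) :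
    checkTable n (table n) = true := by
  interval_cases n <;> decide +kernel

end Table
-- Independent exponential clocks and their renewal at the first ring.
section Restart

open scoped ENNReal

instance isProbabilityMeasure_expMeasure_one : IsProbabilityMeasure (expMeasure 1) :=
  isProbabilityMeasure_expMeasure one_pos

theorem expMeasure_apply (r : ℝ) {s : Set ℝ} (hs : MeasurableSet s) :
    expMeasure r s = ∫⁻ x, s.indicator (exponentialPDF r) x := by
  rw [lintegral_indicator hs]
  exact withDensity_apply _ hs

theorem measurable_exponentialPDF (r : ℝ) : Measurable (exponentialPDF r) :=
  (measurable_exponentialPDFReal r).ennreal_ofReal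

theorem ae_pos_expMeasure (r : ℝ) : ∀ᵐ x ∂(expMeasure r), 0 < x := by
  rw [ae_iff, expMeasure_apply _ (by simp only [not_lt]; exact measurableSet_Iic)]
  refine (lintegral_congr_ae ?_).trans lintegral_zero
  have h0 : ∀ᵐ x : ℝ, x ≠ 0 := by simp [ae_iff]
  filter_upwards [h0] with x hx
  rcases lt_or_gt_of_ne hx with hx | hx
  · rw [Set.indicator_of_mem (by simpa using hx.le), exponentialPDF_of_neg hx]
  · rw [Set.indicator_of_notMem (by simpa using hx)]

/-- The exponential distribution is memoryless. -/
theorem expMeasure_Ioi_inter_preimage_sub {h : ℝ} (hh : 0 ≤ h) {s : Set ℝ} (hs : MeasurableSet s) :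
    expMeasure 1 (Set.Ioi h ∩ (fun x => x - h) ⁻¹' s)
      = ENNReal.ofReal (Real.exp (-h)) * expMeasure 1 s := by
  have hm : MeasurableSet (Set.Ioi h ∩ (fun x => x - h) ⁻¹' s) :=
    measurableSet_Ioi.inter (measurable_id.sub_const h hs)
  rw [expMeasure_apply _ hm, expMeasure_apply _ hs, ← lintegral_const_mul _
    ((measurable_exponentialPDF 1).indicator hs), ← lintegral_add_right_eq_self _ h]
  refine lintegral_congr_ae ?_
  -- After translation by `h` the open ray `Set.Ioi h` becomes `0 < x`, whereas the density is also
  -- nonzero at `0`; this null point is discarded.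
  have h0 : ∀ᵐ x : ℝ, x ≠ 0 := by simp [ae_iff]
  filter_upwards [h0] with x hx
  by_cases hxs : x ∈ s
  · rcases lt_or_gt_of_ne hx with hx | hx
    · rw [Set.indicator_of_notMem (by simp [hx.le]), Set.indicator_of_mem hxs,
        exponentialPDF_of_neg hx, mul_zero]
    · rw [Set.indicator_of_mem (by simp [hx, hxs]), Set.indicator_of_mem hxs,
        exponentialPDF_of_nonneg hx.le, exponentialPDF_of_nonneg (by linarith),
        ← ENNReal.ofReal_mul (Real.exp_nonneg _)]
      simp only [one_mul]
      rw [← Real.exp_add, neg_add_rev]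
  · rw [Set.indicator_of_notMem (by simp [hxs]), Set.indicator_of_notMem hxs, mul_zero]

/-- Tilting the exponential distribution of rate `1` gives that of rate `m + 1`. -/
theorem lintegral_exp_pow_mul_expMeasure (m : ℕ) {f : ℝ → ℝ≥0∞} (hf : Measurable f) :
    ∫⁻ x, ENNReal.ofReal (Real.exp (-x)) ^ m * f x ∂(expMeasure 1)
      = ((m + 1 : ℕ) : ℝ≥0∞)⁻¹ * ∫⁻ x, f x ∂(expMeasure (m + 1 : ℕ)) := by
  have h1 : Measurable fun x : ℝ => ENNReal.ofReal (Real.exp (-x)) ^ m * f x := by fun_prop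
  have e1 := lintegral_withDensity_eq_lintegral_mul volume (measurable_exponentialPDF 1) h1
  have e2 := lintegral_withDensity_eq_lintegral_mul volume
    (measurable_exponentialPDF ((m + 1 : ℕ) : ℝ)) hf
  have e3 : ∀ r, volume.withDensity (exponentialPDF r) = expMeasure r := fun r => rfl
  rw [e3] at e1 e2
  rw [e1, e2, ← lintegral_const_mul _ ((measurable_exponentialPDF _).mul hf)]
  refine lintegral_congr fun x => ?_
  simp only [Pi.mul_apply]
  rcases lt_or_ge x 0 with hx | hx
  · simp [exponentialPDF_of_neg hx]
  · rw [exponentialPDF_of_nonneg hx, exponentialPDF_of_nonneg hx, ← mul_assoc, ← mul_assoc]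
    congr 1
    rw [ENNReal.ofReal_mul (p := ((m + 1 : ℕ) : ℝ)) (by positivity), ENNReal.ofReal_natCast, ← mul_assoc,
      ENNReal.inv_mul_cancel (by simp) (ENNReal.natCast_ne_top _), one_mul,
      ← ENNReal.ofReal_pow (Real.exp_nonneg _), ← ENNReal.ofReal_mul (by positivity),
      ← Real.exp_nat_mul, one_mul, one_mul, ← Real.exp_add]
    congr 2
    push_cast
    ring

variable {ι : Type*}

/-- The joint distribution of the waiting times of independent Poisson clocks of rate `1`. -/
noncomputable def clockLaw (ι : Type*) : Measure (ι × ℕ → ℝ) :=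
  Measure.infinitePi fun _ => expMeasure 1

instance : IsProbabilityMeasure (clockLaw ι) := by unfold clockLaw; infer_instance

theorem ae_pos_clockLaw [Countable ι] : ∀ᵐ g ∂(clockLaw ι), ∀ p, 0 < g p :=
  ae_all_iff.2 fun p => (measurePreserving_eval_infinitePi (fun _ : ι × ℕ => expMeasure 1)
    p).quasiMeasurePreserving.ae (ae_pos_expMeasure 1)

open Classical in
/-- The waiting times of the clocks after the first ring of clock `i`, if it rings first. -/
noncomputable def restart (i : ι) (g : ι × ℕ → ℝ) : ι × ℕ → ℝ := fun p =>
  if p.1 = i then g (i, p.2 + 1) else if p.2 = 0 then g p - g (i, 0) else g p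

/-- Clock `i` is the first one to ring. -/
def ringsFirst (i : ι) : Set (ι × ℕ → ℝ) := {g | ∀ l, l ≠ i → g (i, 0) < g (l, 0)}

theorem measurable_restart (i : ι) : Measurable (restart i) := by
  classical
  refine measurable_pi_lambda _ fun p => ?_
  unfold restart
  split_ifs <;> fun_prop

theorem measurableSet_ringsFirst [Finite ι] (i : ι) : MeasurableSet (ringsFirst i) := by
  have : ringsFirst i = ⋂ l, {g : ι × ℕ → ℝ | l ≠ i → g (i, 0) < g (l, 0)} := by
    ext g; simp [ringsFirst]
  rw [this]
  refine MeasurableSet.iInter fun l => ?_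
  by_cases h : l = i
  · simp [h]
  · simpa [h] using measurableSet_lt (measurable_pi_apply (X := fun _ : ι × ℕ => ℝ) (i, 0))
      (measurable_pi_apply (l, 0))

open Classical in
/-- Insert an additional waiting time at the beginning of clock `i`. -/
noncomputable def insertGap (i : ι) (x : ℝ × (ι × ℕ → ℝ)) : ι × ℕ → ℝ := fun p =>
  if p.1 = i then (if p.2 = 0 then x.1 else x.2 (i, p.2 - 1)) else x.2 p

theorem measurable_insertGap (i : ι) : Measurable (insertGap i) := by
  classical
  refine measurable_pi_lambda _ fun p => ?_
  unfold insertGap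
  split_ifs <;> fun_prop

/-- The first waiting time of a clock and the remaining waiting times are independent. -/
theorem map_insertGap (i : ι) :
    ((expMeasure 1).prod (clockLaw ι)).map (insertGap i) = clockLaw ι := by
  classical
  refine Measure.eq_infinitePi _ fun s t ht => ?_
  -- The places which the old waiting times take after the insertion; the only place not of this
  -- form is `(i, 0)`. A box therefore splits into a condition on the new time and a box for the old
  -- ones.
  let shift : ι × ℕ → ι × ℕ := fun p => if p.1 = i then (i, p.2 + 1) else p
  have hinj : Function.Injective shift := by
    rintro ⟨a, b⟩ ⟨c, d⟩ h
    simp only [shift] at h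
    split_ifs at h with h1 h2 h2 <;> simp_all [Prod.ext_iff]
  have hrange : ∀ p, p ∈ Set.range shift ↔ p ≠ (i, 0) := by
    rintro ⟨a, b⟩
    constructor
    · rintro ⟨⟨c, d⟩, h⟩
      simp only [shift] at h
      rw [← h]
      split_ifs with h1
      · simp
      · exact fun h2 => h1 (Prod.mk.inj h2).1
    · intro h
      by_cases ha : a = i
      · subst ha
        have hb : b ≠ 0 := fun hb => h (by rw [hb])
        refine ⟨(a, b - 1), ?_⟩
        simp only [shift, if_true]
        congr 1
        omega
      · exact ⟨(a, b), by simp [shift, ha]⟩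
  have hins : ∀ x : ℝ × (ι × ℕ → ℝ), ∀ q, insertGap i x (shift q) = x.2 q := by
    rintro x ⟨a, b⟩
    by_cases ha : a = i <;> simp [insertGap, shift, ha]
  have hins0 : ∀ x : ℝ × (ι × ℕ → ℝ), insertGap i x (i, 0) = x.1 := by
    intro x
    simp [insertGap]
  have hpre : insertGap i ⁻¹' ((s : Set (ι × ℕ)).pi t)
      = {h | (i, 0) ∈ s → h ∈ t (i, 0)} ×ˢ
        ((s.preimage shift hinj.injOn : Set (ι × ℕ)).pi fun q => t (shift q)) := by
    ext x
    simp only [Set.mem_preimage, Set.mem_pi, Finset.mem_coe, Set.mem_prod, Set.mem_ofPred_eq,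
      Finset.coe_preimage]
    constructor
    · intro h
      exact ⟨fun h0 => hins0 x ▸ h _ h0, fun q hq => hins x q ▸ h _ hq⟩
    · rintro ⟨h1, h2⟩ p hp
      by_cases h0 : p = (i, 0)
      · subst h0
        rw [hins0]
        exact h1 hp
      · obtain ⟨q, rfl⟩ := (hrange p).2 h0
        rw [hins]
        exact h2 q hp
  rw [Measure.map_apply (measurable_insertGap i)
    (MeasurableSet.pi s.countable_toSet fun p _ => ht p), hpre, Measure.prod_prod, clockLaw,
    Measure.infinitePi_pi _ fun q _ => ht _,
    Finset.prod_preimage' shift s hinj.injOn fun p => expMeasure 1 (t p)]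
  have hfil : s.filter (· ∈ Set.range shift) = s.erase (i, 0) := by
    ext p
    rw [Finset.mem_filter, hrange, Finset.mem_erase, and_comm]
  rw [hfil]
  by_cases h0 : (i, 0) ∈ s
  · simp only [h0, forall_const, Set.ofPred_mem_eq]
    exact Finset.mul_prod_erase s (fun p => expMeasure 1 (t p)) h0
  · simp [h0]

open Classical in
/-- Subtract `h` from the first waiting times of all clocks but `i`. -/
noncomputable def subFirst (i : ι) (h : ℝ) (g : ι × ℕ → ℝ) : ι × ℕ → ℝ := fun p =>
  if p.2 = 0 ∧ p.1 ≠ i then g p - h else g p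

theorem measurable_subFirst (i : ι) : Measurable fun x : ℝ × (ι × ℕ → ℝ) => subFirst i x.1 x.2 := by
  classical
  refine measurable_pi_lambda _ fun p => ?_
  unfold subFirst
  split_ifs <;> fun_prop

/-- Memorylessness of all clocks other than `i` at once: each of them survives beyond `h` with
probability `exp (-h)`, and given this its residual first waiting time is again exponential. -/
theorem clockLaw_subFirst [Fintype ι] (i : ι) {h : ℝ} (hh : 0 ≤ h) {C : Set (ι × ℕ → ℝ)}
    (hC : MeasurableSet C) :
    clockLaw ι {g | (∀ l, l ≠ i → h < g (l, 0)) ∧ subFirst i h g ∈ C}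
      = ENNReal.ofReal (Real.exp (-h)) ^ (Fintype.card ι - 1) * clockLaw ι C := by
  classical
  set c : ℝ≥0∞ := ENNReal.ofReal (Real.exp (-h)) ^ (Fintype.card ι - 1) with hc
  have hc0 : c ≠ 0 := pow_ne_zero _ (by simpa using Real.exp_pos _)
  have hct : c ≠ ⊤ := ENNReal.pow_ne_top ENNReal.ofReal_ne_top
  have hsub : Measurable (subFirst i h) := (measurable_subFirst i).comp measurable_prodMk_left
  let A : Set (ι × ℕ → ℝ) := {g | ∀ l, l ≠ i → h < g (l, 0)}
  have hA : MeasurableSet A := by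
    have : A = ⋂ l, {g : ι × ℕ → ℝ | l ≠ i → h < g (l, 0)} := by
      ext g; simp [A]
    rw [this]
    refine MeasurableSet.iInter fun l => ?_
    by_cases hl : l = i
    · simp [hl]
    · simpa [hl] using measurableSet_lt measurable_const
        (measurable_pi_apply (X := fun _ : ι × ℕ => ℝ) (l, 0))
  -- The law conditioned on `A` is compared with the product law on finite-dimensional boxes, which
  -- determine an infinite product measure.
  have key : c⁻¹ • ((clockLaw ι).restrict A).map (subFirst i h) = clockLaw ι := by
    refine Measure.eq_infinitePi _ fun s t ht => ?_
    have hbox : MeasurableSet ((s : Set (ι × ℕ)).pi t) :=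
      MeasurableSet.pi s.countable_toSet fun p _ => ht p
    rw [Measure.smul_apply, Measure.map_apply hsub hbox, Measure.restrict_apply (hsub hbox),
      smul_eq_mul]
    let H : Finset (ι × ℕ) := (Finset.univ.erase i).image fun l => (l, 0)
    have hH : ∀ p : ι × ℕ, p ∈ H ↔ p.2 = 0 ∧ p.1 ≠ i := by
      rintro ⟨a, b⟩
      simp only [H, Finset.mem_image, Finset.mem_erase, Finset.mem_univ, and_true, Prod.mk.injEq]
      constructor
      · rintro ⟨l, hl, rfl, rfl⟩
        exact ⟨rfl, hl⟩
      · rintro ⟨rfl, ha⟩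
        exact ⟨a, ha, rfl, rfl⟩
    have hHcard : H.card = Fintype.card ι - 1 := by
      rw [Finset.card_image_of_injective _ fun a b hab => (Prod.mk.inj hab).1,
        Finset.card_erase_of_mem (Finset.mem_univ i), Finset.card_univ]
    -- The event `A` constrains the coordinates in `H`, which need not belong to `s`. Void
    -- conditions off `s` let the box be written over `s ∪ H`.
    let t' : ι × ℕ → Set ℝ := fun p => if p ∈ s then t p else Set.univ
    have ht' : ∀ p, MeasurableSet (t' p) := fun p => by
      simp only [t']
      split_ifs
      exacts [ht p, MeasurableSet.univ]
    let u : ι × ℕ → Set ℝ := fun p =>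
      if p ∈ H then Set.Ioi h ∩ (fun x => x - h) ⁻¹' (t' p) else t' p
    have hu : ∀ p, MeasurableSet (u p) := fun p => by
      simp only [u]
      split_ifs
      · exact measurableSet_Ioi.inter (measurable_id.sub_const h (ht' p))
      · exact ht' p
    have hpre : subFirst i h ⁻¹' ((s : Set (ι × ℕ)).pi t) ∩ A
        = ((s ∪ H : Finset (ι × ℕ)) : Set (ι × ℕ)).pi u := by
      ext g
      simp only [Set.mem_inter_iff, Set.mem_preimage, Set.mem_pi, Finset.mem_coe, A,
        Set.mem_ofPred_eq, Finset.mem_union]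
      constructor
      · rintro ⟨h1, h2⟩ p hp
        by_cases hpH : p ∈ H
        · simp only [u, if_pos hpH]
          have hp2 := (hH p).1 hpH
          refine ⟨?_, ?_⟩
          · have := h2 p.1 hp2.2
            rwa [← hp2.1] at this
          · simp only [t', Set.mem_preimage]
            split_ifs with hps
            · have := h1 p hps
              rwa [subFirst, if_pos hp2] at this
            · trivial
        · have hps := hp.resolve_right hpH
          simp only [u, if_neg hpH, t', if_pos hps]
          have := h1 p hps
          rwa [subFirst, if_neg (fun h => hpH ((hH p).2 h))] at this
      · intro hg
        constructor
        · intro p hps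
          have := hg p (Or.inl hps)
          by_cases hpH : p ∈ H
          · simp only [u, if_pos hpH, t', if_pos hps] at this
            rw [subFirst, if_pos ((hH p).1 hpH)]
            exact this.2
          · simp only [u, if_neg hpH, t', if_pos hps] at this
            rwa [subFirst, if_neg (fun h => hpH ((hH p).2 h))]
        · intro l hl
          have hlH : (l, 0) ∈ H := (hH _).2 ⟨rfl, hl⟩
          have := hg (l, 0) (Or.inr hlH)
          simp only [u, if_pos hlH] at this
          exact this.1
    have hprod : ∏ p ∈ s ∪ H, expMeasure 1 (u p) = c * ∏ p ∈ s, expMeasure 1 (t p) := by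
      have h1 : ∀ p, expMeasure 1 (u p)
          = (if p ∈ H then ENNReal.ofReal (Real.exp (-h)) else 1)
            * (if p ∈ s then expMeasure 1 (t p) else 1) := by
        intro p
        have h2 : expMeasure 1 (t' p) = if p ∈ s then expMeasure 1 (t p) else 1 := by
          simp only [t']
          split_ifs <;> simp
        rw [← h2]
        simp only [u]
        split_ifs
        · exact expMeasure_Ioi_inter_preimage_sub hh (ht' p)
        · rw [one_mul]
      simp_rw [h1]
      rw [Finset.prod_mul_distrib, Finset.prod_ite_mem, Finset.prod_ite_mem,
        Finset.inter_eq_right.2 Finset.subset_union_right,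
        Finset.inter_eq_right.2 Finset.subset_union_left, Finset.prod_const, hHcard]
    rw [hpre, clockLaw, Measure.infinitePi_pi _ fun p _ => hu p, hprod, ← mul_assoc,
      ENNReal.inv_mul_cancel hc0 hct, one_mul]
  have h2 := congrArg (fun ν => c * ν C) key
  simp only [Measure.smul_apply, Measure.map_apply hsub hC, Measure.restrict_apply (hsub hC),
    smul_eq_mul, ← mul_assoc, ENNReal.mul_inv_cancel hc0 hct, one_mul] at h2
  rw [← h2]
  congr 1
  ext g
  simp [A, and_comm]

/-- On the event that clock `i` rings first, the time of that ring is exponentially distributed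
with the total rate, and the clocks start afresh, independently of it. -/
theorem map_restart [Fintype ι] (i : ι) :
    ((clockLaw ι).restrict (ringsFirst i)).map (fun g => (g (i, 0), restart i g))
      = (Fintype.card ι : ℝ≥0∞)⁻¹ • (expMeasure (Fintype.card ι)).prod (clockLaw ι) := by
  classical
  have hcard : Fintype.card ι = (Fintype.card ι - 1) + 1 := by
    have := Fintype.card_pos_iff.2 ⟨i⟩
    omega
  have hm : Measurable fun g : ι × ℕ → ℝ => (g (i, 0), restart i g) :=
    (measurable_pi_apply _).prodMk (measurable_restart i)
  have : IsProbabilityMeasure (expMeasure (Fintype.card ι)) :=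
    isProbabilityMeasure_expMeasure (by rw [hcard]; positivity)
  ext C hC
  rw [Measure.map_apply hm hC, Measure.restrict_apply (hm hC), Measure.smul_apply,
    Measure.prod_apply hC, smul_eq_mul]
  -- Split off the first waiting time `h` of clock `i`. For fixed `h > 0` the other `N - 1` clocks
  -- contribute `exp (-h) ^ (N - 1)`, and this tilt turns the rate `1` law of `h` into `N⁻¹` times
  -- the law of rate `N`.
  conv_lhs => rw [← map_insertGap i]
  rw [Measure.map_apply (measurable_insertGap i) ((hm hC).inter (measurableSet_ringsFirst i)),
    Measure.prod_apply (measurable_insertGap i ((hm hC).inter (measurableSet_ringsFirst i)))]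
  have hrestart : ∀ h g, restart i (insertGap i (h, g)) = subFirst i h g := by
    intro h g
    ext ⟨a, b⟩
    by_cases ha : a = i
    · simp [restart, insertGap, subFirst, ha]
    · by_cases hb : b = 0 <;> simp [restart, insertGap, subFirst, ha, hb]
  have h1 : ∀ᵐ h ∂(expMeasure 1), clockLaw ι (Prod.mk h ⁻¹' (insertGap i ⁻¹'
      ((fun g => (g (i, 0), restart i g)) ⁻¹' C ∩ ringsFirst i)))
      = ENNReal.ofReal (Real.exp (-h)) ^ (Fintype.card ι - 1) * clockLaw ι (Prod.mk h ⁻¹' C) := by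
    filter_upwards [ae_pos_expMeasure 1] with h hh
    rw [← clockLaw_subFirst i hh.le (measurable_prodMk_left hC)]
    congr 1
    ext g
    simp only [Set.mem_preimage, Set.mem_inter_iff, hrestart, ringsFirst, Set.mem_ofPred_eq]
    rw [and_comm]
    refine and_congr (forall₂_congr fun l hl => ?_) ?_
    · simp [insertGap, hl]
    · simp [insertGap]
  rw [lintegral_congr_ae h1,
    lintegral_exp_pow_mul_expMeasure _ (measurable_measure_prodMk_left hC), ← hcard]

end Restart

/-! ### Absorbing systems driven by clocks, and their hitting times. -/

section JumpSystem

open scoped ENNReal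

variable {ι κ S : Type*}

theorem ringsFirst_unique {g : ι × ℕ → ℝ} {i j : ι} (hi : g ∈ ringsFirst i)
    (hj : g ∈ ringsFirst j) : i = j := by
  by_contra h
  exact lt_asymm (hi j (Ne.symm h)) (hj i h)

theorem pairwise_disjoint_ringsFirst :
    Pairwise (Function.onFun Disjoint (ringsFirst : ι → Set (ι × ℕ → ℝ))) := by
  intro i j hij
  exact Set.disjoint_left.2 fun g hi hj => hij (ringsFirst_unique hi hj)

variable [Nonempty ι]

open Classical in
/-- The first clock to ring. -/
noncomputable def firstClock (g : ι × ℕ → ℝ) : ι :=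
  if h : ∃ i, g ∈ ringsFirst i then h.choose else Classical.arbitrary ι

/-- The time of the first ring. -/
noncomputable def firstGap (g : ι × ℕ → ℝ) : ℝ := g (firstClock g, 0)

/-- The waiting times after the first ring. -/
noncomputable def next (g : ι × ℕ → ℝ) : ι × ℕ → ℝ := restart (firstClock g) g

theorem firstClock_eq {g : ι × ℕ → ℝ} {i : ι} (h : g ∈ ringsFirst i) : firstClock g = i := by
  have h' : ∃ i, g ∈ ringsFirst i := ⟨i, h⟩
  rw [firstClock, dif_pos h']
  exact ringsFirst_unique h'.choose_spec h

theorem measurableSet_firstClock_eq [Finite ι] (i : ι) :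
    MeasurableSet {g : ι × ℕ → ℝ | firstClock g = i} := by
  -- The second set accounts for the default value of `firstClock` when no clock is strictly first.
  have h : {g : ι × ℕ → ℝ | firstClock g = i}
      = ringsFirst i ∪ ({_g | Classical.arbitrary ι = i} ∩ (⋃ j, ringsFirst j)ᶜ) := by
    ext g
    simp only [Set.mem_ofPred_eq, Set.mem_union, Set.mem_inter_iff, Set.mem_compl_iff,
      Set.mem_iUnion]
    by_cases h : ∃ j, g ∈ ringsFirst j
    · obtain ⟨j, hj⟩ := h
      rw [firstClock_eq hj]
      constructor
      · rintro rfl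
        exact Or.inl hj
      · rintro (h | h)
        · exact ringsFirst_unique hj h
        · exact absurd ⟨j, hj⟩ h.2
    · rw [firstClock, dif_neg h]
      have : g ∉ ringsFirst i := fun hi => h ⟨i, hi⟩
      simp [h, this]
  rw [h]
  exact (measurableSet_ringsFirst i).union ((MeasurableSet.const _).inter
    (MeasurableSet.iUnion fun j => measurableSet_ringsFirst j).compl)

theorem measurable_comp_firstClock [Finite ι] {β : Type*} [MeasurableSpace β]
    {F : ι → (ι × ℕ → ℝ) → β} (hF : ∀ i, Measurable (F i)) :
    Measurable fun g => F (firstClock g) g := by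
  intro B hB
  have : (fun g => F (firstClock g) g) ⁻¹' B
      = ⋃ i, ({g : ι × ℕ → ℝ | firstClock g = i} ∩ F i ⁻¹' B) := by
    ext g; simp
  rw [this]
  exact MeasurableSet.iUnion fun i => (measurableSet_firstClock_eq i).inter (hF i hB)

theorem measurable_firstGap [Finite ι] : Measurable (firstGap (ι := ι)) :=
  measurable_comp_firstClock (F := fun i g => g (i, 0)) fun _ => measurable_pi_apply _

theorem measurable_next [Finite ι] : Measurable (next (ι := ι)) :=
  measurable_comp_firstClock (F := restart) measurable_restart

/-- The state after `m` rings. -/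
noncomputable def stateSeq (attempt : ι → S → S) : S → (ι × ℕ → ℝ) → ℕ → S
  | s, _, 0 => s
  | s, g, m + 1 => stateSeq attempt (attempt (firstClock g) s) (next g) m

/-- `stateSeq` recurses on the first ring, as the restart property requires; here the last ring is
split off instead, as in `stateAfter`. -/
theorem stateSeq_succ (attempt : ι → S → S) (s : S) (g : ι × ℕ → ℝ) (m : ℕ) :
    stateSeq attempt s g (m + 1)
      = attempt (firstClock (next^[m] g)) (stateSeq attempt s g m) := by
  induction m generalizing s g with
  | zero => rfl
  | succ m ih => exact ih _ _

open Classical in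
/-- The time at which the state first belongs to the set `d`. -/
noncomputable def hitTime (attempt : ι → S → S) (d : S → Prop) (s : S) (g : ι × ℕ → ℝ) : ℝ≥0∞ :=
  ∑' m, if d (stateSeq attempt s g m) then 0 else ENNReal.ofReal (firstGap (next^[m] g))

-- Splitting at the first ring needs no absorption, because `hitTime` adds up all the time spent
-- outside `d`. This is the hitting time once `d` is known to be absorbing.
open Classical in
theorem hitTime_eq (attempt : ι → S → S) (d : S → Prop) (s : S) (g : ι × ℕ → ℝ) :
    hitTime attempt d s g = (if d s then 0 else ENNReal.ofReal (firstGap g))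
      + hitTime attempt d (attempt (firstClock g) s) (next g) := by
  rw [hitTime, tsum_eq_zero_add' ENNReal.summable]
  rfl

/-- A system which changes its state finitely often only, and cannot get stuck before all targets
are reached. -/
structure IsAbsorbing (attempt : ι → S → S) (done : κ → S → Prop) (rank : S → ℕ) : Prop where
  done_attempt : ∀ k i s, done k s → done k (attempt i s)
  rank_lt : ∀ i s, attempt i s ≠ s → rank (attempt i s) < rank s
  exists_ne : ∀ k s, ¬ done k s → ∃ i, attempt i s ≠ s

namespace IsAbsorbing

variable {attempt : ι → S → S} {done : κ → S → Prop} {rank : S → ℕ}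

theorem done_stateSeq (H : IsAbsorbing attempt done rank) {k : κ} {s : S} {g : ι × ℕ → ℝ}
    {m m' : ℕ} (hm : m ≤ m') (h : done k (stateSeq attempt s g m)) :
    done k (stateSeq attempt s g m') := by
  induction m', hm using Nat.le_induction with
  | base => exact h
  | succ m' _ ih =>
    rw [stateSeq_succ]
    exact H.done_attempt _ _ _ ih

open Classical in
theorem hitTime_eq_sum (H : IsAbsorbing attempt done rank) {k : κ} {s : S} {g : ι × ℕ → ℝ}
    (h : ∃ m, done k (stateSeq attempt s g m)) :
    hitTime attempt (done k) s g
      = ∑ m ∈ Finset.range (Nat.find h), ENNReal.ofReal (firstGap (next^[m] g)) := by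
  rw [hitTime, tsum_eq_sum (s := Finset.range (Nat.find h))]
  · refine Finset.sum_congr rfl fun m hm => ?_
    rw [if_neg (Nat.find_min h (Finset.mem_range.1 hm))]
  · intro m hm
    rw [if_pos (H.done_stateSeq (not_lt.1 fun h' => hm (Finset.mem_range.2 h')) (Nat.find_spec h))]

theorem hitTime_ne_top (H : IsAbsorbing attempt done rank) {k : κ} {s : S} {g : ι × ℕ → ℝ}
    (h : ∃ m, done k (stateSeq attempt s g m)) : hitTime attempt (done k) s g ≠ ⊤ := by
  classical
  rw [H.hitTime_eq_sum h]
  exact (ENNReal.sum_lt_top.2 fun m _ => ENNReal.ofReal_lt_top).ne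

end IsAbsorbing

variable [Fintype ι]

theorem isProbabilityMeasure_expMeasure_card :
    IsProbabilityMeasure (expMeasure (Fintype.card ι)) :=
  isProbabilityMeasure_expMeasure (by exact_mod_cast Fintype.card_pos)

theorem clockLaw_ringsFirst_inter (i : ι) {B : Set (ι × ℕ → ℝ)} (hB : MeasurableSet B) :
    clockLaw ι (restart i ⁻¹' B ∩ ringsFirst i)
      = (Fintype.card ι : ℝ≥0∞)⁻¹ * clockLaw ι B := by
  have hm : Measurable fun g : ι × ℕ → ℝ => (g (i, 0), restart i g) :=
    (measurable_pi_apply _).prodMk (measurable_restart i)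
  have h := congrArg (fun ν => ν (Set.univ ×ˢ B)) (map_restart i)
  have := isProbabilityMeasure_expMeasure_card (ι := ι)
  simp only [Measure.map_apply hm (MeasurableSet.univ.prod hB), Measure.smul_apply,
    Measure.restrict_apply (hm (MeasurableSet.univ.prod hB)), Measure.prod_prod, measure_univ,
    one_mul, smul_eq_mul] at h
  rw [← h]
  congr 1
  ext g
  simp

/-- The events that a given clock is strictly first are disjoint, and each has probability one over
the number of clocks, so together they have probability `1`. -/
theorem ae_exists_mem_ringsFirst : ∀ᵐ g ∂(clockLaw ι), g ∈ ⋃ i, ringsFirst i := by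
  have hm : MeasurableSet (⋃ i : ι, ringsFirst i) :=
    MeasurableSet.iUnion fun i => measurableSet_ringsFirst i
  refine (mem_ae_iff_prob_eq_one hm).2 ?_
  have h : ∀ i : ι, clockLaw ι (ringsFirst i) = (Fintype.card ι : ℝ≥0∞)⁻¹ := fun i => by
    simpa using clockLaw_ringsFirst_inter i MeasurableSet.univ
  rw [measure_iUnion pairwise_disjoint_ringsFirst measurableSet_ringsFirst, tsum_fintype]
  simp only [h, Finset.sum_const, Finset.card_univ, nsmul_eq_mul]
  exact ENNReal.mul_inv_cancel (by simp) (ENNReal.natCast_ne_top _)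

/-- The event may depend on the first clock, since the state from which the system continues does.
-/
theorem clockLaw_next (B : ι → Set (ι × ℕ → ℝ)) (hB : ∀ i, MeasurableSet (B i)) :
    clockLaw ι {g | next g ∈ B (firstClock g)}
      = (Fintype.card ι : ℝ≥0∞)⁻¹ * ∑ i, clockLaw ι (B i) := by
  have h1 : clockLaw ι {g | next g ∈ B (firstClock g)}
      = clockLaw ι (⋃ i, (restart i ⁻¹' B i ∩ ringsFirst i)) := by
    refine measure_congr ?_
    filter_upwards [ae_exists_mem_ringsFirst] with g hg
    obtain ⟨i, hi⟩ := Set.mem_iUnion.1 hg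
    refine propext ?_
    change next g ∈ B (firstClock g) ↔ g ∈ ⋃ i, (restart i ⁻¹' B i ∩ ringsFirst i)
    rw [next, firstClock_eq hi, Set.mem_iUnion]
    constructor
    · intro h
      exact ⟨i, h, hi⟩
    · rintro ⟨j, h, hj⟩
      rwa [ringsFirst_unique hi hj]
  rw [h1, measure_iUnion, tsum_fintype, Finset.mul_sum]
  · exact Finset.sum_congr rfl fun i _ => clockLaw_ringsFirst_inter i (hB i)
  · intro i j hij
    exact (pairwise_disjoint_ringsFirst hij).mono Set.inter_subset_right Set.inter_subset_right
  · exact fun i => (measurable_restart i (hB i)).inter (measurableSet_ringsFirst i)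

/-- With the same event for every clock, `clockLaw_next` shows that `next` preserves `clockLaw`. A
measurable hull is used because `p` need not be measurable. -/
theorem ae_next {p : (ι × ℕ → ℝ) → Prop} (hp : ∀ᵐ g ∂(clockLaw ι), p g) :
    ∀ᵐ g ∂(clockLaw ι), p (next g) := by
  rw [ae_iff] at hp ⊢
  have h := clockLaw_next (ι := ι) (fun _ => toMeasurable (clockLaw ι) {g | ¬ p g})
    fun _ => measurableSet_toMeasurable _ _
  simp only [measure_toMeasurable, hp, Finset.sum_const_zero, mul_zero] at h
  exact measure_mono_null (fun g hg =>
    (subset_toMeasurable (clockLaw ι) {g | ¬ p g} hg : next g ∈ _)) h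

theorem ae_iterate_next {p : (ι × ℕ → ℝ) → Prop} (hp : ∀ᵐ g ∂(clockLaw ι), p g) :
    ∀ᵐ g ∂(clockLaw ι), ∀ m, p (next^[m] g) := by
  refine ae_all_iff.2 fun m => ?_
  induction m with
  | zero => exact hp
  | succ m ih => exact ae_next ih

theorem integral_next {F : ι → ℝ × (ι × ℕ → ℝ) → ℂ}
    (hF : ∀ i, Integrable (F i) ((expMeasure (Fintype.card ι)).prod (clockLaw ι))) :
    ∫ g, F (firstClock g) (firstGap g, next g) ∂(clockLaw ι)
      = ∑ i, (Fintype.card ι : ℂ)⁻¹ *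
        ∫ x, F i x ∂((expMeasure (Fintype.card ι)).prod (clockLaw ι)) := by
  have hm : ∀ i : ι, Measurable fun g : ι × ℕ → ℝ => (g (i, 0), restart i g) := fun i =>
    (measurable_pi_apply _).prodMk (measurable_restart i)
  have hc : (Fintype.card ι : ℝ≥0∞)⁻¹ ≠ ⊤ := by simp
  have hmap : ∀ i, Integrable (F i) (((clockLaw ι).restrict (ringsFirst i)).map
      (fun g => (g (i, 0), restart i g))) := fun i => by
    rw [map_restart]
    exact (hF i).smul_measure hc
  have heq : ∀ i, ∀ g ∈ ringsFirst i,
      F i (g (i, 0), restart i g) = F (firstClock g) (firstGap g, next g) := by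
    intro i g hg
    rw [firstGap, next, firstClock_eq hg]
  rw [← setIntegral_eq_integral_of_ae_compl_eq_zero (s := ⋃ i : ι, ringsFirst i),
    integral_iUnion_fintype measurableSet_ringsFirst pairwise_disjoint_ringsFirst]
  · refine Finset.sum_congr rfl fun i _ => ?_
    rw [← setIntegral_congr_fun (measurableSet_ringsFirst i) (heq i),
      ← integral_map (hm i).aemeasurable (hmap i).aestronglyMeasurable, map_restart,
      integral_smul_measure]
    simp
  · intro i
    exact ((integrable_map_measure (hmap i).aestronglyMeasurable (hm i).aemeasurable).1
      (hmap i)).congr ((ae_restrict_iff' (measurableSet_ringsFirst i)).2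
        (Filter.Eventually.of_forall (heq i)))
  · filter_upwards [ae_exists_mem_ringsFirst] with g hg h
    exact absurd hg h

theorem measurableSet_stateSeq (attempt : ι → S → S) (d : S → Prop) (s : S) (m : ℕ) :
    MeasurableSet {g | d (stateSeq attempt s g m)} := by
  induction m generalizing s with
  | zero => exact MeasurableSet.const (d s)
  | succ m ih =>
    have : {g | d (stateSeq attempt s g (m + 1))} = ⋃ i, ({g : ι × ℕ → ℝ | firstClock g = i} ∩
        next ⁻¹' {g | d (stateSeq attempt (attempt i s) g m)}) := by
      ext g; simp [stateSeq]
    rw [this]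
    exact MeasurableSet.iUnion fun i =>
      (measurableSet_firstClock_eq i).inter (measurable_next (ih _))

theorem measurable_hitTime (attempt : ι → S → S) (d : S → Prop) (s : S) :
    Measurable (hitTime attempt d s) := by
  classical
  refine Measurable.tsum fun m => Measurable.ite (measurableSet_stateSeq attempt d s m)
    measurable_const (ENNReal.measurable_ofReal.comp (measurable_firstGap.comp ?_))
  exact measurable_next.iterate m

namespace IsAbsorbing

variable {attempt : ι → S → S} {done : κ → S → Prop} {rank : S → ℕ}

/-- Let `q` be the probability of never reaching the target from `s`. By induction on the rank, this
probability is `0` from every state other than `s` that one attempt leads to. Conditioning on the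
first clock gives `q = (f / N) * q`, where `f` counts the clocks that fix `s`. Some clock moves `s`,
so `f < N` and `q = 0`. -/
theorem clockLaw_never (H : IsAbsorbing attempt done rank) (k : κ) (s : S) :
    clockLaw ι {g | ∀ m, ¬ done k (stateSeq attempt s g m)} = 0 := by
  classical
  induction hr : rank s using Nat.strong_induction_on generalizing s with
  | _ r ih =>
  by_cases hd : done k s
  · convert measure_empty (μ := clockLaw ι)
    ext g
    simp only [Set.mem_ofPred_eq, Set.mem_empty_iff_false, iff_false, not_forall, not_not]
    exact ⟨0, hd⟩
  · set N : S → Set (ι × ℕ → ℝ) := fun s => {g | ∀ m, ¬ done k (stateSeq attempt s g m)} with hN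
    have hNm : ∀ s, MeasurableSet (N s) := fun s => by
      have : N s = ⋂ m, {g | ¬ done k (stateSeq attempt s g m)} := by
        ext g; simp [N]
      rw [this]
      exact MeasurableSet.iInter fun m => measurableSet_stateSeq attempt (fun s => ¬ done k s) s m
    have h1 : N s = {g | next g ∈ N (attempt (firstClock g) s)} := by
      ext g
      constructor
      · intro h m
        exact h (m + 1)
      · intro h m
        cases m with
        | zero => exact hd
        | succ m => exact h m
    have h2 := clockLaw_next (fun i => N (attempt i s)) fun i => hNm _
    rw [← h1] at h2
    have h3 : ∀ i, clockLaw ι (N (attempt i s))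
        = if attempt i s = s then clockLaw ι (N s) else 0 := by
      intro i
      split_ifs with h
      · rw [h]
      · exact ih _ (hr ▸ H.rank_lt i s h) _ rfl
    obtain ⟨i, hi⟩ := H.exists_ne k s hd
    simp only [h3, Finset.sum_ite, Finset.sum_const, nsmul_eq_mul, mul_zero, add_zero] at h2
    by_contra h0
    have h4 : ((Finset.univ.filter fun i => attempt i s = s).card : ℝ≥0∞) < Fintype.card ι := by
      have : (Finset.univ.filter fun i => attempt i s = s).card < Fintype.card ι := by
        refine Finset.card_lt_univ_of_notMem (x := i) ?_
        simpa using hi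
      exact_mod_cast this
    have h5 : (Fintype.card ι : ℝ≥0∞) * clockLaw ι (N s)
        = (Finset.univ.filter fun i => attempt i s = s).card * clockLaw ι (N s) := by
      conv_lhs => rw [h2]
      rw [← mul_assoc, ENNReal.mul_inv_cancel (by simp) (ENNReal.natCast_ne_top _), one_mul]
    rw [ENNReal.mul_left_inj h0 (measure_ne_top _ _)] at h5
    exact h4.ne' h5

theorem ae_exists_done [Finite κ] (H : IsAbsorbing attempt done rank) (s : S) :
    ∀ᵐ g ∂(clockLaw ι), ∀ k, ∃ m, done k (stateSeq attempt s g m) := by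
  refine ae_all_iff.2 fun k => ?_
  rw [ae_iff]
  simpa using H.clockLaw_never k s

end IsAbsorbing

end JumpSystem

/-! ### The equations satisfied by the joint Laplace transforms. -/

section Laplace

open scoped ENNReal

/-- The case `z.re = 0` is needed for characteristic functions; convergence comes from `r > 0`. -/
theorem integral_exp_expMeasure {r : ℝ} (hr : 0 < r) {z : ℂ} (hz : 0 ≤ z.re) :
    ∫ t, Complex.exp (-z * t) ∂(expMeasure r) = r / (r + z) := by
  have hpdf : expMeasure r = volume.withDensity (exponentialPDF r) := rfl
  have hre : (-(r + z)).re < 0 := by simp; linarith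
  rw [hpdf, integral_withDensity_eq_integral_toReal_smul (measurable_exponentialPDF r)
    (Filter.Eventually.of_forall fun x => ENNReal.ofReal_lt_top)]
  have h1 : ∀ᵐ t : ℝ, (exponentialPDF r t).toReal • Complex.exp (-z * t)
      = (Set.Ioi (0 : ℝ)).indicator (fun t : ℝ => r * Complex.exp (-(r + z) * t)) t := by
    have h0 : ∀ᵐ t : ℝ, t ≠ 0 := by simp [ae_iff]
    filter_upwards [h0] with t ht
    rcases lt_or_gt_of_ne ht with ht | ht
    · rw [Set.indicator_of_notMem (by simp [ht.le]), exponentialPDF_of_neg ht]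
      simp
    · rw [Set.indicator_of_mem (by simpa using ht), exponentialPDF_of_nonneg ht.le,
        ENNReal.toReal_ofReal (by positivity), Complex.real_smul, Complex.ofReal_mul,
        Complex.ofReal_exp, mul_assoc, ← Complex.exp_add]
      congr 2
      push_cast
      ring
  rw [integral_congr_ae h1, integral_indicator measurableSet_Ioi, integral_const_mul,
    integral_exp_mul_complex_Ioi hre]
  rw [Complex.ofReal_zero, mul_zero, Complex.exp_zero, neg_div_neg_eq, mul_one_div]

variable {ι κ S : Type*} [Nonempty ι] [Fintype ι] [Fintype κ] {attempt : ι → S → S}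
  {done : κ → S → Prop} {rank : S → ℕ}

/-- The joint Laplace transform of the times at which the targets are reached. -/
noncomputable def laplace (attempt : ι → S → S) (done : κ → S → Prop) (x : κ → ℂ) (s : S) : ℂ :=
  ∫ g, Complex.exp (-∑ k, x k * ((hitTime attempt (done k) s g).toReal : ℂ)) ∂(clockLaw ι)

theorem norm_exp_neg_sum_le {x : κ → ℂ} (hx : ∀ k, 0 ≤ (x k).re) {t : κ → ℝ} (ht : ∀ k, 0 ≤ t k) :
    ‖Complex.exp (-∑ k, x k * (t k : ℂ))‖ ≤ 1 := by
  rw [Complex.norm_exp, Real.exp_le_one_iff, Complex.neg_re, Complex.re_sum, neg_nonpos]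
  refine Finset.sum_nonneg fun k _ => ?_
  rw [Complex.re_mul_ofReal]
  exact mul_nonneg (hx k) (ht k)

/-- Decomposition at the first ring of the Laplace transform. -/
theorem IsAbsorbing.isLaplaceTransform (H : IsAbsorbing attempt done rank) {x : κ → ℂ}
    (hx : ∀ k, 0 ≤ (x k).re) :
    IsLaplaceTransform attempt done x (laplace attempt done x) := by
  classical
  constructor
  · intro s
    set X : ℂ := ∑ k, if done k s then 0 else x k with hX
    have hXre : 0 ≤ X.re := by
      rw [hX, Complex.re_sum]
      refine Finset.sum_nonneg fun k _ => ?_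
      split_ifs
      · simp
      · exact hx k
    have hN : (0 : ℝ) < Fintype.card ι := by exact_mod_cast Fintype.card_pos
    have := isProbabilityMeasure_expMeasure_card (ι := ι)
    let E : S → (ι × ℕ → ℝ) → ℂ := fun s g =>
      Complex.exp (-∑ k, x k * ((hitTime attempt (done k) s g).toReal : ℂ))
    have hEm : ∀ s, Measurable (E s) := fun s => by
      have := fun k => measurable_hitTime attempt (done k) s
      fun_prop
    have hE1 : ∀ s g, ‖E s g‖ ≤ 1 := fun s g =>
      norm_exp_neg_sum_le hx fun k => ENNReal.toReal_nonneg
    have hexpint : Integrable (fun t : ℝ => Complex.exp (-X * t))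
        (expMeasure (Fintype.card ι)) := by
      refine Integrable.of_bound (by fun_prop) 1 ?_
      filter_upwards [ae_pos_expMeasure _] with t ht
      rw [Complex.norm_exp, Real.exp_le_one_iff, Complex.re_mul_ofReal, Complex.neg_re]
      nlinarith
    have hEint : ∀ s, Integrable (E s) (clockLaw ι) := fun s =>
      Integrable.of_bound (hEm s).aestronglyMeasurable 1 (Filter.Eventually.of_forall (hE1 s))
    -- Until the first ring, time accrues for exactly the targets not yet reached, which produces
    -- the factor with exponent `-X * firstGap g`. Additivity of `toReal` needs finite hitting
    -- times; these hold almost surely from every successor state.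
    have h1 : laplace attempt done x s
        = ∫ g, (fun (i : ι) (z : ℝ × (ι × ℕ → ℝ)) => Complex.exp (-X * z.1) * E (attempt i s) z.2)
          (firstClock g) (firstGap g, next g) ∂(clockLaw ι) := by
      refine integral_congr_ae ?_
      filter_upwards [ae_pos_clockLaw, ae_next (ae_all_iff.2 fun i => H.ae_exists_done (attempt i s))]
        with g hg hd
      simp only [E]
      rw [← Complex.exp_add]
      congr 1
      have h2 : ∀ k, ((hitTime attempt (done k) s g).toReal : ℂ)
          = (if done k s then 0 else (firstGap g : ℂ))
            + ((hitTime attempt (done k) (attempt (firstClock g) s) (next g)).toReal : ℂ) := by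
        intro k
        rw [hitTime_eq, ENNReal.toReal_add _ (H.hitTime_ne_top (hd _ k))]
        · push_cast
          congr 1
          split_ifs
          · simp
          · rw [ENNReal.toReal_ofReal (show 0 ≤ firstGap g from (hg _).le)]
        · split_ifs <;> simp
      simp only [h2, mul_add, Finset.sum_add_distrib, hX]
      rw [neg_add, neg_mul, Finset.sum_mul]
      congr 3
      funext k
      split_ifs <;> simp
    rw [Finset.sum_sub_distrib, Finset.sum_const, Finset.card_univ, nsmul_eq_mul]
    have h3 : laplace attempt done x s = ∑ i, (Fintype.card ι : ℂ)⁻¹ *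
        ((Fintype.card ι : ℂ) / (Fintype.card ι + X) * laplace attempt done x (attempt i s)) := by
      rw [h1, integral_next (F := fun i z => Complex.exp (-X * z.1) * E (attempt i s) z.2)
        fun i => hexpint.mul_prod (hEint _)]
      refine Finset.sum_congr rfl fun i _ => ?_
      rw [integral_prod_mul (fun t : ℝ => Complex.exp (-X * t)) (E (attempt i s)),
        integral_exp_expMeasure hN hXre]
      simp [laplace, E]
    have hN0 : (Fintype.card ι : ℂ) ≠ 0 := by simp
    have hNX : (Fintype.card ι : ℂ) + X ≠ 0 := by
      intro h
      have := congrArg Complex.re h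
      rw [Complex.add_re, Complex.natCast_re, Complex.zero_re] at this
      linarith
    have h4 : ((Fintype.card ι : ℂ) + X) * laplace attempt done x s
        = ∑ i, laplace attempt done x (attempt i s) := by
      rw [h3, Finset.mul_sum]
      refine Finset.sum_congr rfl fun i _ => ?_
      field_simp
    rw [← h4]
    ring
  · intro s hs
    have h0 : ∀ k g, hitTime attempt (done k) s g = 0 := by
      intro k g
      rw [hitTime, ENNReal.tsum_eq_zero]
      intro m
      rw [if_pos (H.done_stateSeq (Nat.zero_le m) (hs k))]
    simp [laplace, h0]

end Laplace

/-! ### Pathwise agreement of the superposed ring times with the recursive description. -/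

section RingTimes

variable {ι κ S : Type*}

/-- After any number of rings all waiting times are positive; in particular, no two clocks ever
ring simultaneously. -/
structure IsGeneric [Nonempty ι] (g : ι × ℕ → ℝ) : Prop where
  pos : ∀ m p, 0 < next^[m] g p

theorem ae_isGeneric [Nonempty ι] [Fintype ι] : ∀ᵐ g ∂(clockLaw ι), IsGeneric g := by
  filter_upwards [ae_iterate_next ae_pos_clockLaw] with g h using ⟨h⟩

theorem pos_of_mem_ringSet {g : ι × ℕ → ℝ} (hg : ∀ p, 0 < g p) {i : ι} {r : ℝ}
    (hr : r ∈ ringSet (Function.curry g) i) : 0 < r := by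
  obtain ⟨m, rfl⟩ := hr
  exact Finset.sum_pos (fun j _ => hg _) (by simp)

variable [Nonempty ι]

/-- The sum of the first `m` waiting times between consecutive rings of any clocks. -/
noncomputable def totalGap (g : ι × ℕ → ℝ) (m : ℕ) : ℝ :=
  ∑ j ∈ Finset.range m, firstGap (next^[j] g)

theorem totalGap_succ' (g : ι × ℕ → ℝ) (m : ℕ) :
    totalGap g (m + 1) = firstGap g + totalGap (next g) m := by
  simp only [totalGap]
  rw [Finset.sum_range_succ', add_comm]
  rfl

/-- Moving the origin of time to the first ring removes just that ring and shifts all others. This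
is algebra on partial sums and requires no genericity. -/
theorem mem_ringSet_iff {g : ι × ℕ → ℝ} {i : ι} {r : ℝ} :
    r ∈ ringSet (Function.curry g) i ↔ (i = firstClock g ∧ r = firstGap g) ∨
      r - firstGap g ∈ ringSet (Function.curry (next g)) i := by
  by_cases hi : i = firstClock g
  · have hs : ∀ m, ∑ j ∈ Finset.range (m + 1), Function.curry (next g) i j
        = ∑ j ∈ Finset.range (m + 1), g (i, j + 1) := fun m =>
      Finset.sum_congr rfl fun j _ => by simp [Function.curry, next, restart, hi]
    constructor
    · rintro ⟨m, rfl⟩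
      cases m with
      | zero => exact Or.inl ⟨hi, by simp [Function.curry, firstGap, hi]⟩
      | succ m =>
        refine Or.inr ⟨m, ?_⟩
        simp only [hs]
        rw [Finset.sum_range_succ' _ (m + 1)]
        simp [Function.curry, firstGap, hi]
    · rintro (⟨-, rfl⟩ | ⟨m, hm⟩)
      · exact ⟨0, by simp [Function.curry, firstGap, hi]⟩
      · refine ⟨m + 1, ?_⟩
        simp only [hs] at hm
        simp only
        rw [Finset.sum_range_succ' _ (m + 1)]
        rw [← sub_add_cancel r (firstGap g), ← hm]
        simp [Function.curry, firstGap, hi]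
  · have hs : ∀ m, ∑ j ∈ Finset.range (m + 1), Function.curry (next g) i j
        = ∑ j ∈ Finset.range (m + 1), Function.curry g i j - firstGap g := fun m => by
      rw [Finset.sum_range_succ', Finset.sum_range_succ']
      simp [Function.curry, next, restart, hi, firstGap, add_sub_assoc]
    simp only [hi, false_and, false_or, ringSet, Set.mem_range, hs, sub_left_inj]

namespace IsGeneric

variable {g : ι × ℕ → ℝ}

theorem next (hg : IsGeneric g) : IsGeneric (next g) :=
  ⟨fun m => hg.pos (m + 1)⟩

theorem firstGap_pos (hg : IsGeneric g) (m : ℕ) : 0 < firstGap (OrientedSwap.next^[m] g) :=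
  hg.pos m _

theorem strictMono_totalGap (hg : IsGeneric g) : StrictMono (totalGap g) := by
  refine strictMono_nat_of_lt_succ fun m => ?_
  rw [totalGap, totalGap, Finset.sum_range_succ]
  linarith [hg.firstGap_pos m]

theorem totalGap_nonneg (hg : IsGeneric g) (m : ℕ) : 0 ≤ totalGap g m :=
  Finset.sum_nonneg fun j _ => (hg.firstGap_pos j).le

/-- Positivity of all waiting times after a restart excludes a second clock ringing at the same
instant, so the choice made in `stateAfter` is forced. -/
theorem totalGap_mem_ringSet_iff (hg : IsGeneric g) (m : ℕ) {i : ι} :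
    totalGap g (m + 1) ∈ ringSet (Function.curry g) i
      ↔ i = firstClock (OrientedSwap.next^[m] g) := by
  induction m generalizing g with
  | zero =>
    rw [totalGap_succ', mem_ringSet_iff]
    simp only [totalGap, Finset.range_zero, Finset.sum_empty, add_zero, sub_self, and_true,
      Function.iterate_zero, id]
    exact or_iff_left fun h => lt_irrefl _ (pos_of_mem_ringSet (hg.next.pos 0) h)
  | succ m ih =>
    have h0 : 0 < totalGap (OrientedSwap.next g) (m + 1) :=
      (hg.next.totalGap_nonneg m).trans_lt (hg.next.strictMono_totalGap m.lt_succ_self)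
    rw [totalGap_succ', mem_ringSet_iff, add_sub_cancel_left, ih hg.next]
    exact or_iff_right fun h => by linarith [h.2]

theorem isLeast_totalGap (hg : IsGeneric g) (m : ℕ) :
    IsLeast {r | totalGap g m < r ∧ ∃ i, r ∈ ringSet (Function.curry g) i}
      (totalGap g (m + 1)) := by
  refine ⟨⟨hg.strictMono_totalGap m.lt_succ_self, _, (hg.totalGap_mem_ringSet_iff m).2 rfl⟩, ?_⟩
  rintro r ⟨hr, i, hi⟩
  induction m generalizing g r with
  | zero =>
    rw [mem_ringSet_iff] at hi
    rw [totalGap_succ']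
    simp only [totalGap, Finset.range_zero, Finset.sum_empty, add_zero]
    rcases hi with ⟨-, rfl⟩ | hi
    · exact le_rfl
    · linarith [pos_of_mem_ringSet (hg.next.pos 0) hi]
  | succ m ih =>
    rw [totalGap_succ'] at hr ⊢
    rw [mem_ringSet_iff] at hi
    rcases hi with ⟨-, rfl⟩ | hi
    · linarith [hg.next.totalGap_nonneg m]
    · linarith [ih hg.next (by linarith) hi]

theorem ringTime_eq (hg : IsGeneric g) (m : ℕ) : ringTime (Function.curry g) m = totalGap g m := by
  induction m with
  | zero => simp [ringTime, totalGap]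
  | succ m ih => rw [ringTime, ih, (hg.isLeast_totalGap m).csInf_eq]

theorem stateAfter_eq (hg : IsGeneric g) (attempt : ι → S → S) (s : S) (m : ℕ) :
    stateAfter attempt s (Function.curry g) m = stateSeq attempt s g m := by
  induction m with
  | zero => rfl
  | succ m ih =>
    have h : ∃ i, ringTime (Function.curry g) (m + 1) ∈ ringSet (Function.curry g) i := by
      rw [hg.ringTime_eq]
      exact ⟨_, (hg.totalGap_mem_ringSet_iff m).2 rfl⟩
    have hc : h.choose = firstClock (OrientedSwap.next^[m] g) := by
      refine (hg.totalGap_mem_ringSet_iff m).1 ?_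
      rw [← hg.ringTime_eq]
      exact h.choose_spec
    rw [stateAfter, dif_pos h, hc, ih, stateSeq_succ]

variable {attempt : ι → S → S} {done : κ → S → Prop} {rank : S → ℕ}

open Classical in
theorem toReal_hitTime (hg : IsGeneric g) (H : IsAbsorbing attempt done rank) {k : κ} {s : S}
    (h : ∃ m, done k (stateSeq attempt s g m)) :
    (hitTime attempt (done k) s g).toReal = totalGap g (Nat.find h) := by
  rw [H.hitTime_eq_sum h, ENNReal.toReal_sum (by simp), totalGap]
  exact Finset.sum_congr rfl fun m _ => ENNReal.toReal_ofReal (hg.firstGap_pos m).le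

end IsGeneric

end RingTimes

/-! ### Both processes are absorbing systems. -/

section Targets

variable {n : ℕ}

/-- Pigeonhole: the `k + 1` largest labels are used up by the positions up to `k`. -/
theorem lt_of_swapDone {k : Fin (n - 1)} {σ : Equiv.Perm (Fin n)} (h : swapDone k σ) {q : Fin n}
    (hq : leftPos k < q) : (σ q : ℕ) + k + 1 < n := by
  by_contra hc
  have hn : n - 1 - k < n := by omega
  have hcard : (insert q (Finset.Iic (leftPos k))).card
      ≤ (Finset.Ici (⟨n - 1 - k, hn⟩ : Fin n)).card := by
    refine Finset.card_le_card_of_injOn σ ?_ σ.injective.injOn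
    intro p hp
    have : n ≤ (σ p : ℕ) + k + 1 := by
      rcases Finset.mem_insert.1 hp with rfl | hp
      · omega
      · exact h p (Fin.le_def.1 (Finset.mem_Iic.1 hp))
    simp only [Finset.coe_Ici, Set.mem_Ici, Fin.le_def]
    omega
  rw [Finset.card_insert_of_notMem (by simpa using hq), Fin.card_Iic, Fin.card_Ici] at hcard
  simp only [leftPos] at hcard
  omega

/-- For `i ≠ k` the two exchanged positions lie on the same side of the cut between `k` and `k + 1`.
-/
theorem swapDone_swapAt_iff {i k : Fin (n - 1)} (hik : i ≠ k) (σ : Equiv.Perm (Fin n)) :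
    swapDone k (swapAt i σ) ↔ swapDone k σ := by
  have hle : ∀ p : Fin n, (Equiv.swap (leftPos i) (rightPos i) p : ℕ) ≤ k ↔ (p : ℕ) ≤ k := by
    intro p
    have hik' : (i : ℕ) ≠ k := fun h => hik (Fin.ext h)
    rcases eq_or_ne p (leftPos i) with rfl | h1
    · rw [Equiv.swap_apply_left]
      simp only [leftPos, rightPos]
      omega
    · rcases eq_or_ne p (rightPos i) with rfl | h2
      · rw [Equiv.swap_apply_right]
        simp only [leftPos, rightPos]
        omega
      · rw [Equiv.swap_apply_of_ne_of_ne h1 h2]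
  constructor
  · intro h p hp
    have := h (Equiv.swap (leftPos i) (rightPos i) p) ((hle p).2 hp)
    simpa [swapAt] using this
  · intro h p hp
    exact h _ ((hle p).2 hp)

/-- The label at `k` now exceeds the one at `k + 1`, so no swap there succeeds. As `lastSwapTime`
recognises swaps by comparing configurations, attempts at other places and failed attempts are also
excluded, by looking at the left position `k`. -/
theorem attemptSwap_ne_swapAt {k : Fin (n - 1)} {σ : Equiv.Perm (Fin n)} (h : swapDone k σ)
    (i : Fin (n - 1)) : attemptSwap i σ ≠ swapAt k σ := by
  have hd : (σ (rightPos k) : ℕ) < σ (leftPos k) := by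
    have h1 := lt_of_swapDone h (q := rightPos k) (by simp [leftPos, rightPos, Fin.lt_def])
    have h2 := h (leftPos k) le_rfl
    omega
  intro he
  by_cases hi : σ (leftPos i) < σ (rightPos i)
  · rw [attemptSwap_of_lt hi] at he
    have h1 := congrArg (fun τ => τ (leftPos k)) (mul_left_cancel he)
    simp only [Equiv.swap_apply_left] at h1
    by_cases hik : i = k
    · subst hik
      exact absurd hi (not_lt.2 (Fin.le_def.2 hd.le))
    · have hik' : (i : ℕ) ≠ k := fun h => hik (Fin.ext h)
      rw [Equiv.swap_apply_def] at h1
      split_ifs at h1 with h2 h3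
      · exact hik' (by simpa [leftPos] using congrArg Fin.val h2.symm)
      · have h4 : (k : ℕ) = i + 1 := congrArg Fin.val h3
        have h5 : (i : ℕ) = k + 1 := congrArg Fin.val h1
        omega
      · exact leftPos_ne_rightPos k h1
  · rw [attemptSwap_of_not_lt hi] at he
    have h1 := congrArg (fun τ => τ (leftPos k)) he
    simp only [swapAt, Equiv.Perm.mul_apply, Equiv.swap_apply_left] at h1
    exact leftPos_ne_rightPos k (σ.injective h1)

theorem swapDone_attemptSwap {k : Fin (n - 1)} {σ : Equiv.Perm (Fin n)} (h : swapDone k σ)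
    (i : Fin (n - 1)) : swapDone k (attemptSwap i σ) := by
  by_cases hi : σ (leftPos i) < σ (rightPos i)
  · have hne := attemptSwap_ne_swapAt h i
    rw [attemptSwap_of_lt hi] at hne ⊢
    exact (swapDone_swapAt_iff (fun hik => hne (by rw [hik])) σ).2 h
  · rwa [attemptSwap_of_not_lt hi]

theorem attemptSwap_eq_swapAt {i k : Fin (n - 1)} {σ : Equiv.Perm (Fin n)} (h : ¬ swapDone k σ)
    (h' : swapDone k (attemptSwap i σ)) : attemptSwap i σ = swapAt k σ := by
  by_cases hi : σ (leftPos i) < σ (rightPos i)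
  · rw [attemptSwap_of_lt hi] at h' ⊢
    by_cases hik : i = k
    · rw [hik]
    · exact absurd ((swapDone_swapAt_iff hik σ).1 h') h
  · rw [attemptSwap_of_not_lt hi] at h'
    exact absurd h' h

theorem not_swapDone_one (k : Fin (n - 1)) : ¬ swapDone k (1 : Equiv.Perm (Fin n)) := by
  intro h
  have hk := k.isLt
  have h0 : 0 < n := by omega
  have h1 : n ≤ 0 + (k : ℕ) + 1 := h ⟨0, h0⟩ (Nat.zero_le _)
  omega

/-- Moving the larger label one place to the left lowers `∑ p, p * σ p` by the difference of the two
labels; this sum serves as the rank. -/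
theorem sum_mul_swapAt_lt {k : Fin (n - 1)} {σ : Equiv.Perm (Fin n)}
    (h : σ (leftPos k) < σ (rightPos k)) :
    ∑ p : Fin n, (p : ℕ) * (swapAt k σ p : ℕ) < ∑ p : Fin n, (p : ℕ) * (σ p : ℕ) := by
  have hne := leftPos_ne_rightPos k
  have hsplit : ∀ f : Fin n → ℕ, ∑ p, f p = f (leftPos k) + (f (rightPos k)
      + ∑ p ∈ (Finset.univ.erase (leftPos k)).erase (rightPos k), f p) := fun f => by
    rw [Finset.add_sum_erase _ _ (by simp [hne.symm]), Finset.add_sum_erase _ _ (by simp)]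
  rw [hsplit, hsplit fun p : Fin n => (p : ℕ) * (σ p : ℕ)]
  have hrest : ∑ p ∈ (Finset.univ.erase (leftPos k)).erase (rightPos k), (p : ℕ) * (swapAt k σ p : ℕ)
      = ∑ p ∈ (Finset.univ.erase (leftPos k)).erase (rightPos k), (p : ℕ) * (σ p : ℕ) := by
    refine Finset.sum_congr rfl fun p hp => ?_
    simp only [Finset.mem_erase, Finset.mem_univ, and_true] at hp
    rw [swapAt, Equiv.Perm.mul_apply, Equiv.swap_apply_of_ne_of_ne hp.2 hp.1]
  rw [hrest]
  have h' : (σ (leftPos k) : ℕ) < σ (rightPos k) := h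
  simp only [swapAt, Equiv.Perm.mul_apply, Equiv.swap_apply_left, Equiv.swap_apply_right]
  have hl : (leftPos k : ℕ) = k := rfl
  have hr : (rightPos k : ℕ) = k + 1 := rfl
  rw [hl, hr]
  nlinarith

theorem le_of_forall_not_lt {σ : Equiv.Perm (Fin n)}
    (h : ∀ k, ¬ σ (leftPos k) < σ (rightPos k)) (p : Fin n) : n ≤ (σ p : ℕ) + p + 1 := by
  -- Without ascents `σ` is strictly decreasing, so its values grow by at least one per step to the
  -- left; the induction runs over the distance `d` from the last position.
  obtain ⟨d, hd⟩ : ∃ d, (p : ℕ) + d + 1 = n := ⟨n - 1 - p, by omega⟩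
  induction d generalizing p with
  | zero => omega
  | succ d ih =>
    have hp : (p : ℕ) < n - 1 := by omega
    have h1 := ih (rightPos ⟨p, hp⟩) (by simp [rightPos]; omega)
    have h2 : ¬ σ p < σ (rightPos ⟨p, hp⟩) := h ⟨p, hp⟩
    have h3 : σ p ≠ σ (rightPos ⟨p, hp⟩) := fun he =>
      leftPos_ne_rightPos ⟨p, hp⟩ (σ.injective he)
    have h4 : (σ (rightPos ⟨p, hp⟩) : ℕ) < σ p := Fin.lt_def.1 (lt_of_le_of_ne (not_lt.1 h2) h3.symm)
    have h5 : (rightPos ⟨p, hp⟩ : Fin n).val = p + 1 := rfl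
    omega

theorem isAbsorbing_attemptSwap : IsAbsorbing (attemptSwap (n := n)) swapDone
    fun σ => ∑ p : Fin n, (p : ℕ) * (σ p : ℕ) where
  done_attempt _ i _ h := swapDone_attemptSwap h i
  rank_lt i σ h := by
    have hi : σ (leftPos i) < σ (rightPos i) := by
      by_contra hi
      exact h (attemptSwap_of_not_lt hi)
    rw [attemptSwap_of_lt hi]
    exact sum_mul_swapAt_lt hi
  exists_ne k σ h := by
    by_contra! hc
    refine h fun p hp => ?_
    have hp' : (p : ℕ) ≤ k := hp
    have := le_of_forall_not_lt (σ := σ) (fun i hi => ?_) p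
    · omega
    · have h1 := sum_mul_swapAt_lt hi
      rw [← attemptSwap_of_lt hi, hc i] at h1
      exact lt_irrefl _ h1

theorem mem_attemptBox_of_mem {c : StaircaseBox n} {Y : YoungDiagram} {b : ℕ × ℕ} (h : b ∈ Y) :
    b ∈ attemptBox c Y := by
  by_cases hl : IsLowerSet (insert c.1 Y.cells : Set (ℕ × ℕ))
  · exact (mem_attemptBox hl b).2 (Or.inr h)
  · rwa [attemptBox_of_not_isLowerSet hl]

open Classical in
theorem isAbsorbing_attemptBox : IsAbsorbing (attemptBox (n := n)) (boxDone (n := n))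
    fun Y => (Finset.univ.filter fun c : StaircaseBox n => c.1 ∉ Y).card where
  done_attempt _ _ _ h := mem_attemptBox_of_mem h
  rank_lt c Y h := by
    have hc : c.1 ∉ Y := fun hc => h (attemptBox_of_mem hc)
    have hl : IsLowerSet (insert c.1 Y.cells : Set (ℕ × ℕ)) := by
      by_contra hl
      exact h (attemptBox_of_not_isLowerSet hl)
    refine Finset.card_lt_card (Finset.ssubset_iff_of_subset ?_ |>.2 ⟨c, ?_, ?_⟩)
    · intro b hb
      simp only [Finset.mem_filter, Finset.mem_univ, true_and] at hb ⊢
      exact fun hY => hb (mem_attemptBox_of_mem hY)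
    · simpa using hc
    · simpa using (mem_attemptBox hl c.1).2 (Or.inl rfl)
  exists_ne k Y h := by
    obtain ⟨c, hc, hl⟩ := exists_addable h
    exact ⟨c, fun he => hc (he ▸ (mem_attemptBox hl c.1).2 (Or.inl rfl))⟩

end Targets

/-! ### Last swap times and box times are hitting times. -/

section HittingTimes

variable {n : ℕ}

theorem boxTime_eq_hitTime [Nonempty (StaircaseBox n)] {g : StaircaseBox n × ℕ → ℝ}
    (hg : IsGeneric g) (k : Fin (n - 1)) (h : ∃ m, boxDone k (stateSeq attemptBox ⊥ g m)) :
    boxTime (Function.curry g) (cornerBox k) = (hitTime attemptBox (boxDone k) ⊥ g).toReal := by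
  classical
  rw [hg.toReal_hitTime isAbsorbing_attemptBox h, boxTime]
  refine IsLeast.csInf_eq ⟨⟨_, (hg.ringTime_eq _).symm, ?_⟩, ?_⟩
  · rw [growthProcess, hg.stateAfter_eq]
    exact Nat.find_spec h
  · rintro _ ⟨m, rfl, hm⟩
    rw [growthProcess, hg.stateAfter_eq] at hm
    rw [hg.ringTime_eq]
    exact hg.strictMono_totalGap.monotone (Nat.find_min' h hm)

theorem lastSwapTime_eq_hitTime [Nonempty (Fin (n - 1))] {g : Fin (n - 1) × ℕ → ℝ}
    (hg : IsGeneric g) (k : Fin (n - 1)) (h : ∃ m, swapDone k (stateSeq attemptSwap 1 g m)) :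
    lastSwapTime (Function.curry g) k = (hitTime attemptSwap (swapDone k) 1 g).toReal := by
  classical
  rw [hg.toReal_hitTime isAbsorbing_attemptSwap h, lastSwapTime]
  -- The identity has reached no target, so the target is reached at an actual ring, as the index `m
  -- + 1` in `lastSwapTime` demands.
  have h0 : Nat.find h ≠ 0 := fun h0 => not_swapDone_one k ((Nat.find_eq_zero h).1 h0)
  obtain ⟨m, hm⟩ := Nat.exists_eq_succ_of_ne_zero h0
  refine IsGreatest.csSup_eq ⟨⟨m, ?_, ?_⟩, ?_⟩
  · rw [hg.ringTime_eq, hm]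
  · have h1 := Nat.find_spec h
    have h2 := Nat.find_min h (m := m) (by omega)
    rw [hm, Nat.succ_eq_add_one, stateSeq_succ] at h1
    rw [swapProcess, hg.stateAfter_eq, hg.stateAfter_eq, stateSeq_succ]
    exact attemptSwap_eq_swapAt h2 h1
  · rintro _ ⟨l, rfl, hl⟩
    rw [swapProcess, hg.stateAfter_eq, hg.stateAfter_eq, stateSeq_succ] at hl
    rw [hg.ringTime_eq]
    -- A swap at `k` at a later ring would start from a configuration in which the target is already
    -- reached.
    refine hg.strictMono_totalGap.monotone (Nat.succ_le_of_lt (not_le.1 fun hle => ?_))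
    exact attemptSwap_ne_swapAt (isAbsorbing_attemptSwap.done_stateSeq hle (Nat.find_spec h)) _ hl

end HittingTimes

/-! ### From Laplace transforms to equality of joint laws. -/

section JointLaw

variable {ι κ S Ω : Type*} [MeasurableSpace Ω]

/-- Independence together with the marginal laws means that the joint law is the product measure, so
everything can be proved on the canonical space. -/
theorem IsPoissonClocks.hasLaw_clockLaw [Countable ι] {μ : Measure Ω} {gap : ι → ℕ → Ω → ℝ}
    (h : IsPoissonClocks μ gap) :
    HasLaw (fun ω (p : ι × ℕ) => gap p.1 p.2 ω) (clockLaw ι) μ :=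
  h.iIndepFun_gap.hasLaw_infinitePi (fun p => h.hasLaw_gap p.1 p.2)
    (aemeasurable_pi_iff.2 fun p => (h.hasLaw_gap p.1 p.2).aemeasurable)

variable [Nonempty ι] [Fintype ι] {attempt : ι → S → S} {done : κ → S → Prop} {rank : S → ℕ}

/-- The times at which the targets are reached. -/
noncomputable def hitTimes (attempt : ι → S → S) (done : κ → S → Prop) (s : S)
    (g : ι × ℕ → ℝ) (k : κ) : ℝ :=
  (hitTime attempt (done k) s g).toReal

theorem measurable_hitTimes (attempt : ι → S → S) (done : κ → S → Prop) (s : S) :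
    Measurable (hitTimes attempt done s) :=
  measurable_pi_lambda _ fun k => (measurable_hitTime attempt (done k) s).ennreal_toReal

/-- With `x k = -I * L (Pi.single k 1)`, the exponent `-∑ k, x k * t k` equals `I * L t`, and every
`x k` is purely imaginary. -/
theorem charFunDual_map_hitTimes [Fintype κ] [DecidableEq κ] (s : S) (L : StrongDual ℝ (κ → ℝ)) :
    charFunDual ((clockLaw ι).map (hitTimes attempt done s)) L
      = laplace attempt done (fun k => -Complex.I * L (Pi.single k 1)) s := by
  rw [charFunDual_apply, integral_map (measurable_hitTimes attempt done s).aemeasurable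
    (by fun_prop), laplace]
  refine integral_congr_ae (Filter.Eventually.of_forall fun g => ?_)
  have hL : ∀ v : κ → ℝ, L v = ∑ k, v k * L (Pi.single k 1) := fun v => by
    conv_lhs => rw [← Finset.univ_sum_single v, map_sum]
    refine Finset.sum_congr rfl fun k _ => ?_
    rw [← smul_eq_mul, ← map_smul, ← Pi.single_smul, smul_eq_mul, mul_one]
  simp only
  rw [hL]
  congr 1
  push_cast
  rw [Finset.sum_mul, ← Finset.sum_neg_distrib]
  refine Finset.sum_congr rfl fun k _ => ?_
  rw [hitTimes]
  ring

/-- The hitting times of two systems have the same joint law if their joint Laplace transforms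
agree at purely imaginary arguments. -/
theorem map_hitTimes_eq [Fintype κ] {ι' S' : Type*} [Nonempty ι'] [Fintype ι']
    {attempt' : ι' → S' → S'} {done' : κ → S' → Prop} {s : S} {s' : S'}
    (h : ∀ x : κ → ℂ, (∀ k, (x k).re = 0) →
      laplace attempt done x s = laplace attempt' done' x s') :
    (clockLaw ι).map (hitTimes attempt done s) = (clockLaw ι').map (hitTimes attempt' done' s') := by
  classical
  have := Measure.isProbabilityMeasure_map (μ := clockLaw ι)
    (measurable_hitTimes attempt done s).aemeasurable
  have := Measure.isProbabilityMeasure_map (μ := clockLaw ι')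
    (measurable_hitTimes attempt' done' s').aemeasurable
  refine Measure.ext_of_charFunDual ?_
  funext L
  rw [charFunDual_map_hitTimes, charFunDual_map_hitTimes]
  exact h _ fun k => by simp

variable {n : ℕ}

theorem map_swap_hitTimes_eq_map_box_hitTimes (hn₂ : 2 ≤ n) (hn₆ : n ≤ 6)
    [Nonempty (Fin (n - 1))] [Nonempty (StaircaseBox n)] :
    (clockLaw (Fin (n - 1))).map (hitTimes attemptSwap (swapDone (n := n)) 1)
      = (clockLaw (StaircaseBox n)).map (hitTimes attemptBox (boxDone (n := n)) ⊥) := by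
  refine map_hitTimes_eq fun x hx => ?_
  exact laplaceTransform_eq (by omega) (checkTable_table hn₂ hn₆) (fun k => (hx k).ge)
    (isAbsorbing_attemptSwap.isLaplaceTransform fun k => (hx k).ge)
    (isAbsorbing_attemptBox.isLaplaceTransform fun k => (hx k).ge)

theorem U_ae_eq [Nonempty (Fin (n - 1))] {μ : Measure Ω} {gap : Fin (n - 1) → ℕ → Ω → ℝ}
    (h : IsPoissonClocks μ gap) :
    U gap =ᵐ[μ] hitTimes attemptSwap swapDone 1 ∘ fun ω p => gap p.1 p.2 ω := by
  have hg : ∀ᵐ g ∂(clockLaw (Fin (n - 1))),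
      (fun k => lastSwapTime (Function.curry g) k) = hitTimes attemptSwap swapDone 1 g := by
    filter_upwards [ae_isGeneric, isAbsorbing_attemptSwap.ae_exists_done 1] with g hg hd
    funext k
    exact lastSwapTime_eq_hitTime hg k (hd k)
  rw [← h.hasLaw_clockLaw.map_eq] at hg
  exact ae_of_ae_map h.hasLaw_clockLaw.aemeasurable hg

theorem V_ae_eq [Nonempty (StaircaseBox n)] {μ : Measure Ω} {gap : StaircaseBox n → ℕ → Ω → ℝ}
    (h : IsPoissonClocks μ gap) :
    V gap =ᵐ[μ] hitTimes attemptBox boxDone ⊥ ∘ fun ω p => gap p.1 p.2 ω := by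
  have hg : ∀ᵐ g ∂(clockLaw (StaircaseBox n)),
      (fun k => boxTime (Function.curry g) (cornerBox k)) = hitTimes attemptBox boxDone ⊥ g := by
    filter_upwards [ae_isGeneric, isAbsorbing_attemptBox.ae_exists_done ⊥] with g hg hd
    funext k
    exact boxTime_eq_hitTime hg k (hd k)
  rw [← h.hasLaw_clockLaw.map_eq] at hg
  exact ae_of_ae_map h.hasLaw_clockLaw.aemeasurable hg

end JointLaw

end OrientedSwap

theorem theorem1p3 (n : ℕ) (hn₂ : 2 ≤ n) (hn₆ : n ≤ 6)
    {Ω₁ Ω₂ : Type*} [MeasurableSpace Ω₁] [MeasurableSpace Ω₂]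
    (μ₁ : Measure Ω₁) [IsProbabilityMeasure μ₁] (μ₂ : Measure Ω₂) [IsProbabilityMeasure μ₂]
    (swapGap : Fin (n - 1) → ℕ → Ω₁ → ℝ)
    (hswap : OrientedSwap.IsPoissonClocks μ₁ swapGap)
    (boxGap : OrientedSwap.StaircaseBox n → ℕ → Ω₂ → ℝ)
    (hbox : OrientedSwap.IsPoissonClocks μ₂ boxGap) :
    IdentDistrib (OrientedSwap.U swapGap) (OrientedSwap.V boxGap) μ₁ μ₂ := by
  have : Nonempty (Fin (n - 1)) := ⟨⟨0, by omega⟩⟩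
  have : Nonempty (OrientedSwap.StaircaseBox n) := ⟨⟨(0, 0), by simp only; omega⟩⟩
  have hU := OrientedSwap.U_ae_eq hswap
  have hV := OrientedSwap.V_ae_eq hbox
  have hmU := OrientedSwap.measurable_hitTimes OrientedSwap.attemptSwap
    (OrientedSwap.swapDone (n := n)) 1
  have hmV := OrientedSwap.measurable_hitTimes (OrientedSwap.attemptBox (n := n))
    (OrientedSwap.boxDone (n := n)) ⊥
  have hlU := hswap.hasLaw_clockLaw
  have hlV := hbox.hasLaw_clockLaw
  -- `U` and `V` are built from infima, suprema and choices; their almost everywhere measurability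
  -- is inherited from the hitting times.
  refine ⟨(hmU.comp_aemeasurable hlU.aemeasurable).congr hU.symm,
    (hmV.comp_aemeasurable hlV.aemeasurable).congr hV.symm, ?_⟩
  rw [Measure.map_congr hU, Measure.map_congr hV,
    ← AEMeasurable.map_map_of_aemeasurable hmU.aemeasurable hlU.aemeasurable,
    ← AEMeasurable.map_map_of_aemeasurable hmV.aemeasurable hlV.aemeasurable,
    hlU.map_eq, hlV.map_eq, OrientedSwap.map_swap_hitTimes_eq_map_box_hitTimes hn₂ hn₆]
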